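/- Fix $\tau\in\mathbb C$ with $\operatorname{Im}\tau>0$, put $\Lambda=\mathbb Z+\tau\mathbb Z$, and let $m\ge 1$. With $q=e^{2\pi i\tau}$, $y=e^{2\pi i x}$ and $(a;q)=\prod_{j\ge0}(1-aq^j)$ let $$\theta(x)=\frac{\sin \pi x}{\pi}\,(qy;q)(q/y;q)(q;q)^{-2},\qquad \rho=\theta'/\theta,\qquad \sigma(x,w)=\frac{\theta(x+w)}{\theta(x)\theta(w)}.$$ **Bethe solutions.** A solution of the Bethe ansatz equations is a triple $(\mu,t,z)\in\mathbb C\times\mathbb C^m\times\mathbb C^{2m}$ such that the $t_j$ are pairwise distinct modulo $\Lambda$, no $t_j$ equals a $z_a$ modulo $\Lambda$, and $$2\pi i\mu+2\sum_{k\ne j}\rho(t_j-t_k)-\sum_{a=1}^{2m}\rho(t_j-z_a)=0,\qquad j=1,\dots,m.$$ Solutions are called equivalent if they are related by a sequence of permutations of the $t_j$, permutations of the $z_a$, and the transformations $t_j\mapsto t_j\pm1$; $z_a\mapsto z_a\pm1$; $(\mu,t_j)\mapsto(\mu\mp2,t_j\pm\tau)$; $(\mu,z_a)\mapsto(\mu\pm1,z_a\pm\tau)$.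 **The operator $\mathcal D_{(\mu,t,z)}$.** Let $V=(\mathbb C^2)^{\otimes 2m}$, where $\mathbb C^2$ is the $\mathfrak{sl}_2$-module with standard basis $v_1,v_2$, regarded as a $\mathfrak{gl}_2$-module on which $e_{11}+e_{22}$ acts by $0$; let $e_{jl}^{(k)}$ be the action of $e_{jl}$ in the $k$-th factor, and $e_{jl}=\sum_k e_{jl}^{(k)}$ on $V$. For $\lambda=(\lambda_1,\lambda_2)$ and $\lambda_{jl}=\lambda_j-\lambda_l$ let $e^+_{jj}(x)=\sum_k\rho(x-z_k)e_{jj}^{(k)}$, $e^+_{jl}(x)=\sum_k\sigma(x-z_k,\lambda_{jl})e_{jl}^{(k)}$ for $j\ne l$, and $L_{jj}=e^+_{jj}+\sum_{l\ne j}\rho(\lambda_{jl})e_{ll}$, $L_{jl}=e^+_{lj}$ for $j\neq l$. The RST-operator is the column determinant $X_{11}X_{22}-X_{21}X_{12}$ of the matrix $X_{jl}=\delta_{jl}\partial_x-\delta_{jl}\partial_{\lambda_j}+L_{jl}(x)$, written as $\partial_x^2+S_1(x)\partial_x+S_2(x)$, where the $S_i(x)$ act on meromorphic functions of $\lambda_{12}$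 with values in the zero weight space $V[0]$. The Bethe function is $$\Psi(\lambda_{12},\mu,t,z)=e^{\pi i\mu\lambda_{12}}\sum_{I\subset\{1,\dots,2m\},\ |I|=m}\Big(\sum_{\pi\in S_m}\prod_{j=1}^m\sigma(t_{\pi(j)}-z_{i_j},-\lambda_{12})\Big)v_I,\qquad I=\{i_1<\dots<i_m\},$$ where $v_I\in V$ is the tensor product of basis vectors with $v_2$ at the places in $I$ and $v_1$ elsewhere. If $\Psi\not\equiv 0$ and $S_i(x)\Psi=B_i(x)\Psi$, $i=1,2$, with scalar functions $B_i(x)$, then the fundamental differential operator of $(\mu,t,z)$ is $\mathcal D_{(\mu,t,z)}=\partial_x^2+B_1(x)\partial_x+B_2(x)$. **The pair $\beta(\mu,t,z)$.** A theta-polynomial of degree $m$ with multipliers $A,B\in\mathbb C^\times$ is an entire function $f$ with $f(x+1)=A(-1)^mf(x)$ and $f(x+\tau)=B(-1)^me^{-\pi i m\tau-2\pi i m x}f(x)$. Consider pairs $(f,g)$ of nonzero theta-polynomials of degree $m$ such that the first multiplier $A$ of $f$ is $1$ and that of $g$ is not $1$; identify $(f,g)$ with $(c\,e^{2\pi i k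 x}f,\ d\,e^{2\pi i kx}g)$ for $c,d\in\mathbb C^\times$, $k\in\mathbb Z$. Put $\operatorname{Wr}(f,g)=fg'-f'g$; the class of $(f,g)$ has generic first coordinate if $f$ and $\operatorname{Wr}(f,g)$ have no common zeros. For a solution $(\mu,t,z)$ with $\mu\notin\mathbb Z$, $\beta(\mu,t,z)$ is the class with generic first coordinate of a pair $(f,g)$ with $$f=\prod_{j}\theta(x-t'_j),\qquad \operatorname{Wr}(f,g)=\mathrm{const}\cdot e^{-2\pi i\mu' x}\prod_{a}\theta(x-z'_a),\quad \mathrm{const}\neq0,$$ where $(\mu',t',z')$ is any solution equivalent to $(\mu,t,z)$. For a pair $(f,g)$ let $\mathcal D_{(f,g)}$ be the monic second order linear differential operator with meromorphic coefficients whose kernel (on every connected open set on which $\operatorname{Wr}(f,g)$ has no zeros and $\sqrt{\operatorname{Wr}(f,g)}$ has a holomorphic branch) is spanned by $f/\sqrt{\operatorname{Wr}(f,g)}$ and $g/\sqrt{\operatorname{Wr}(f,g)}$. **Theorem.** Let $(\mu,t,z)$ be a solution of the Bethe ansatz equations with $\mu\notin\mathbb Z$. Then the class $\beta(\mu,t,z)$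 exists and is unique, the operators $\mathcal D_{(\mu,t,z)}$ and $\mathcal D_{(f,g)}$, for every representative $(f,g)$ of $\beta(\mu,t,z)$, exist and are uniquely determined on $\mathbb C\setminus\bigcup_a(z_a+\Lambda)$, and there $$\mathcal D_{(\mu,t,z)}=\mathcal D_{(f,g)}.$$ -/

import Mathlib

noncomputable section

namespace EllipticBethe

open Real Complex

/-! ### Theta functions -/

/-- The normalized first Jacobi theta function
`θ(x,τ) = (sin(πx)/π) (qz;q)(q/z;q)(q;q)⁻²` with `z = e^{2πix}`, `q = e^{2πiτ}`,
where `(a;q) = ∏_{j ≥ 0} (1 - a q^j)`. -/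
def theta (τ x : ℂ) : ℂ :=
  Complex.sin (π * x) / π *
    (∏' j : ℕ, (1 - cexp (2 * π * I * τ) * cexp (2 * π * I * x) * cexp (2 * π * I * τ) ^ j)) *
    (∏' j : ℕ, (1 - cexp (2 * π * I * τ) / cexp (2 * π * I * x) * cexp (2 * π * I * τ) ^ j)) /
    (∏' j : ℕ, (1 - cexp (2 * π * I * τ) * cexp (2 * π * I * τ) ^ j)) ^ 2

/-- `ρ = θ'/θ`. -/
def rho (τ x : ℂ) : ℂ := deriv (theta τ) x / theta τ x

/-- `σ(x,w) = θ(x+w) / (θ(x) θ(w))`. -/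
def sigma (τ x w : ℂ) : ℂ := theta τ (x + w) / (theta τ x * theta τ w)

/-- `x` lies in the lattice `ℤ + τℤ`. -/
def InLattice (τ x : ℂ) : Prop := ∃ k l : ℤ, x = k + l * τ

/-! ### Bethe ansatz equations -/

/-- A triple `(μ, t, z)` with `t ∈ ℂ^m`, `z ∈ ℂ^{2m}`. -/
structure BetheData (m : ℕ) where
  mu : ℂ
  t : Fin m → ℂ
  z : Fin (2 * m) → ℂ

/-- `(μ, t, z)` solves the Bethe ansatz equations (which presupposes that the arguments of `ρ`
are not poles). -/
structure IsBetheSolution (τ : ℂ) {m : ℕ} (s : BetheData m) : Prop where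
  t_distinct : ∀ i j, i ≠ j → ¬ InLattice τ (s.t i - s.t j)
  t_ne_z : ∀ i a, ¬ InLattice τ (s.t i - s.z a)
  bethe : ∀ j, 2 * π * I * s.mu + 2 * ∑ k ∈ Finset.univ.erase j, rho τ (s.t j - s.t k)
    - ∑ a, rho τ (s.t j - s.z a) = 0

/-- Elementary transformations of solutions: permutations of the `t_j` and of the `z_a`,
and shifts of single coordinates by lattice elements. -/
inductive BetheStep (τ : ℂ) {m : ℕ} : BetheData m → BetheData m → Prop
  | permT (s : BetheData m) (e : Equiv.Perm (Fin m)) : BetheStep τ s ⟨s.mu, s.t ∘ e, s.z⟩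
  | permZ (s : BetheData m) (e : Equiv.Perm (Fin (2 * m))) : BetheStep τ s ⟨s.mu, s.t, s.z ∘ e⟩
  | tTau (s : BetheData m) (j : Fin m) :
      BetheStep τ s ⟨s.mu - 2, Function.update s.t j (s.t j + τ), s.z⟩
  | tOne (s : BetheData m) (j : Fin m) :
      BetheStep τ s ⟨s.mu, Function.update s.t j (s.t j + 1), s.z⟩
  | zTau (s : BetheData m) (a : Fin (2 * m)) :
      BetheStep τ s ⟨s.mu + 1, s.t, Function.update s.z a (s.z a + τ)⟩
  | zOne (s : BetheData m) (a : Fin (2 * m)) :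
      BetheStep τ s ⟨s.mu, s.t, Function.update s.z a (s.z a + 1)⟩

/-- Equivalence of solutions: the equivalence relation generated by the elementary
transformations. -/
def BetheEquiv (τ : ℂ) {m : ℕ} : BetheData m → BetheData m → Prop :=
  Relation.EqvGen (BetheStep τ)

/-! ### The module `V = (ℂ²)^{⊗ n}` and the RST-operator -/

/-- `(ℂ²)^{⊗ n}`, in coordinates with respect to the basis `v_{J 0} ⊗ ⋯ ⊗ v_{J (n-1)}`;
the index `0` stands for `v_1` and `1` for `v_2`. -/
abbrev TensorPower (n : ℕ) : Type := (Fin n → Fin 2) → ℂ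

/-- The action of `A` in the `k`-th tensor factor. -/
def site {n : ℕ} (k : Fin n) (A : Matrix (Fin 2) (Fin 2) ℂ) (v : TensorPower n) : TensorPower n :=
  fun J => ∑ i, A (J k) i * v (Function.update J k i)

/-- The action of `e_{jl} ∈ 𝔤𝔩₂` on the `𝔰𝔩₂`-module `ℂ²`, extended to `𝔤𝔩₂` so that the central
element `e_{11} + e_{22}` acts by zero. -/
def glMat (j l : Fin 2) : Matrix (Fin 2) (Fin 2) ℂ :=
  Matrix.single j l 1 - if j = l then (1 / 2 : ℂ) • (1 : Matrix (Fin 2) (Fin 2) ℂ) else 0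

/-- `e⁺_{jj}(x) = ∑_k ρ(x - z_k) e_{jj}^{(k)}`, and
`e⁺_{jl}(x) = ∑_k σ(x - z_k, λ_j - λ_l) e_{jl}^{(k)}` for `j ≠ l`. -/
def ePlus (τ : ℂ) {n : ℕ} (z : Fin n → ℂ) (j l : Fin 2) (x : ℂ) (lam : Fin 2 → ℂ)
    (v : TensorPower n) : TensorPower n :=
  ∑ k, (if j = l then rho τ (x - z k) else sigma τ (x - z k) (lam j - lam l)) •
    site k (glMat j l) v

/-- The matrix `L_{jl}(x)`: `L_{jj} = e⁺_{jj} + ∑_{r ≠ j} ρ(λ_j - λ_r) e_{rr}` and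
`L_{jl} = e⁺_{lj}` for `j ≠ l`. -/
def lMat (τ : ℂ) {n : ℕ} (z : Fin n → ℂ) (j l : Fin 2) (x : ℂ) (lam : Fin 2 → ℂ)
    (v : TensorPower n) : TensorPower n :=
  if j = l then
    ePlus τ z j j x lam v +
      ∑ r ∈ Finset.univ.erase j, rho τ (lam j - lam r) • ∑ k, site k (glMat r r) v
  else ePlus τ z l j x lam v

/-- The entry `δ_{jl} ∂_x - δ_{jl} ∂_{λ_j} + L_{jl}(x)`, acting on `V`-valued functions
of `x` and `λ = (λ_1, λ_2)`. -/
def rstEntry (τ : ℂ) {n : ℕ} (z : Fin n → ℂ) (j l : Fin 2)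
    (F : ℂ → (Fin 2 → ℂ) → TensorPower n) : ℂ → (Fin 2 → ℂ) → TensorPower n :=
  fun x lam =>
    (if j = l then
      deriv (fun y => F y lam) x - deriv (fun s => F x (Function.update lam j s)) (lam j)
     else 0) + lMat τ z j l x lam (F x lam)

/-- The RST-operator: the column determinant `∑_π sgn(π) X_{π(1),1} X_{π(2),2}` of the matrix
`X = (rstEntry j l)`. -/
def rst (τ : ℂ) {n : ℕ} (z : Fin n → ℂ) (F : ℂ → (Fin 2 → ℂ) → TensorPower n) :
    ℂ → (Fin 2 → ℂ) → TensorPower n :=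
  ∑ p : Equiv.Perm (Fin 2),
    ((Equiv.Perm.sign p : ℤ) : ℂ) • rstEntry τ z (p 0) 0 (rstEntry τ z (p 1) 1 F)

/-- The coefficient `S_1(x)` of the RST-operator `∂_x² + S_1(x) ∂_x + S_2(x)`, acting on functions
of `λ`. It is read off by applying the operator to `(y - x) Ψ(λ)` and evaluating at `y = x`. -/
def rstS1 (τ : ℂ) {n : ℕ} (z : Fin n → ℂ) (x : ℂ) (Ψ : (Fin 2 → ℂ) → TensorPower n) :
    (Fin 2 → ℂ) → TensorPower n :=
  rst τ z (fun y lam => (y - x) • Ψ lam) x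

/-- The coefficient `S_2(x)` of the RST-operator `∂_x² + S_1(x) ∂_x + S_2(x)`, acting on functions
of `λ`. It is read off by applying the operator to `Ψ(λ)`, which does not depend on `y`, and
evaluating at `y = x`. -/
def rstS2 (τ : ℂ) {n : ℕ} (z : Fin n → ℂ) (x : ℂ) (Ψ : (Fin 2 → ℂ) → TensorPower n) :
    (Fin 2 → ℂ) → TensorPower n :=
  rst τ z (fun _ lam => Ψ lam) x

/-- The Bethe function `Ψ = e^{πiμλ_{12}} ∑_{|I| = m} W_I(λ_{12},t,z) v_I`, where `v_I` has `v_2`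
exactly at the places in `I`, and
`W_I = Sym_t ∏_j σ(t_j - z_{i_j}, -λ_{12})` for `I = {i_1 < ⋯ < i_m}`.
The symmetrization is written as a sum over the bijections between `{1,…,m}` and `I`
(there are none if `|I| ≠ m`). -/
def betheFun (τ : ℂ) {m : ℕ} (s : BetheData m) (lam : Fin 2 → ℂ) : TensorPower (2 * m) :=
  fun J => cexp (π * I * s.mu * (lam 0 - lam 1)) *
    ∑ e : Fin m ≃ {i : Fin (2 * m) // J i = 1},
      ∏ j, sigma τ (s.t j - s.z (e j)) (-(lam 0 - lam 1))

/-! ### Fundamental differential operators -/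

/-- The scalar operator `∂_x² + c₁(x) ∂_x + c₂(x)` with meromorphic coefficients. -/
structure MonicOp where
  c₁ : ℂ → ℂ
  c₂ : ℂ → ℂ
  meromorphic_c₁ : Meromorphic c₁
  meromorphic_c₂ : Meromorphic c₂

/-- `D` is the fundamental differential operator of the solution `s = (μ,t,z)`: the Bethe function
`Ψ` of `s` is an eigenfunction (nonzero, in particular) of the coefficients `S_1(x)`, `S_2(x)` of
the RST-operator, and the coefficients of `D` are the eigenvalues. -/
structure IsFundOpOfSolution (τ : ℂ) {m : ℕ} (s : BetheData m) (D : MonicOp) : Prop where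
  ne_zero : ∃ lam : Fin 2 → ℂ, ¬ InLattice τ (lam 0 - lam 1) ∧ betheFun τ s lam ≠ 0
  eigen₁ : ∀ x, (∀ a, ¬ InLattice τ (x - s.z a)) →
    ∀ lam : Fin 2 → ℂ, ¬ InLattice τ (lam 0 - lam 1) →
      rstS1 τ s.z x (betheFun τ s) lam = D.c₁ x • betheFun τ s lam
  eigen₂ : ∀ x, (∀ a, ¬ InLattice τ (x - s.z a)) →
    ∀ lam : Fin 2 → ℂ, ¬ InLattice τ (lam 0 - lam 1) →
      rstS2 τ s.z x (betheFun τ s) lam = D.c₂ x • betheFun τ s lam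

/-- The Wronskian `f g' - f' g`. -/
def wr (f g : ℂ → ℂ) (x : ℂ) : ℂ := f x * deriv g x - deriv f x * g x

/-- `D` is the monic operator whose kernel is spanned by `f/√Wr(f,g)` and `g/√Wr(f,g)`: on every
connected open set without zeros of `Wr(f,g)`, and for every holomorphic branch `w` of
`√Wr(f,g)` there, the holomorphic solutions of `D u = 0` are exactly the linear
combinations of `f/w` and `g/w`. -/
def IsFundOpOfPair (f g : ℂ → ℂ) (D : MonicOp) : Prop :=
  ∀ (U : Set ℂ) (w : ℂ → ℂ), IsOpen U → IsConnected U → (∀ x ∈ U, wr f g x ≠ 0) →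
    DifferentiableOn ℂ w U → (∀ x ∈ U, w x ^ 2 = wr f g x) →
    ∀ u : ℂ → ℂ, DifferentiableOn ℂ u U →
      ((∀ x ∈ U, deriv (deriv u) x + D.c₁ x * deriv u x + D.c₂ x * u x = 0) ↔
        ∃ a b : ℂ, ∀ x ∈ U, u x = a * (f x / w x) + b * (g x / w x))

/-! ### Theta-polynomials and pairs -/

/-- `f` is a theta-polynomial of degree `m` with multipliers `A`, `B`. -/
structure IsThetaPoly (τ : ℂ) (m : ℕ) (A B : ℂ) (f : ℂ → ℂ) : Prop where
  entire : Differentiable ℂ f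
  add_one : ∀ x, f (x + 1) = A * (-1) ^ m * f x
  add_tau : ∀ x, f (x + τ) = B * (-1) ^ m * cexp (-π * I * m * τ - 2 * π * I * m * x) * f x

/-- Pairs `(f, g)` of nonzero theta-polynomials of degree `m` such that the first multiplier of
`f` is `1` and the first multiplier of `g` is not `1`. -/
structure ThetaPair (τ : ℂ) (m : ℕ) where
  f : ℂ → ℂ
  g : ℂ → ℂ
  f_ne : f ≠ 0
  g_ne : g ≠ 0
  f_theta : ∃ B : ℂ, B ≠ 0 ∧ IsThetaPoly τ m 1 B f
  g_theta : ∃ A B : ℂ, A ≠ 0 ∧ A ≠ 1 ∧ B ≠ 0 ∧ IsThetaPoly τ m A B g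

/-- Two pairs are identified if they agree up to multiplication of each coordinate by a nonzero
number and of both coordinates by `e^{2πikx}` for some `k ∈ ℤ`. -/
def ThetaPair.setoid (τ : ℂ) (m : ℕ) : Setoid (ThetaPair τ m) where
  r P Q := ∃ (k : ℤ) (c d : ℂ), c ≠ 0 ∧ d ≠ 0 ∧
    (∀ x, Q.f x = c * (cexp (2 * π * I * k * x) * P.f x)) ∧
    (∀ x, Q.g x = d * (cexp (2 * π * I * k * x) * P.g x))
  iseqv :=
    { refl := fun P => ⟨0, 1, 1, one_ne_zero, one_ne_zero, by simp, by simp⟩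
      symm := by
        rintro P Q ⟨k, c, d, hc, hd, hf, hg⟩
        have key : ∀ x : ℂ, cexp (2 * π * I * ((-k : ℤ) : ℂ) * x) * cexp (2 * π * I * k * x) = 1 := by
          intro x
          rw [← Complex.exp_add, ← Complex.exp_zero]
          congr 1
          push_cast
          ring
        refine ⟨-k, c⁻¹, d⁻¹, inv_ne_zero hc, inv_ne_zero hd, fun x => ?_, fun x => ?_⟩
        · rw [hf, mul_left_comm _ c, inv_mul_cancel_left₀ hc, ← mul_assoc, key, one_mul]
        · rw [hg, mul_left_comm _ d, inv_mul_cancel_left₀ hd, ← mul_assoc, key, one_mul]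
      trans := by
        rintro P Q R ⟨k, c, d, hc, hd, hf, hg⟩ ⟨k', c', d', hc', hd', hf', hg'⟩
        have key : ∀ x : ℂ, cexp (2 * π * I * ((k + k' : ℤ) : ℂ) * x)
            = cexp (2 * π * I * k * x) * cexp (2 * π * I * k' * x) := by
          intro x
          rw [← Complex.exp_add]
          congr 1
          push_cast
          ring
        refine ⟨k + k', c * c', d * d', mul_ne_zero hc hc', mul_ne_zero hd hd',
          fun x => ?_, fun x => ?_⟩
        · rw [hf', hf, key]
          ring
        · rw [hg', hg, key]
          ring }

/-- The space `(P_{m,1} × (P_m - P_{m,1})) / ℤ`. -/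
def PairSpace (τ : ℂ) (m : ℕ) : Type := Quotient (ThetaPair.setoid τ m)

/-- The point of `(P_{m,1} × (P_m - P_{m,1})) / ℤ` represented by a pair. -/
def ThetaPair.toPoint {τ : ℂ} {m : ℕ} (P : ThetaPair τ m) : PairSpace τ m :=
  Quotient.mk (ThetaPair.setoid τ m) P

/-- The points with generic first coordinate: `f` has no common zeros with `Wr(f,g)`. -/
def Pairs₁ (τ : ℂ) (m : ℕ) : Type :=
  {p : PairSpace τ m // ∀ P : ThetaPair τ m, P.toPoint = p → ∀ x, P.f x = 0 → wr P.f P.g x ≠ 0}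

/-- `p = β(μ,t,z)`: for some representative `(μ',t',z')` of the equivalence class of the solution
`(μ,t,z)`, the point `p` is represented by a pair `(f,g)` with `f = ∏_j θ(x - t'_j)` and
`Wr(f,g) = const e^{-2πiμ'x} ∏_a θ(x - z'_a)`. -/
def IsBeta (τ : ℂ) {m : ℕ} (s : BetheData m) (p : Pairs₁ τ m) : Prop :=
  ∃ s' : BetheData m, BetheEquiv τ s s' ∧ ∃ P : ThetaPair τ m, P.toPoint = p.1 ∧
    (∀ x, P.f x = ∏ j, theta τ (x - s'.t j)) ∧
    ∃ c : ℂ, c ≠ 0 ∧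
      ∀ x, wr P.f P.g x = c * cexp (-2 * π * I * s'.mu * x) * ∏ a, theta τ (x - s'.z a)

end EllipticBethe

end

open EllipticBethe

set_option autoImplicit false

namespace EllipticBethe

open Real Complex Filter Topology

/-! ### The theta function -/

/-! Put f = ∏ θ(x - t_j), W = e^{-2πiμx} ∏ θ(x - z_a), and let v = f'/f - W'/(2W) = πiμ + ∑ ρ(x -
t_j) - ½ ∑ ρ(x - z_a), the logarithmic derivative of f/√W. The two operators agree because both
equal ∂² - (v' + v²).

The side of the pair. A solution of Wr(f,g) = W satisfies (g/f)' = W/f². The Bethe equations say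
that W/f² has no residues at the simple zeros of f (`IsBetheSolution.no_residue`), so an entire g
exists (`exists_wronskian_partner`), unique up to multiples of f. Since μ is not an integer, the
first multiplier e^{-2πiμ} of W is not 1. Hence exactly one g is quasi-periodic under x ↦ x + 1, and
that g is also quasi-periodic under x ↦ x + τ (`exists_thetaPoly_partner`). Equivalent solutions
change f by a constant times e^{2πikx} and W by a constant times e^{4πikx}
(`BetheEquiv.exists_exp`), so the class of (f,g) is well defined and unique (`exists_beta`). The
functions f/√W and g/√W have Wronskian 1. The operator annihilating them therefore has no first
order term, and the Riccati equation gives its potential -(v' + v²) (`isFundOpOfPair_pairOp`,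
`pairPotential_eq_of_logDeriv`).

The side of the solution. On the zero weight space S₁ = 0 and -S₂ = ∂_λ² - 2w∂_λ + w² + w' +
hopping, with w the diagonal `weightRho` (`rst_apply`). A component of Ψ is a sum over bijections e
from the Bethe roots to the places of v_2. The addition theorem `sigma_mul_sigma`, a consequence of
Liouville's theorem, turns each contribution into a multiple of the summand of some e. The Bethe
equations then eliminate the sums over the remaining places, and the multiple becomes v' + v² plus
unwanted terms indexed by pairs of distinct roots (`IsGenericPoint.term_eq`). Terms with a single
root have disappeared by the differentiated addition theorem (`IsGenericPoint.diagonal`). Those with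
roots j ≠ k cancel between e and e composed with the transposition (j k), by the three-term relation
`sigma_triple` (`IsGenericPoint.unwanted_symm`). Points excluded in these computations form
countable sets and are recovered by continuity. Finally Ψ ≠ 0, because its leading coefficient as λ
→ 0 counts bijections. -/

/-- The infinite product `(a;q) = ∏_{j ≥ 0} (1 - a q^j)`. -/
noncomputable def qPoch (q a : ℂ) : ℂ := ∏' j : ℕ, (1 - a * q ^ j)

lemma summable_norm_mul_pow {q : ℂ} (hq : ‖q‖ < 1) (a : ℂ) :
    Summable fun j : ℕ => ‖-(a * q ^ j)‖ := by
  simpa [norm_mul, norm_pow] using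
    (summable_geometric_of_lt_one (norm_nonneg _) hq).mul_left ‖a‖

lemma qPoch_eq_mul {q : ℂ} (hq : ‖q‖ < 1) (a : ℂ) : qPoch q a = (1 - a) * qPoch q (a * q) := by
  have e : ∀ j : ℕ, 1 + -(a * q * q ^ j) = 1 - a * q ^ (j + 1) := fun j => by ring
  have h := multipliable_one_add_of_summable (summable_norm_mul_pow hq (a * q))
  simp only [e] at h
  have := tprod_eq_zero_mul' (f := fun j : ℕ => 1 - a * q ^ j) h
  unfold qPoch
  rw [this]
  simp only [pow_zero, mul_one, pow_succ', mul_assoc]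

lemma qPoch_ne_zero {q a : ℂ} (hq : ‖q‖ < 1) (ha : ∀ j : ℕ, a * q ^ j ≠ 1) : qPoch q a ≠ 0 := by
  have := tprod_one_add_ne_zero_of_summable (f := fun j : ℕ => -(a * q ^ j))
    (fun j h => ha j (by linear_combination -h)) (summable_norm_mul_pow hq a)
  simpa [qPoch, sub_eq_add_neg] using this

lemma differentiable_qPoch {q : ℂ} (hq : ‖q‖ < 1) : Differentiable ℂ (qPoch q) := by
  have key : HasProdLocallyUniformlyOn (fun (j : ℕ) a => 1 - a * q ^ j) (qPoch q) Set.univ := by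
    simp_rw [sub_eq_add_neg]
    have : qPoch q = fun a => ∏' j : ℕ, (1 + -(a * q ^ j)) := by
      ext a; simp [qPoch, sub_eq_add_neg]
    rw [this]
    apply hasProdLocallyUniformlyOn_of_forall_compact isOpen_univ
    intro K _ hcK
    obtain ⟨C, hC⟩ := hcK.isBounded.exists_norm_le
    refine ((summable_geometric_of_lt_one (norm_nonneg _) hq).mul_left C).hasProdUniformlyOn_nat_one_add
      hcK (.of_forall fun n x hx ↦ ?_) (fun _ ↦ by fun_prop)
    rw [norm_neg, norm_mul, norm_pow]
    exact mul_le_mul_of_nonneg_right (hC x hx) (by positivity)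
  rw [← differentiableOn_univ]
  exact key.differentiableOn (.of_forall fun _ ↦ by
    simpa [Finset.prod_fn] using DifferentiableOn.finsetProd (fun _ _ ↦ by fun_prop)) isOpen_univ

lemma norm_nome_lt_one {τ : ℂ} (hτ : 0 < τ.im) : ‖cexp (2 * π * I * τ)‖ < 1 := by
  rw [Complex.norm_exp, Real.exp_lt_one_iff]
  have : (2 * π * I * τ).re = -(2 * Real.pi * τ.im) := by simp
  rw [this, neg_lt_zero]
  positivity

lemma theta_eq_qPoch (τ x : ℂ) : theta τ x = Complex.sin (π * x) / π *
    qPoch (cexp (2 * π * I * τ)) (cexp (2 * π * I * τ) * cexp (2 * π * I * x)) *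
    qPoch (cexp (2 * π * I * τ)) (cexp (2 * π * I * τ) / cexp (2 * π * I * x)) /
    qPoch (cexp (2 * π * I * τ)) (cexp (2 * π * I * τ)) ^ 2 := rfl

lemma pow_succ_nome_ne_one {τ : ℂ} (hτ : 0 < τ.im) (j : ℕ) :
    cexp (2 * π * I * τ) * cexp (2 * π * I * τ) ^ j ≠ 1 := by
  intro h
  have h2 := norm_nome_lt_one hτ
  have : ‖cexp (2 * π * I * τ)‖ ^ (j + 1) < 1 := pow_lt_one₀ (norm_nonneg _) h2 (by omega)
  rw [← pow_succ'] at h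
  rw [← norm_pow, h] at this
  simp at this

lemma differentiable_theta {τ : ℂ} (hτ : 0 < τ.im) : Differentiable ℂ (theta τ) := by
  have h := differentiable_qPoch (norm_nome_lt_one hτ)
  have : theta τ = fun x => Complex.sin (π * x) / π *
    qPoch (cexp (2 * π * I * τ)) (cexp (2 * π * I * τ) * cexp (2 * π * I * x)) *
    qPoch (cexp (2 * π * I * τ)) (cexp (2 * π * I * τ) * cexp (-(2 * π * I * x))) /
    qPoch (cexp (2 * π * I * τ)) (cexp (2 * π * I * τ)) ^ 2 := by
    ext x
    rw [theta_eq_qPoch, Complex.exp_neg (2 * π * I * x), div_eq_mul_inv (cexp _) (cexp _)]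
  rw [this]
  fun_prop

lemma theta_neg (τ x : ℂ) : theta τ (-x) = -theta τ x := by
  rw [theta_eq_qPoch, theta_eq_qPoch]
  have h1 : cexp (2 * π * I * -x) = (cexp (2 * π * I * x))⁻¹ := by
    rw [← Complex.exp_neg]; ring_nf
  rw [h1, div_inv_eq_mul, ← div_eq_mul_inv, mul_neg, Complex.sin_neg]
  ring

@[simp] lemma theta_zero (τ : ℂ) : theta τ 0 = 0 := by simp [theta]

lemma theta_add_one (τ x : ℂ) : theta τ (x + 1) = -theta τ x := by
  rw [theta_eq_qPoch, theta_eq_qPoch]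
  have h1 : cexp (2 * π * I * (x + 1)) = cexp (2 * π * I * x) := by
    rw [mul_add, Complex.exp_add, mul_one, Complex.exp_two_pi_mul_I, mul_one]
  rw [h1, mul_add, mul_one, Complex.sin_add_pi]
  ring

/-- The shift replaces y by qy. Thereby (qy;q) loses its first factor 1 - qy and (q/y;q) gains the
factor 1 - 1/y; up to exponentials these factors are the sines at x + τ and at x. -/
lemma theta_add_tau {τ : ℂ} (hτ : 0 < τ.im) (x : ℂ) :
    theta τ (x + τ) = -cexp (-π * I * τ - 2 * π * I * x) * theta τ x := by
  rw [theta_eq_qPoch, theta_eq_qPoch]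
  have hq := norm_nome_lt_one hτ
  have h1 : cexp (2 * π * I * (x + τ)) = cexp (2 * π * I * τ) * cexp (2 * π * I * x) := by
    rw [← Complex.exp_add]; ring_nf
  set q := cexp (2 * π * I * τ) with hqd
  set y := cexp (2 * π * I * x) with hyd
  have hq0 : q ≠ 0 := Complex.exp_ne_zero _
  have hy0 : y ≠ 0 := Complex.exp_ne_zero _
  rw [h1, div_mul_eq_div_div, div_self hq0, qPoch_eq_mul hq (1 / y), qPoch_eq_mul hq (q * y),
    one_div_mul_eq_div, mul_comm (q * y) q]
  have hpi : (π : ℂ) ≠ 0 := by exact_mod_cast Real.pi_ne_zero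
  have e1 : Complex.sin (π * (x + τ)) = -cexp (-π * I * (x + τ)) * (1 - q * y) / (2 * I) := by
    have : cexp (π * (x + τ) * I) = cexp (-π * I * (x + τ)) * (q * y) := by
      rw [hqd, hyd, ← Complex.exp_add, ← Complex.exp_add]; ring_nf
    rw [Complex.sin, this]
    have : -(π * (x + τ)) * I = -π * I * (x + τ) := by ring
    rw [this]
    field_simp
    rw [I_sq]; ring
  have e2 : Complex.sin (π * x) = cexp (π * I * x) * (1 - 1 / y) / (2 * I) := by
    have : cexp (-(π * x) * I) = cexp (π * I * x) * (1 / y) := by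
      rw [hyd, one_div, ← Complex.exp_neg, ← Complex.exp_add]; ring_nf
    rw [Complex.sin, this]
    have : π * x * I = π * I * x := by ring
    rw [this]
    field_simp
    rw [I_sq]; ring
  have e3 : cexp (-π * I * (x + τ)) = cexp (-π * I * τ - 2 * π * I * x) * cexp (π * I * x) := by
    rw [← Complex.exp_add]; ring_nf
  rw [e1, e2, e3]
  ring

/-- The sine vanishes on ℤ, and the two infinite products account for the lattice points with
negative and with positive coefficient of τ. -/
lemma inLattice_of_theta_eq_zero {τ : ℂ} (hτ : 0 < τ.im) {x : ℂ} (h : theta τ x = 0) :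
    InLattice τ x := by
  have hpi : (π : ℂ) ≠ 0 := by exact_mod_cast Real.pi_ne_zero
  have h2 : (2 * π * I : ℂ) ≠ 0 := Complex.two_pi_I_ne_zero
  have hq := norm_nome_lt_one hτ
  have hqq := qPoch_ne_zero hq (fun j => pow_succ_nome_ne_one hτ j)
  rw [theta_eq_qPoch, div_eq_zero_iff, mul_eq_zero, mul_eq_zero, div_eq_zero_iff] at h
  rcases h with (((h | h) | h) | h) | h
  · obtain ⟨k, hk⟩ := Complex.sin_eq_zero_iff.1 h
    refine ⟨k, 0, ?_⟩
    have := mul_left_cancel₀ hpi (hk.trans (mul_comm _ _))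
    simpa using this
  · exact absurd h hpi
  · by_contra hx
    refine qPoch_ne_zero hq (fun j hj => hx ?_) h
    rw [← Complex.exp_add, ← Complex.exp_nat_mul, ← Complex.exp_add, Complex.exp_eq_one_iff] at hj
    obtain ⟨n, hn⟩ := hj
    refine ⟨n, -(j + 1), mul_left_cancel₀ h2 ?_⟩
    push_cast
    linear_combination hn
  · by_contra hx
    refine qPoch_ne_zero hq (fun j hj => hx ?_) h
    rw [← Complex.exp_sub, ← Complex.exp_nat_mul, ← Complex.exp_add, Complex.exp_eq_one_iff] at hj
    obtain ⟨n, hn⟩ := hj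
    refine ⟨-n, j + 1, mul_left_cancel₀ h2 ?_⟩
    push_cast
    linear_combination -hn
  · exact absurd h (pow_ne_zero _ hqq)

lemma theta_add_lattice {τ : ℂ} (hτ : 0 < τ.im) (k l : ℤ) :
    ∃ c : ℂ, c ≠ 0 ∧ ∀ x, theta τ (x + (k + l * τ)) = c * cexp (-2 * π * I * l * x) * theta τ x := by
  have hk : ∀ k : ℤ, ∃ c : ℂ, c ≠ 0 ∧ ∀ x, theta τ (x + k) = c * theta τ x := by
    intro k
    induction k using Int.induction_on with
    | zero => exact ⟨1, one_ne_zero, by simp⟩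
    | succ n ih =>
      obtain ⟨c, hc, h⟩ := ih
      refine ⟨-c, neg_ne_zero.2 hc, fun x => ?_⟩
      rw [show x + ((n : ℤ) + 1 : ℤ) = x + (n : ℤ) + 1 by push_cast; ring, theta_add_one, h]
      ring
    | pred n ih =>
      obtain ⟨c, hc, h⟩ := ih
      refine ⟨-c, neg_ne_zero.2 hc, fun x => ?_⟩
      have := theta_add_one τ (x + (-(n : ℤ) - 1 : ℤ))
      rw [show x + (-(n : ℤ) - 1 : ℤ) + 1 = x + (-(n : ℤ) : ℤ) by push_cast; ring, h] at this
      linear_combination this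
  have hl : ∀ l : ℤ, ∃ c : ℂ, c ≠ 0 ∧
      ∀ x, theta τ (x + l * τ) = c * cexp (-2 * π * I * l * x) * theta τ x := by
    intro l
    induction l using Int.induction_on with
    | zero => exact ⟨1, one_ne_zero, by simp⟩
    | succ n ih =>
      obtain ⟨c, hc, h⟩ := ih
      refine ⟨-c * cexp (-π * I * τ - 2 * π * I * n * τ),
        mul_ne_zero (neg_ne_zero.2 hc) (Complex.exp_ne_zero _), fun x => ?_⟩
      rw [show x + ((n : ℤ) + 1 : ℤ) * τ = x + (n : ℤ) * τ + τ by push_cast; ring,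
        theta_add_tau hτ, h]
      have : cexp (-π * I * τ - 2 * π * I * (x + (n : ℤ) * τ)) * cexp (-2 * π * I * (n : ℤ) * x)
          = cexp (-π * I * τ - 2 * π * I * n * τ) * cexp (-2 * π * I * ((n : ℤ) + 1 : ℤ) * x) := by
        rw [← Complex.exp_add, ← Complex.exp_add]
        congr 1
        push_cast
        ring
      linear_combination (-c * theta τ x) * this
    | pred n ih =>
      obtain ⟨c, hc, h⟩ := ih
      refine ⟨-c * cexp (π * I * τ - 2 * π * I * (n + 1) * τ),
        mul_ne_zero (neg_ne_zero.2 hc) (Complex.exp_ne_zero _), fun x => ?_⟩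
      have := theta_add_tau hτ (x + (-(n : ℤ) - 1 : ℤ) * τ)
      rw [show x + (-(n : ℤ) - 1 : ℤ) * τ + τ = x + (-(n : ℤ) : ℤ) * τ by push_cast; ring, h] at this
      have e : cexp (-2 * π * I * (-(n : ℤ) : ℤ) * x) =
        cexp (π * I * τ - 2 * π * I * (n + 1) * τ) * cexp (-2 * π * I * (-(n : ℤ) - 1 : ℤ) * x) *
         cexp (-π * I * τ - 2 * π * I * (x + (-(n : ℤ) - 1 : ℤ) * τ)) := by
        rw [← Complex.exp_add, ← Complex.exp_add]
        congr 1
        push_cast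
        ring
      rw [e] at this
      have h0 := Complex.exp_ne_zero (-π * I * τ - 2 * π * I * (x + (-(n : ℤ) - 1 : ℤ) * τ))
      apply mul_left_cancel₀ h0
      linear_combination this
  obtain ⟨c, hc, h⟩ := hk k
  obtain ⟨d, hd, h'⟩ := hl l
  refine ⟨c * d, mul_ne_zero hc hd, fun x => ?_⟩
  rw [show x + (k + l * τ) = x + l * τ + k by ring, h, h']
  ring

lemma theta_eq_zero_iff {τ : ℂ} (hτ : 0 < τ.im) {x : ℂ} : theta τ x = 0 ↔ InLattice τ x := by
  refine ⟨inLattice_of_theta_eq_zero hτ, ?_⟩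
  rintro ⟨k, l, rfl⟩
  obtain ⟨c, -, h⟩ := theta_add_lattice hτ k l
  simpa using h 0

/-- The factors 1/π and (q;q)⁻² in the definition are chosen for this normalization. -/
lemma hasDerivAt_theta_zero {τ : ℂ} (hτ : 0 < τ.im) : HasDerivAt (theta τ) 1 0 := by
  have hpi : (π : ℂ) ≠ 0 := by exact_mod_cast Real.pi_ne_zero
  have h := differentiable_qPoch (norm_nome_lt_one hτ)
  set K : ℂ → ℂ := fun x =>
    qPoch (cexp (2 * π * I * τ)) (cexp (2 * π * I * τ) * cexp (2 * π * I * x)) *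
    qPoch (cexp (2 * π * I * τ)) (cexp (2 * π * I * τ) * cexp (-(2 * π * I * x))) /
    qPoch (cexp (2 * π * I * τ)) (cexp (2 * π * I * τ)) ^ 2 with hK
  have hKd : Differentiable ℂ K := by fun_prop
  have hqq := qPoch_ne_zero (norm_nome_lt_one hτ) (fun j => pow_succ_nome_ne_one hτ j)
  have hK0 : K 0 = 1 := by
    simp only [hK, mul_zero, neg_zero, Complex.exp_zero, mul_one]
    field_simp
  have ht : theta τ = fun x => Complex.sin (π * x) / π * K x := by
    ext x
    simp only [hK]
    rw [theta_eq_qPoch, Complex.exp_neg (2 * π * I * x), div_eq_mul_inv (cexp _) (cexp _)]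
    ring
  rw [ht]
  have h1 : HasDerivAt (fun x : ℂ => Complex.sin (π * x) / π) 1 0 := by
    have := (((hasDerivAt_id (0 : ℂ)).const_mul (π : ℂ)).csin).div_const (π : ℂ)
    simpa [hpi] using this
  have := h1.fun_mul (hKd 0).hasDerivAt
  simpa [hK0] using this

lemma deriv_theta_zero {τ : ℂ} (hτ : 0 < τ.im) : deriv (theta τ) 0 = 1 :=
  (hasDerivAt_theta_zero hτ).deriv

/-- Quasi-periodicity carries every zero to the one at 0. -/
lemma deriv_theta_ne_zero {τ : ℂ} (hτ : 0 < τ.im) {x : ℂ} (hx : theta τ x = 0) :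
    deriv (theta τ) x ≠ 0 := by
  obtain ⟨k, l, rfl⟩ := (theta_eq_zero_iff hτ).1 hx
  obtain ⟨c, hc, h⟩ := theta_add_lattice hτ k l
  have h1 : HasDerivAt (fun x => theta τ (x + (k + l * τ))) (deriv (theta τ) (k + l * τ)) 0 := by
    have := (differentiable_theta hτ (0 + (k + l * τ))).hasDerivAt.comp_add_const 0 (k + l * τ)
    simpa using this
  have h2 : HasDerivAt (fun x => c * cexp (-2 * π * I * l * x) * theta τ x) c 0 := by
    have e : HasDerivAt (fun x : ℂ => c * cexp (-2 * π * I * l * x))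
      (deriv (fun x : ℂ => c * cexp (-2 * π * I * l * x)) 0) 0 :=
      DifferentiableAt.hasDerivAt (by fun_prop)
    have := e.fun_mul (hasDerivAt_theta_zero hτ)
    simpa using this
  rw [funext h] at h1
  rw [h1.unique h2]
  exact hc

end EllipticBethe

namespace EllipticBethe

open Real Complex Filter Topology

/-! ### The lattice -/

lemma InLattice.neg {τ x : ℂ} (h : InLattice τ x) : InLattice τ (-x) := by
  obtain ⟨k, l, rfl⟩ := h
  exact ⟨-k, -l, by push_cast; ring⟩

lemma InLattice.add {τ x y : ℂ} (hx : InLattice τ x) (hy : InLattice τ y) :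
    InLattice τ (x + y) := by
  obtain ⟨k, l, rfl⟩ := hx
  obtain ⟨k', l', rfl⟩ := hy
  exact ⟨k + k', l + l', by push_cast; ring⟩

lemma inLattice_zero (τ : ℂ) : InLattice τ 0 := ⟨0, 0, by simp⟩

lemma inLattice_neg_iff {τ x : ℂ} : InLattice τ (-x) ↔ InLattice τ x :=
  ⟨fun h => by simpa using h.neg, InLattice.neg⟩

lemma inLattice_sub_comm {τ x y : ℂ} : InLattice τ (x - y) ↔ InLattice τ (y - x) := by
  rw [← inLattice_neg_iff, neg_sub]

lemma countable_inLattice (τ : ℂ) : {x : ℂ | InLattice τ x}.Countable := by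
  refine (Set.countable_range fun p : ℤ × ℤ => (p.1 + p.2 * τ : ℂ)).mono ?_
  rintro x ⟨k, l, rfl⟩
  exact ⟨(k, l), rfl⟩

lemma countable_inLattice_sub (τ a : ℂ) : {x : ℂ | InLattice τ (x - a)}.Countable :=
  (countable_inLattice τ).preimage_of_injOn (f := fun x => x - a) (sub_left_injective.injOn)

/-- The complement of a countable set is dense in ℂ. This is the device by which genericity
assumptions are dropped throughout. -/
lemma eqOn_zero_of_countable {F : ℂ → ℂ} {U S : Set ℂ} (hU : IsOpen U) (hF : ContinuousOn F U)
    (hS : S.Countable) (h : ∀ x ∈ U, x ∉ S → F x = 0) : ∀ x ∈ U, F x = 0 := by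
  intro x hx
  by_contra hne
  have hopen : IsOpen (U ∩ F ⁻¹' {0}ᶜ) := hF.isOpen_inter_preimage hU isOpen_compl_singleton
  obtain ⟨y, ⟨hyU, hy0⟩, hyS⟩ :=
    (hS.dense_compl ℂ).inter_open_nonempty _ hopen ⟨x, hx, hne⟩
  exact hy0 (h y hyU hyS)

lemma isOpen_theta_ne_zero {τ : ℂ} (hτ : 0 < τ.im) : IsOpen {x : ℂ | ¬ InLattice τ x} := by
  simp_rw [← theta_eq_zero_iff hτ]
  exact isOpen_compl_singleton.preimage (differentiable_theta hτ).continuous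

/-! ### Quotients and quasi-periodic functions -/

/-- At a zero of G the quotient F/G is given the value F'/G'. Near such a point it is a quotient of
two `dslope`s, whose denominator is nonzero because the zero is simple. -/
lemma exists_eq_mul_of_simple_zeros {U : Set ℂ} (hU : IsOpen U) {F G : ℂ → ℂ}
    (hF : DifferentiableOn ℂ F U) (hG : DifferentiableOn ℂ G U)
    (h0 : ∀ x ∈ U, G x = 0 → F x = 0) (h1 : ∀ x ∈ U, G x = 0 → deriv G x ≠ 0) :
    ∃ H : ℂ → ℂ, DifferentiableOn ℂ H U ∧ ∀ x ∈ U, F x = H x * G x := by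
  classical
  refine ⟨fun x => if G x = 0 then deriv F x / deriv G x else F x / G x, ?_, ?_⟩
  · intro x hx
    refine DifferentiableAt.differentiableWithinAt ?_
    have hxU := hU.mem_nhds hx
    by_cases hGx : G x = 0
    · have hdF := ((Complex.differentiableOn_dslope hxU).2 hF).differentiableAt hxU
      have hdG := ((Complex.differentiableOn_dslope hxU).2 hG).differentiableAt hxU
      have hne : dslope G x x ≠ 0 := by rw [dslope_same]; exact h1 x hx hGx
      refine (hdF.div hdG hne).congr_of_eventuallyEq ?_
      filter_upwards [hdG.continuousAt.eventually_ne hne] with y hy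
      by_cases hyx : y = x
      · subst hyx
        simp [hGx]
      · have eF : F y = (y - x) * dslope F x y := by
          have := sub_smul_dslope F x y
          rw [h0 x hx hGx, sub_zero, smul_eq_mul] at this
          exact this.symm
        have eG : G y = (y - x) * dslope G x y := by
          have := sub_smul_dslope G x y
          rw [hGx, sub_zero, smul_eq_mul] at this
          exact this.symm
        have hyx' : y - x ≠ 0 := sub_ne_zero.2 hyx
        have hGy : G y ≠ 0 := by rw [eG]; exact mul_ne_zero hyx' hy
        simp only [hGy, if_false, Pi.div_apply]
        rw [eF, eG, mul_div_mul_left _ _ hyx']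
    · refine ((hF.differentiableAt hxU).div (hG.differentiableAt hxU) hGx).congr_of_eventuallyEq ?_
      filter_upwards [(hG.differentiableAt hxU).continuousAt.eventually_ne hGx] with y hy
      simp [hy]
  · intro x hx
    by_cases hGx : G x = 0
    · simp [hGx, h0 x hx hGx]
    · simp [hGx]

/-- Liouville's theorem: all values are attained on the compact fundamental parallelogram. -/
lemma apply_eq_apply_of_doubly_periodic {τ : ℂ} (hτ : 0 < τ.im) {f : ℂ → ℂ}
    (hf : Differentiable ℂ f) (h1 : ∀ x, f (x + 1) = f x) (h2 : ∀ x, f (x + τ) = f x) (x y : ℂ) :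
    f x = f y := by
  refine hf.apply_eq_apply_of_bounded ?_ x y
  have hK : IsCompact ((fun p : ℝ × ℝ => f (p.1 + p.2 * τ)) '' (Set.Icc 0 1 ×ˢ Set.Icc 0 1)) := by
    refine (isCompact_Icc.prod isCompact_Icc).image ?_
    exact hf.continuous.comp (by fun_prop)
  refine hK.isBounded.subset ?_
  rintro _ ⟨x, rfl⟩
  have p1 : Function.Periodic f 1 := h1
  have p2 : Function.Periodic f τ := h2
  set b : ℝ := x.im / τ.im
  set a : ℝ := x.re - b * τ.re
  have hx : x = a + b * τ := by
    apply Complex.ext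
    · simp [a]
    · simp [b, hτ.ne']
  refine ⟨(Int.fract a, Int.fract b), ⟨⟨Int.fract_nonneg _, (Int.fract_lt_one _).le⟩,
    ⟨Int.fract_nonneg _, (Int.fract_lt_one _).le⟩⟩, ?_⟩
  have e : x = ((Int.fract a : ℝ) : ℂ) + ((Int.fract b : ℝ) : ℂ) * τ + (⌊a⌋ : ℂ) * 1
      + (⌊b⌋ : ℂ) * τ := by
    rw [hx, Int.fract, Int.fract]
    push_cast
    ring
  change f _ = f x
  conv_rhs => rw [e]
  rw [p2.int_mul, p1.int_mul]

lemma eq_zero_add_lattice_iff {τ : ℂ} {F : ℂ → ℂ} (h1 : ∀ x, F (x + 1) = 0 ↔ F x = 0)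
    (h2 : ∀ x, F (x + τ) = 0 ↔ F x = 0) {ω : ℂ} (hω : InLattice τ ω) (x : ℂ) :
    F (x + ω) = 0 ↔ F x = 0 := by
  obtain ⟨k, l, rfl⟩ := hω
  have p1 : Function.Periodic (fun x => F x = 0) 1 := fun x => propext (h1 x)
  have p2 : Function.Periodic (fun x => F x = 0) τ := fun x => propext (h2 x)
  rw [show x + (k + l * τ) = x + (k : ℂ) * 1 + (l : ℂ) * τ by ring]
  exact iff_of_eq ((p2.int_mul l _).trans (p1.int_mul k x))

/-- A theta function of degree two that vanishes at three points is zero. -/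
lemma eq_zero_of_theta_degree_two {τ : ℂ} (hτ : 0 < τ.im) {F : ℂ → ℂ} {b u₁ : ℂ}
    (hF : Differentiable ℂ F) (h1 : ∀ u, F (u + 1) = F u)
    (h2 : ∀ u, F (u + τ) = cexp (-2 * π * I * τ - 4 * π * I * u - 2 * π * I * b) * F u)
    (hb : ¬ InLattice τ b) (z1 : F 0 = 0) (z2 : F (-b) = 0) (z3 : F u₁ = 0)
    (hu : ¬ InLattice τ u₁) (hub : ¬ InLattice τ (u₁ + b)) (u : ℂ) : F u = 0 := by
  have hth := differentiable_theta hτ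
  -- G has the multipliers of F, and its zeros 0 and -b modulo the lattice are simple because b is
  -- not a lattice point. So F/G is entire and doubly periodic, hence constant, and the third zero
  -- `u₁` makes the constant 0.
  set G : ℂ → ℂ := fun u => theta τ u * theta τ (u + b) with hG
  have hGd : Differentiable ℂ G := by fun_prop
  have hz := fun {ω} (hω : InLattice τ ω) => eq_zero_add_lattice_iff (F := F)
    (fun x => by rw [h1]) (fun x => by rw [h2]; simp [Complex.exp_ne_zero]) hω
  have hdG : ∀ x, deriv G x = deriv (theta τ) x * theta τ (x + b)
      + theta τ x * deriv (theta τ) (x + b) := fun x =>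
    ((hth x).hasDerivAt.fun_mul ((hth (x + b)).hasDerivAt.comp_add_const x b)).deriv
  obtain ⟨H, hH, hFH⟩ := exists_eq_mul_of_simple_zeros isOpen_univ hF.differentiableOn
    hGd.differentiableOn (fun x _ hx => by
      rcases mul_eq_zero.1 hx with hx | hx
      · rw [← zero_add x, hz ((theta_eq_zero_iff hτ).1 hx), z1]
      · rw [show x = -b + (x + b) by ring, hz ((theta_eq_zero_iff hτ).1 hx), z2])
    (fun x _ hx => by
      rw [hdG]
      rcases mul_eq_zero.1 hx with hx | hx
      · rw [hx, zero_mul, add_zero]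
        refine mul_ne_zero (deriv_theta_ne_zero hτ hx) fun h => hb ?_
        rw [theta_eq_zero_iff hτ] at hx h
        simpa using h.add hx.neg
      · rw [hx, mul_zero, zero_add]
        refine mul_ne_zero (fun h => hb ?_) (deriv_theta_ne_zero hτ hx)
        rw [theta_eq_zero_iff hτ] at hx h
        simpa using hx.add h.neg)
  rw [differentiableOn_univ] at hH
  replace hFH : ∀ x, F x = H x * G x := fun x => hFH x trivial
  have hcont := hH.continuous
  have key : ∀ v : ℂ, (∀ x, G x ≠ 0 → H (x + v) = H x) → ∀ x, H (x + v) = H x := by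
    intro v hne x
    have := eqOn_zero_of_countable (F := fun x => H (x + v) - H x)
      (S := {x | InLattice τ (x - 0)} ∪ {x | InLattice τ (x - -b)}) isOpen_univ
      (by fun_prop) ((countable_inLattice_sub τ 0).union (countable_inLattice_sub τ (-b)))
      (fun x _ hx => by
        rw [hne x, sub_self]
        intro h
        apply hx
        rcases mul_eq_zero.1 h with h | h
        · left; simpa using (theta_eq_zero_iff hτ).1 h
        · right; simpa using (theta_eq_zero_iff hτ).1 h) x trivial
    exact sub_eq_zero.1 this
  have G1 : ∀ x, G (x + 1) = G x := fun x => by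
    simp only [hG]
    rw [show x + 1 + b = x + b + 1 by ring, theta_add_one, theta_add_one]; ring
  have G2 : ∀ x, G (x + τ) = cexp (-2 * π * I * τ - 4 * π * I * x - 2 * π * I * b) * G x :=
    fun x => by
      simp only [hG]
      rw [show x + τ + b = x + b + τ by ring, theta_add_tau hτ, theta_add_tau hτ]
      have : cexp (-2 * π * I * τ - 4 * π * I * x - 2 * π * I * b) =
          cexp (-π * I * τ - 2 * π * I * x) * cexp (-π * I * τ - 2 * π * I * (x + b)) := by
        rw [← Complex.exp_add]; ring_nf
      rw [this]; ring
  have H1 := key 1 fun x hx => by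
    have := h1 x
    rw [hFH, hFH x, G1] at this
    exact mul_right_cancel₀ hx this
  have H2 := key τ fun x hx => by
    have := h2 x
    rw [hFH, hFH x, G2] at this
    apply mul_right_cancel₀ (mul_ne_zero (Complex.exp_ne_zero
      (-2 * π * I * τ - 4 * π * I * x - 2 * π * I * b)) hx)
    linear_combination this
  have hu1 : H u₁ = 0 := by
    rw [hFH] at z3
    refine (mul_eq_zero.1 z3).resolve_right (mul_ne_zero ?_ ?_)
    · rwa [Ne, theta_eq_zero_iff hτ]
    · rwa [Ne, theta_eq_zero_iff hτ]
  rw [hFH, apply_eq_apply_of_doubly_periodic hτ hH H1 H2 u u₁, hu1, zero_mul]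

/-! ### The addition theorem -/

lemma deriv_theta_add_one {τ : ℂ} (x : ℂ) : deriv (theta τ) (x + 1) = -deriv (theta τ) x := by
  rw [← deriv_comp_add_const, funext (theta_add_one τ), deriv.fun_neg]

lemma deriv_theta_add_tau {τ : ℂ} (hτ : 0 < τ.im) (x : ℂ) : deriv (theta τ) (x + τ) =
    -cexp (-π * I * τ - 2 * π * I * x) * (deriv (theta τ) x - 2 * π * I * theta τ x) := by
  rw [← deriv_comp_add_const, funext (theta_add_tau hτ)]
  have h1 : HasDerivAt (fun x => -cexp (-π * I * τ - 2 * π * I * x))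
      (-(cexp (-π * I * τ - 2 * π * I * x) * (-(2 * π * I)))) x := by
    have := (((hasDerivAt_id x).const_mul (2 * π * I)).const_sub (-π * I * τ)).cexp.fun_neg
    simpa using this
  rw [(h1.fun_mul (differentiable_theta hτ x).hasDerivAt).deriv]
  ring

lemma deriv_theta_neg {τ : ℂ} (x : ℂ) : deriv (theta τ) (-x) = deriv (theta τ) x := by
  have := deriv_comp_neg (theta τ) x
  rw [funext (theta_neg τ), deriv.fun_neg] at this
  simpa using this.symm

/-- In the variable u the left side is a theta function of degree two with the multipliers of θ(u)
θ(u + w - l), and it vanishes at the three points 0, l - w and l. -/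
lemma theta_addition_aux {τ : ℂ} (hτ : 0 < τ.im) (u : ℂ) {w l : ℂ} (hw : ¬ InLattice τ w)
    (hl : ¬ InLattice τ l) (hwl : ¬ InLattice τ (w - l)) :
    deriv (theta τ) u * theta τ (u + w - l) * theta τ w * theta τ l
      + theta τ u * theta τ (u + w - l) *
        (deriv (theta τ) w * theta τ l - theta τ w * deriv (theta τ) l)
      - theta τ u * deriv (theta τ) (u + w - l) * theta τ w * theta τ l
      + theta τ (u + w) * theta τ (w - l) * theta τ (u - l) = 0 := by
  have hth := differentiable_theta hτ
  have hth' : Differentiable ℂ (deriv (theta τ)) := fun x =>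
    (hth.analyticAt x).deriv.differentiableAt
  refine eq_zero_of_theta_degree_two hτ (b := w - l) (u₁ := l) (F := fun u =>
    deriv (theta τ) u * theta τ (u + w - l) * theta τ w * theta τ l
      + theta τ u * theta τ (u + w - l) *
        (deriv (theta τ) w * theta τ l - theta τ w * deriv (theta τ) l)
      - theta τ u * deriv (theta τ) (u + w - l) * theta τ w * theta τ l
      + theta τ (u + w) * theta τ (w - l) * theta τ (u - l)) (by fun_prop) ?_ ?_ hwl ?_ ?_ ?_ hl
    (by simpa using hw) u
  · intro u
    rw [show u + 1 + w - l = u + w - l + 1 by ring, show u + 1 + w = u + w + 1 by ring,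
      show u + 1 - l = u - l + 1 by ring]
    simp only [theta_add_one, deriv_theta_add_one]
    ring
  · intro u
    rw [show u + τ + w - l = u + w - l + τ by ring, show u + τ + w = u + w + τ by ring,
      show u + τ - l = u - l + τ by ring]
    simp only [theta_add_tau hτ, deriv_theta_add_tau hτ]
    have e1 : cexp (-2 * π * I * τ - 4 * π * I * u - 2 * π * I * (w - l)) =
      cexp (-π * I * τ - 2 * π * I * u) * cexp (-π * I * τ - 2 * π * I * (u + w - l)) := by
      rw [← Complex.exp_add]; ring_nf
    have e2 : cexp (-π * I * τ - 2 * π * I * u) * cexp (-π * I * τ - 2 * π * I * (u + w - l)) =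
      cexp (-π * I * τ - 2 * π * I * (u + w)) * cexp (-π * I * τ - 2 * π * I * (u - l)) := by
      rw [← Complex.exp_add, ← Complex.exp_add]; ring_nf
    rw [e1]
    linear_combination (-theta τ (u + w) * theta τ (w - l) * theta τ (u - l)) * e2
  · simp only [theta_zero, zero_add, zero_sub, theta_neg, deriv_theta_zero hτ]
    ring
  · rw [show -(w - l) + w - l = 0 by ring, show -(w - l) + w = l by ring,
      show -(w - l) - l = -w by ring]
    simp only [theta_zero, theta_neg, deriv_theta_zero hτ]
    ring
  · simp only [add_sub_cancel_left, sub_self, theta_zero]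
    ring

/-- The excluded values are recovered by continuity, first in l, then in w for a fixed generic l. -/
lemma theta_addition {τ : ℂ} (hτ : 0 < τ.im) (u w l : ℂ) :
    deriv (theta τ) u * theta τ (u + w - l) * theta τ w * theta τ l
      + theta τ u * theta τ (u + w - l) *
        (deriv (theta τ) w * theta τ l - theta τ w * deriv (theta τ) l)
      - theta τ u * deriv (theta τ) (u + w - l) * theta τ w * theta τ l
      + theta τ (u + w) * theta τ (w - l) * theta τ (u - l) = 0 := by
  have hth := (differentiable_theta hτ).continuous
  have hth' : Continuous (deriv (theta τ)) :=
    (Differentiable.contDiff (n := 1) (differentiable_theta hτ)).continuous_deriv le_rfl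
  refine eqOn_zero_of_countable (S := {x | InLattice τ x}) (F := fun l =>
    deriv (theta τ) u * theta τ (u + w - l) * theta τ w * theta τ l
      + theta τ u * theta τ (u + w - l) *
        (deriv (theta τ) w * theta τ l - theta τ w * deriv (theta τ) l)
      - theta τ u * deriv (theta τ) (u + w - l) * theta τ w * theta τ l
      + theta τ (u + w) * theta τ (w - l) * theta τ (u - l)) isOpen_univ (by fun_prop)
    (countable_inLattice τ) (fun l _ hl => ?_) l trivial
  refine eqOn_zero_of_countable (S := {x | InLattice τ x} ∪ {x | InLattice τ (x - l)}) (F := fun w =>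
    deriv (theta τ) u * theta τ (u + w - l) * theta τ w * theta τ l
      + theta τ u * theta τ (u + w - l) *
        (deriv (theta τ) w * theta τ l - theta τ w * deriv (theta τ) l)
      - theta τ u * deriv (theta τ) (u + w - l) * theta τ w * theta τ l
      + theta τ (u + w) * theta τ (w - l) * theta τ (u - l)) isOpen_univ (by fun_prop)
    ((countable_inLattice τ).union (countable_inLattice_sub τ l)) (fun w _ hw => ?_) w trivial
  exact theta_addition_aux hτ u (fun h => hw (.inl h)) hl (fun h => hw (.inr h))

lemma rho_neg (τ x : ℂ) : rho τ (-x) = -rho τ x := by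
  rw [rho, rho, theta_neg, deriv_theta_neg, div_neg]

lemma sigma_neg_neg (τ x w : ℂ) : sigma τ (-x) (-w) = -sigma τ x w := by
  rw [sigma, sigma, ← neg_add, theta_neg, theta_neg, theta_neg, neg_mul_neg, neg_div]

/-- The addition theorem `σ(u,-λ) σ(w,-λ) = σ(u+w,-λ) (ρ(u) + ρ(w) - ρ(λ) - ρ(u+w-λ))`. -/
lemma sigma_mul_sigma {τ : ℂ} (hτ : 0 < τ.im) {u w l : ℂ} (hu : ¬ InLattice τ u)
    (hw : ¬ InLattice τ w) (hl : ¬ InLattice τ l) (huw : ¬ InLattice τ (u + w))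
    (huwl : ¬ InLattice τ (u + w - l)) :
    sigma τ u (-l) * sigma τ w (-l) =
      sigma τ (u + w) (-l) * (rho τ u + rho τ w - rho τ l - rho τ (u + w - l)) := by
  have key := theta_addition hτ u w l
  rw [← theta_eq_zero_iff hτ] at hu hw hl huw huwl
  simp only [sigma, rho, ← sub_eq_add_neg, theta_neg]
  field_simp
  linear_combination key

end EllipticBethe

namespace EllipticBethe

open Real Complex Filter Topology

/-! ### Functions with a given Wronskian -/

/-- Near x₀ the quotient d/f has derivative zero; the identity theorem extends the resulting
equation across the zeros of f. -/
lemma eqOn_const_mul_of_wr_eq_zero {U : Set ℂ} (hU : IsOpen U) (hUc : IsPreconnected U)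
    {f d : ℂ → ℂ} (hf : DifferentiableOn ℂ f U) (hd : DifferentiableOn ℂ d U) {x₀ : ℂ}
    (hx₀ : x₀ ∈ U) (hfx : f x₀ ≠ 0) (h : ∀ x ∈ U, wr f d x = 0) :
    ∀ x ∈ U, d x = d x₀ / f x₀ * f x := by
  have hfA := hf.analyticOnNhd hU
  have hdA := hd.analyticOnNhd hU
  have hev : ∀ᶠ x in 𝓝 x₀, x ∈ U ∧ f x ≠ 0 :=
    (hU.eventually_mem hx₀).and
      ((hf.differentiableAt (hU.mem_nhds hx₀)).continuousAt.eventually_ne hfx)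
  obtain ⟨r, hr, hball⟩ := Metric.eventually_nhds_iff_ball.1 hev
  have hq : ∀ x ∈ Metric.ball x₀ r, d x / f x = d x₀ / f x₀ := by
    intro x hx
    have hder : ∀ y ∈ Metric.ball x₀ r, HasDerivAt (fun y => d y / f y) 0 y := by
      intro y hy
      obtain ⟨hyU, hfy⟩ := hball y hy
      have := ((hd.differentiableAt (hU.mem_nhds hyU)).hasDerivAt).fun_div
        ((hf.differentiableAt (hU.mem_nhds hyU)).hasDerivAt) hfy
      refine this.congr_deriv ?_
      have hw := h y hyU
      rw [wr] at hw
      rw [div_eq_zero_iff]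
      left
      linear_combination hw
    exact (convex_ball x₀ r).is_const_of_fderivWithin_eq_zero (𝕜 := ℂ)
      (fun y hy => (hder y hy).differentiableAt.differentiableWithinAt)
      (fun y hy => by
        rw [fderivWithin_of_isOpen Metric.isOpen_ball hy]
        ext
        simpa using (hder y hy).deriv) hx (Metric.mem_ball_self hr)
  have hg : AnalyticOnNhd ℂ (fun x => d x₀ / f x₀ * f x) U := fun x hx =>
    analyticAt_const.mul (hfA x hx)
  refine hdA.eqOn_of_preconnected_of_eventuallyEq hg hUc hx₀ ?_
  filter_upwards [Metric.ball_mem_nhds x₀ hr] with x hx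
  rw [← hq x hx, div_mul_cancel₀ _ (hball x hx).2]

lemma finite_zeros_inter_of_isCompact {f : ℂ → ℂ} (hf : Differentiable ℂ f)
    (hs : ∀ x, f x = 0 → deriv f x ≠ 0) {K : Set ℂ} (hK : IsCompact K) :
    (K ∩ f ⁻¹' {0}).Finite := by
  by_contra hinf
  obtain ⟨x, hxK, hx⟩ := Set.Infinite.exists_accPt_of_subset_isCompact hinf hK
    Set.inter_subset_left
  have hcl : IsClosed (f ⁻¹' {0}) := isClosed_singleton.preimage hf.continuous
  rw [accPt_iff_frequently_nhdsNE] at hx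
  have hx0 : f x = 0 := by
    have h1 : ∃ᶠ y in 𝓝 x, y ∈ f ⁻¹' {0} :=
      (hx.filter_mono nhdsWithin_le_nhds).mono fun y hy => hy.2
    have := mem_closure_iff_frequently.2 h1
    rwa [hcl.closure_eq] at this
  exact hx (((hf x).hasDerivAt.eventually_ne (hs x hx0) (c := 0)).mono fun y hy h => hy h.2)

lemma differentiable_deriv {f : ℂ → ℂ} (hf : Differentiable ℂ f) : Differentiable ℂ (deriv f) :=
  fun x => (hf.analyticAt x).deriv.differentiableAt

/-- At a zero of f the equation forces g = -W/f'. Let P be a polynomial with these values; a ball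
contains only finitely many zeros, so interpolation applies. Then N = Wr(f,P) - W vanishes on the
zeros of f, and the hypothesis `hc` makes it vanish there to second order, so N = H₂ f². If K is a
primitive of H₂ on the ball, Wr(f, K f) = K' f² = N and g = P - K f is a solution. -/
lemma exists_wronskian_partner_ball {f W : ℂ → ℂ} (hf : Differentiable ℂ f)
    (hW : Differentiable ℂ W) (hs : ∀ x, f x = 0 → deriv f x ≠ 0)
    (hc : ∀ x, f x = 0 → deriv (deriv f) x * W x = deriv f x * deriv W x) (R : ℝ) :
    ∃ g : ℂ → ℂ, DifferentiableOn ℂ g (Metric.ball 0 R) ∧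
      ∀ x ∈ Metric.ball 0 R, wr f g x = W x := by
  classical
  set U := Metric.ball (0 : ℂ) R
  have hU : IsOpen U := Metric.isOpen_ball
  have hfin := finite_zeros_inter_of_isCompact hf hs (isCompact_closedBall (0 : ℂ) R)
  set P : Polynomial ℂ := Lagrange.interpolate hfin.toFinset id fun t => -W t / deriv f t
  have hP : ∀ x ∈ U, f x = 0 → P.eval x = -W x / deriv f x := fun x hx hfx =>
    Lagrange.eval_interpolate_at_node (s := hfin.toFinset) (v := id)
      (fun t => -W t / deriv f t) (Set.injOn_id _)
      (hfin.mem_toFinset.2 ⟨Metric.ball_subset_closedBall hx, hfx⟩)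
  have hf' := differentiable_deriv hf
  have hPd : ∀ Q : Polynomial ℂ, Differentiable ℂ fun x => Q.eval x := fun Q => Q.differentiable
  set N : ℂ → ℂ := fun x => f x * P.derivative.eval x - deriv f x * P.eval x - W x with hN
  have hNd : Differentiable ℂ N := by
    have h1 := hPd P
    have h2 := hPd P.derivative
    fun_prop
  have hN' : ∀ x, deriv N x = f x * P.derivative.derivative.eval x
      - deriv (deriv f) x * P.eval x - deriv W x := by
    intro x
    have := (((hf x).hasDerivAt.fun_mul (P.derivative.hasDerivAt x)).fun_sub
      ((hf' x).hasDerivAt.fun_mul (P.hasDerivAt x))).fun_sub (hW x).hasDerivAt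
    rw [this.deriv]
    ring
  obtain ⟨H₁, hH₁, hNH₁⟩ := exists_eq_mul_of_simple_zeros hU hNd.differentiableOn
    hf.differentiableOn (fun x hx hfx => by
      have := hs x hfx
      simp only [hN, hfx, hP x hx hfx]
      field_simp
      ring) (fun x _ hfx => hs x hfx)
  obtain ⟨H₂, hH₂, hH₁₂⟩ := exists_eq_mul_of_simple_zeros hU hH₁
    hf.differentiableOn (fun x hx hfx => by
      have h0 := hs x hfx
      have h1 : deriv N x = 0 := by
        rw [hN' x, hP x hx hfx, hfx]
        have := hc x hfx
        field_simp
        linear_combination this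
      have h2 : HasDerivAt N (deriv H₁ x * f x + H₁ x * deriv f x) x :=
        ((hH₁.differentiableAt (hU.mem_nhds hx)).hasDerivAt.fun_mul
          (hf x).hasDerivAt).congr_of_eventuallyEq (by
            filter_upwards [hU.mem_nhds hx] with y hy using hNH₁ y hy)
      rw [h2.deriv, hfx, mul_zero, zero_add] at h1
      exact (mul_eq_zero.1 h1).resolve_right h0) (fun x _ hfx => hs x hfx)
  obtain ⟨K, hK⟩ := hH₂.isExactOn_ball
  refine ⟨fun x => P.eval x - K x * f x, ?_, fun x hx => ?_⟩
  · have h1 := (hPd P).differentiableOn (s := U)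
    have h2 : DifferentiableOn ℂ K U := fun x hx =>
      (hK x hx).differentiableAt.differentiableWithinAt
    exact h1.fun_sub (h2.fun_mul hf.differentiableOn)
  · have := (P.hasDerivAt x).fun_sub ((hK x hx).fun_mul (hf x).hasDerivAt)
    rw [wr, this.deriv]
    have e := hNH₁ x hx
    rw [hH₁₂ x hx] at e
    simp only [hN] at e
    linear_combination e

lemma wr_add_const_mul {f g : ℂ → ℂ} {x : ℂ} (hf : DifferentiableAt ℂ f x)
    (hg : DifferentiableAt ℂ g x) (c : ℂ) : wr f (fun x => g x + c * f x) x = wr f g x := by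
  rw [wr, wr, (hg.hasDerivAt.fun_add (hf.hasDerivAt.const_mul c)).deriv]
  ring

lemma wr_sub_const_mul {f g h : ℂ → ℂ} {x : ℂ} (hg : DifferentiableAt ℂ g x)
    (hh : DifferentiableAt ℂ h x) (c : ℂ) :
    wr f (fun x => g x - c * h x) x = wr f g x - c * wr f h x := by
  rw [wr, wr, wr, (hg.hasDerivAt.fun_sub (hh.hasDerivAt.const_mul c)).deriv]
  ring

/-- An entire function `g` with `Wr(f,g) = W` exists as soon as `(W/f²)` has no residues. -/
lemma exists_wronskian_partner {f W : ℂ → ℂ} (hf : Differentiable ℂ f)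
    (hW : Differentiable ℂ W) (hs : ∀ x, f x = 0 → deriv f x ≠ 0)
    (hc : ∀ x, f x = 0 → deriv (deriv f) x * W x = deriv f x * deriv W x) :
    ∃ g : ℂ → ℂ, Differentiable ℂ g ∧ ∀ x, wr f g x = W x := by
  obtain ⟨x₀, hx₀⟩ : ∃ x₀, f x₀ ≠ 0 := by
    by_contra! h
    refine hs 0 (h 0) ?_
    rw [show f = fun _ => 0 from funext h]
    simp
  obtain ⟨n₀, hn₀⟩ := exists_nat_gt ‖x₀‖
  -- Solutions on a ball differ by multiples of f. The normalization g(x₀) = 0, where f(x₀) ≠ 0,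
  -- makes them unique, so that they agree on smaller balls and glue to an entire function.
  have hex : ∀ n : ℕ, ∃ g : ℂ → ℂ, DifferentiableOn ℂ g (Metric.ball 0 (n + n₀ : ℝ)) ∧
      (∀ x ∈ Metric.ball 0 (n + n₀ : ℝ), wr f g x = W x) ∧ g x₀ = 0 := by
    intro n
    obtain ⟨g, hg, hgW⟩ := exists_wronskian_partner_ball hf hW hs hc (n + n₀ : ℝ)
    refine ⟨fun x => g x + -(g x₀ / f x₀) * f x, hg.fun_add (hf.differentiableOn.const_mul _),
      fun x hx => ?_, ?_⟩
    · rw [wr_add_const_mul (hf x) (hg.differentiableAt (Metric.isOpen_ball.mem_nhds hx)), hgW x hx]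
    · field_simp
      ring
  choose g hg hgW hg0 using hex
  have hmem : ∀ n : ℕ, x₀ ∈ Metric.ball (0 : ℂ) (n + n₀ : ℝ) := fun n => by
    rw [mem_ball_zero_iff]
    have : (0 : ℝ) ≤ n := n.cast_nonneg
    linarith
  have hle : ∀ n k : ℕ, n ≤ k → ∀ x ∈ Metric.ball (0 : ℂ) (n + n₀ : ℝ), g k x = g n x := by
    intro n k hnk x hx
    have hsub : Metric.ball (0 : ℂ) (n + n₀ : ℝ) ⊆ Metric.ball (0 : ℂ) (k + n₀ : ℝ) := by
      apply Metric.ball_subset_ball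
      have : (n : ℝ) ≤ k := by exact_mod_cast hnk
      linarith
    have hgk := (hg k).mono hsub
    have := eqOn_const_mul_of_wr_eq_zero Metric.isOpen_ball (convex_ball _ _).isPreconnected
      hf.differentiableOn (hgk.fun_sub ((hg n).const_mul 1)) (hmem n) hx₀
      (fun y hy => by
        rw [wr_sub_const_mul (hgk.differentiableAt (Metric.isOpen_ball.mem_nhds hy))
          ((hg n).differentiableAt (Metric.isOpen_ball.mem_nhds hy)), hgW n y hy,
          hgW k y (hsub hy), one_mul, sub_self]) x hx
    simp only [hg0, one_mul, sub_self, zero_div, zero_mul] at this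
    exact sub_eq_zero.1 this
  have hbig : ∀ x : ℂ, x ∈ Metric.ball (0 : ℂ) ((⌈‖x‖⌉₊ + 1 : ℕ) + n₀ : ℝ) := fun x => by
    rw [mem_ball_zero_iff]
    have h1 := Nat.le_ceil ‖x‖
    have h2 : (0 : ℝ) ≤ n₀ := n₀.cast_nonneg
    push_cast
    linarith
  have hev : ∀ x, (fun y => g (⌈‖y‖⌉₊ + 1) y) =ᶠ[𝓝 x] g (⌈‖x‖⌉₊ + 1) := by
    intro x
    filter_upwards [Metric.isOpen_ball.mem_nhds (hbig x)] with y hy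
    rcases le_total (⌈‖y‖⌉₊ + 1) (⌈‖x‖⌉₊ + 1) with h | h
    · exact (hle _ _ h y (hbig y)).symm
    · exact hle _ _ h y hy
  refine ⟨fun y => g (⌈‖y‖⌉₊ + 1) y, fun x => ?_, fun x => ?_⟩
  · exact ((hg _).differentiableAt (Metric.isOpen_ball.mem_nhds (hbig x))).congr_of_eventuallyEq
      (hev x)
  · rw [← hgW _ x (hbig x), wr, wr, (hev x).deriv_eq]

/-- The solution `g` of `Wr(f,g) = W` is a theta-polynomial if `f` is one, `W` is quasi-periodic
and the first multiplier of `W` is not `1`. -/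
lemma exists_thetaPoly_partner {τ : ℂ} {m : ℕ} {f g W : ℂ → ℂ} {A B C : ℂ}
    (hf : IsThetaPoly τ m 1 B f) (hB : B ≠ 0) {x₀ : ℂ} (hx₀ : f x₀ ≠ 0)
    (hg : Differentiable ℂ g) (hgW : ∀ x, wr f g x = W x) (hA : A ≠ 1)
    (hW1 : ∀ x, W (x + 1) = A * W x)
    (hWτ : ∀ x, W (x + τ) =
      C * (B * (-1) ^ m * cexp (-π * I * m * τ - 2 * π * I * m * x)) ^ 2 * W x) :
    ∃ g : ℂ → ℂ, (∀ x, wr f g x = W x) ∧ IsThetaPoly τ m A (C * B) g := by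
  have hfd := hf.entire
  have hsq : ((-1 : ℂ) ^ m) * (-1) ^ m = 1 := by rw [← mul_pow]; simp
  have hconst : ∀ d : ℂ → ℂ, Differentiable ℂ d → (∀ x, wr f d x = 0) →
      ∃ κ : ℂ, ∀ x, d x = κ * f x := fun d hd h =>
    ⟨_, fun x => eqOn_const_mul_of_wr_eq_zero isOpen_univ isPreconnected_univ
      hfd.differentiableOn hd.differentiableOn (Set.mem_univ x₀) hx₀ (fun x _ => h x) x trivial⟩
  have hf1 : ∀ x, f (x + 1) = (-1) ^ m * f x := fun x => by rw [hf.add_one, one_mul]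
  have hf1' : ∀ x, deriv f (x + 1) = (-1) ^ m * deriv f x := fun x => by
    rw [← deriv_comp_add_const, funext hf1, deriv_const_mul _ (hfd x)]
  -- The defect of quasi-periodicity under 1 has zero Wronskian with f, so it is κ f. Since f has
  -- first multiplier 1, adding c f to g changes the defect by c (1 - A)(-1)^m f; this determines c,
  -- as A ≠ 1.
  obtain ⟨κ, hκ⟩ := hconst (fun x => g (x + 1) - A * (-1) ^ m * g x) (by fun_prop) fun x => by
    rw [wr_sub_const_mul (by fun_prop) (hg x), wr, deriv_comp_add_const, hgW]
    have h1 := hgW (x + 1)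
    rw [wr, hf1, hf1', hW1] at h1
    linear_combination (-1) ^ m * h1 - (f x * deriv g (x + 1) - deriv f x * g (x + 1)) * hsq
  set c := κ / ((A - 1) * (-1) ^ m) with hcdef
  have hA1 : A - 1 ≠ 0 := sub_ne_zero.2 hA
  have hm0 : ((-1 : ℂ) ^ m) ≠ 0 := by simp
  set h : ℂ → ℂ := fun x => g x + c * f x with hh
  have hhd : Differentiable ℂ h := by fun_prop
  have hhW : ∀ x, wr f h x = W x := fun x => by rw [hh, wr_add_const_mul (hfd x) (hg x), hgW]
  have hh1 : ∀ x, h (x + 1) = A * (-1) ^ m * h x := fun x => by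
    have e1 : κ = c * ((A - 1) * (-1) ^ m) := by rw [hcdef]; field_simp
    simp only [hh]
    rw [hf1]
    linear_combination hκ x + f x * e1
  set E : ℂ → ℂ := fun x => cexp (-π * I * m * τ - 2 * π * I * m * x) with hE
  have hEd : ∀ x, HasDerivAt E (-(2 * π * I * m) * E x) x := fun x => by
    have := (((hasDerivAt_id x).const_mul (2 * π * I * m)).const_sub (-π * I * m * τ)).cexp
    simp only [id, mul_one] at this
    rw [mul_comm]
    exact this
  have hE0 : ∀ x, E x ≠ 0 := fun x => Complex.exp_ne_zero _
  have hE1 : ∀ x, E (x + 1) = E x := fun x => by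
    simp only [hE]
    rw [show -π * I * m * τ - 2 * π * I * m * (x + 1)
      = -π * I * m * τ - 2 * π * I * m * x - m * (2 * π * I) by ring, Complex.exp_sub,
      Complex.exp_nat_mul_two_pi_mul_I, div_one]
  set M : ℂ → ℂ := fun x => B * (-1) ^ m * E x with hM
  have hM0 : ∀ x, M x ≠ 0 := fun x => mul_ne_zero (mul_ne_zero hB hm0) (hE0 x)
  have hMd : ∀ x, HasDerivAt M (-(2 * π * I * m) * M x) x := fun x => by
    refine ((hEd x).const_mul (B * (-1) ^ m)).congr_deriv ?_
    simp only [hM]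
    ring
  have hfτ : ∀ x, f (x + τ) = M x * f x := hf.add_tau
  have hfτ' : ∀ x, deriv f (x + τ) = M x * (deriv f x - 2 * π * I * m * f x) := fun x => by
    rw [← deriv_comp_add_const, funext hfτ, ((hMd x).fun_mul (hfd x).hasDerivAt).deriv]
    ring
  have hq : ∀ x, HasDerivAt (fun x => h (x + τ) / M x)
      ((deriv h (x + τ) + 2 * π * I * m * h (x + τ)) / M x) x := fun x => by
    have := ((hhd (x + τ)).hasDerivAt.comp_add_const x τ).fun_div (hMd x) (hM0 x)
    refine this.congr_deriv ?_
    have := hM0 x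
    field_simp
    ring
  -- M is the multiplier of f under τ and C M² that of W, which makes the Wronskian of f with this
  -- defect vanish.
  obtain ⟨κ', hκ'⟩ := hconst (fun x => h (x + τ) / M x - C * h x)
    (fun x => (hq x).differentiableAt.fun_sub ((hhd x).const_mul C)) fun x => by
    rw [wr_sub_const_mul (hq x).differentiableAt (hhd x), wr, (hq x).deriv, hhW]
    have h1 := hhW (x + τ)
    rw [wr, hfτ, hfτ', hWτ] at h1
    change _ = C * M x ^ 2 * W x at h1
    have := hM0 x
    field_simp
    apply mul_left_cancel₀ this
    linear_combination h1
  -- Under x ↦ x + 1 the left side of `hκ'` is multiplied by A(-1)^m but f by (-1)^m, and A ≠ 1.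
  have hκ0 : κ' = 0 := by
    have h1 := hκ' (x₀ + 1)
    rw [show x₀ + 1 + τ = x₀ + τ + 1 by ring, hh1, hh1, hf1,
      show M (x₀ + 1) = M x₀ by simp only [hM, hE1]] at h1
    have h2 := hκ' x₀
    have : κ' * ((A - 1) * (-1) ^ m * f x₀) = 0 := by
      linear_combination h1 - A * (-1) ^ m * h2
    exact (mul_eq_zero.1 this).resolve_right (mul_ne_zero (mul_ne_zero hA1 hm0) hx₀)
  refine ⟨h, hhW, hhd, hh1, fun x => ?_⟩
  have h1 := hκ' x
  rw [hκ0, zero_mul, sub_eq_zero, div_eq_iff (hM0 x)] at h1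
  rw [h1]
  simp only [hM, hE]
  ring

end EllipticBethe

namespace EllipticBethe

open Real Complex Filter Topology

/-! ### Products of theta functions -/

/-- The product `∏_i θ(x - a_i)`. -/
noncomputable def thetaProd (τ : ℂ) {ι : Type*} [Fintype ι] (a : ι → ℂ) (x : ℂ) : ℂ :=
  ∏ i, theta τ (x - a i)

section thetaProd

variable {τ : ℂ} {ι : Type*} [Fintype ι]

lemma differentiable_thetaProd (hτ : 0 < τ.im) (a : ι → ℂ) : Differentiable ℂ (thetaProd τ a) := by
  have := differentiable_theta hτ
  unfold thetaProd
  fun_prop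

lemma thetaProd_eq_zero_iff (hτ : 0 < τ.im) {a : ι → ℂ} {x : ℂ} :
    thetaProd τ a x = 0 ↔ ∃ i, InLattice τ (x - a i) := by
  simp [thetaProd, Finset.prod_eq_zero_iff, theta_eq_zero_iff hτ]

lemma thetaProd_add_one (a : ι → ℂ) (x : ℂ) :
    thetaProd τ a (x + 1) = (-1) ^ Fintype.card ι * thetaProd τ a x := by
  simp only [thetaProd, add_sub_right_comm, theta_add_one]
  rw [Finset.prod_neg, Finset.card_univ]

lemma thetaProd_add_tau (hτ : 0 < τ.im) (a : ι → ℂ) (x : ℂ) :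
    thetaProd τ a (x + τ) = cexp (2 * π * I * ∑ i, a i) * (-1) ^ Fintype.card ι *
      cexp (-π * I * Fintype.card ι * τ - 2 * π * I * Fintype.card ι * x) * thetaProd τ a x := by
  simp only [thetaProd, add_sub_right_comm, theta_add_tau hτ]
  rw [Finset.prod_mul_distrib, Finset.prod_neg, Finset.card_univ, ← Complex.exp_sum]
  have : ∑ i, (-π * I * τ - 2 * π * I * (x - a i)) = 2 * π * I * ∑ i, a i +
      (-π * I * Fintype.card ι * τ - 2 * π * I * Fintype.card ι * x) := by
    simp only [mul_sub, Finset.sum_sub_distrib, Finset.sum_const, Finset.card_univ, nsmul_eq_mul,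
      ← Finset.mul_sum]
    ring
  rw [this, Complex.exp_add]
  ring

lemma thetaProd_add_lattice (hτ : 0 < τ.im) (a : ι → ℂ) (k l : ℤ) :
    ∃ c : ℂ, c ≠ 0 ∧ ∀ x, thetaProd τ a (x + (k + l * τ)) =
      c * cexp (-2 * π * I * l * Fintype.card ι * x) * thetaProd τ a x := by
  obtain ⟨c, hc, h⟩ := theta_add_lattice hτ k l
  refine ⟨∏ i, (c * cexp (2 * π * I * l * a i)),
    Finset.prod_ne_zero_iff.2 fun i _ => mul_ne_zero hc (Complex.exp_ne_zero _), fun x => ?_⟩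
  simp only [thetaProd, add_sub_right_comm, h]
  have : cexp (-2 * π * I * l * Fintype.card ι * x) = ∏ _i : ι, cexp (-2 * π * I * l * x) := by
    rw [Finset.prod_const, Finset.card_univ, ← Complex.exp_nat_mul]
    ring_nf
  rw [this, ← Finset.prod_mul_distrib, ← Finset.prod_mul_distrib]
  refine Finset.prod_congr rfl fun i _ => ?_
  have e : cexp (-2 * π * I * l * (x - a i)) =
      cexp (2 * π * I * l * a i) * cexp (-2 * π * I * l * x) := by
    rw [← Complex.exp_add]; ring_nf
  rw [e]
  ring

lemma hasDerivAt_thetaProd (hτ : 0 < τ.im) {a : ι → ℂ} {x : ℂ}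
    (hx : ∀ i, ¬ InLattice τ (x - a i)) :
    HasDerivAt (thetaProd τ a) (thetaProd τ a x * ∑ i, rho τ (x - a i)) x := by
  classical
  have := HasDerivAt.fun_finsetProd (u := Finset.univ) (x := x) (f := fun i y => theta τ (y - a i))
    (f' := fun i => deriv (theta τ) (x - a i)) fun i _ =>
      (differentiable_theta hτ (x - a i)).hasDerivAt.comp_sub_const x (a i)
  refine this.congr_deriv ?_
  rw [Finset.mul_sum]
  refine Finset.sum_congr rfl fun i _ => ?_
  have h0 : theta τ (x - a i) ≠ 0 := by rw [Ne, theta_eq_zero_iff hτ]; exact hx i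
  rw [smul_eq_mul, thetaProd, ← Finset.mul_prod_erase _ _ (Finset.mem_univ i), rho]
  field_simp

end thetaProd

lemma deriv_deriv_theta_zero (τ : ℂ) : deriv (deriv (theta τ)) 0 = 0 := by
  have h := deriv_comp_neg (deriv (theta τ)) 0
  rw [funext fun x => deriv_theta_neg (τ := τ) x, neg_zero] at h
  have : (2 : ℂ) * deriv (deriv (theta τ)) 0 = 0 := by linear_combination h
  simpa using this

/-! ### Theta-polynomials attached to a solution -/

section solution

variable {τ : ℂ} {m : ℕ}

/-- The function `e^{-2πiμx} ∏_a θ(x - z_a)`. -/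
noncomputable def betheWr (τ : ℂ) {m : ℕ} (s : BetheData m) (x : ℂ) : ℂ :=
  cexp (-2 * π * I * s.mu * x) * thetaProd τ s.z x

lemma differentiable_betheWr (hτ : 0 < τ.im) (s : BetheData m) :
    Differentiable ℂ (betheWr τ s) := by
  have := differentiable_thetaProd hτ s.z
  unfold betheWr
  fun_prop

lemma betheWr_eq_zero_iff (hτ : 0 < τ.im) {s : BetheData m} {x : ℂ} :
    betheWr τ s x = 0 ↔ ∃ a, InLattice τ (x - s.z a) := by
  rw [betheWr, mul_eq_zero, or_iff_right (Complex.exp_ne_zero _), thetaProd_eq_zero_iff hτ]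

lemma betheWr_add_one (s : BetheData m) (x : ℂ) :
    betheWr τ s (x + 1) = cexp (-2 * π * I * s.mu) * betheWr τ s x := by
  rw [betheWr, betheWr, thetaProd_add_one, mul_add, Complex.exp_add]
  simp only [Fintype.card_fin, pow_mul, mul_one]
  norm_num
  ring

/-- The multiplier is factored through the square of the one of ∏ θ(x - t_j), the form required by
`exists_thetaPoly_partner`; the t_j cancel in the product. -/
lemma betheWr_add_tau (hτ : 0 < τ.im) (s : BetheData m) (x : ℂ) :
    betheWr τ s (x + τ) = cexp (-2 * π * I * s.mu * τ + 2 * π * I * ∑ a, s.z a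
        - 4 * π * I * ∑ j, s.t j) *
      (cexp (2 * π * I * ∑ j, s.t j) * (-1) ^ m *
        cexp (-π * I * m * τ - 2 * π * I * m * x)) ^ 2 * betheWr τ s x := by
  rw [betheWr, betheWr, thetaProd_add_tau hτ, mul_add, Complex.exp_add]
  have hsq : ((-1 : ℂ) ^ m) ^ 2 = 1 := by rw [← pow_mul, mul_comm, pow_mul]; simp
  simp only [Fintype.card_fin, mul_pow, hsq, ← Complex.exp_nat_mul, pow_mul]
  have : cexp (-2 * π * I * s.mu * τ) * (cexp (2 * π * I * ∑ a, s.z a) *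
      cexp (-π * I * (2 * m : ℕ) * τ - 2 * π * I * (2 * m : ℕ) * x)) =
      cexp (-2 * π * I * s.mu * τ + 2 * π * I * ∑ a, s.z a - 4 * π * I * ∑ j, s.t j) *
      (cexp ((2 : ℕ) * (2 * π * I * ∑ j, s.t j)) *
        cexp ((2 : ℕ) * (-π * I * m * τ - 2 * π * I * m * x))) := by
    simp only [← Complex.exp_add]
    push_cast
    ring_nf
  norm_num at this ⊢
  linear_combination (cexp (-(2 * π * I * s.mu * x)) * thetaProd τ s.z x) * this

lemma hasDerivAt_betheWr (hτ : 0 < τ.im) {s : BetheData m} {x : ℂ}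
    (hx : ∀ a, ¬ InLattice τ (x - s.z a)) :
    HasDerivAt (betheWr τ s)
      (betheWr τ s x * (-2 * π * I * s.mu + ∑ a, rho τ (x - s.z a))) x := by
  have h1 : HasDerivAt (fun x => cexp (-2 * π * I * s.mu * x))
      (cexp (-2 * π * I * s.mu * x) * (-2 * π * I * s.mu)) x := by
    simpa using ((hasDerivAt_id x).const_mul (-2 * π * I * s.mu)).cexp
  refine (h1.fun_mul (hasDerivAt_thetaProd hτ hx)).congr_deriv ?_
  rw [betheWr]
  ring

lemma isThetaPoly_thetaProd (hτ : 0 < τ.im) (t : Fin m → ℂ) :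
    IsThetaPoly τ m 1 (cexp (2 * π * I * ∑ j, t j)) (thetaProd τ t) where
  entire := differentiable_thetaProd hτ t
  add_one x := by simpa using thetaProd_add_one t x
  add_tau x := by simpa using thetaProd_add_tau hτ t x

/-- The values of `f'` and `f''` at a simple zero `t_j` of `f = ∏_k θ(x - t_k)`. -/
lemma deriv_thetaProd_self (hτ : 0 < τ.im) {t : Fin m → ℂ}
    (ht : ∀ i j, i ≠ j → ¬ InLattice τ (t i - t j)) (j : Fin m) :
    deriv (thetaProd τ t) (t j) ≠ 0 ∧
    deriv (deriv (thetaProd τ t)) (t j) = 2 * deriv (thetaProd τ t) (t j) *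
      ∑ k ∈ Finset.univ.erase j, rho τ (t j - t k) := by
  have hth := differentiable_theta hτ
  set h : ℂ → ℂ := thetaProd τ (fun k : {k // k ≠ j} => t k) with hh
  have hhd : Differentiable ℂ h := differentiable_thetaProd hτ _
  -- With the simple factor split off, θ(0) = θ''(0) = 0 and θ'(0) = 1 give f' = h and f'' = 2h' at
  -- t_j.
  have hf : thetaProd τ t = fun x => theta τ (x - t j) * h x := by
    ext x
    rw [thetaProd, ← Finset.mul_prod_erase _ _ (Finset.mem_univ j), hh, thetaProd]
    congr 1
    exact Finset.prod_subtype _ (by simp) _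
  have hne : ∀ k : {k // k ≠ j}, ¬ InLattice τ (t j - t k) := fun k => ht j k k.2.symm
  have h1 : ∀ x, HasDerivAt (thetaProd τ t)
      (deriv (theta τ) (x - t j) * h x + theta τ (x - t j) * deriv h x) x := fun x => by
    rw [hf]
    exact ((hth (x - t j)).hasDerivAt.comp_sub_const x (t j)).fun_mul (hhd x).hasDerivAt
  have h2 := (((differentiable_deriv hth (t j - t j)).hasDerivAt.comp_sub_const (t j) (t j)).fun_mul
    (hhd (t j)).hasDerivAt).fun_add (((hth (t j - t j)).hasDerivAt.comp_sub_const (t j) (t j)).fun_mul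
    (differentiable_deriv hhd (t j)).hasDerivAt)
  have e1 : deriv (thetaProd τ t) (t j) = h (t j) := by
    rw [(h1 (t j)).deriv, sub_self, deriv_theta_zero hτ, theta_zero]
    ring
  have e2 : deriv (deriv (thetaProd τ t)) (t j) = 2 * deriv h (t j) := by
    rw [funext fun x => (h1 x).deriv, h2.deriv, sub_self, deriv_theta_zero hτ, theta_zero,
      deriv_deriv_theta_zero τ]
    ring
  have hsum : ∑ k ∈ Finset.univ.erase j, rho τ (t j - t k) =
      ∑ k : {k // k ≠ j}, rho τ (t j - t k) :=
    Finset.sum_subtype _ (by simp) _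
  rw [e2, e1, hsum, (hasDerivAt_thetaProd hτ hne).deriv]
  refine ⟨?_, by ring⟩
  rw [Ne, hh, thetaProd_eq_zero_iff hτ]
  simpa using hne

/-- Serves to carry a condition on derivatives from t_j to its lattice translates. -/
lemma exists_exp_shift_deriv {f : ℂ → ℂ} (hf : Differentiable ℂ f) {c a ω : ℂ}
    (h : ∀ x, f (x + ω) = c * cexp (a * x) * f x) :
    (∀ x, deriv f (x + ω) = c * cexp (a * x) * (deriv f x + a * f x)) ∧
    ∀ x, deriv (deriv f) (x + ω) =
      c * cexp (a * x) * (deriv (deriv f) x + 2 * a * deriv f x + a ^ 2 * f x) := by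
  have hE : ∀ x, HasDerivAt (fun x => c * cexp (a * x)) (c * cexp (a * x) * a) x := fun x => by
    have := (((hasDerivAt_id x).const_mul a).cexp).const_mul c
    simpa [mul_assoc] using this
  have h1 : ∀ x, deriv f (x + ω) = c * cexp (a * x) * (deriv f x + a * f x) := fun x => by
    rw [← deriv_comp_add_const, funext h, ((hE x).fun_mul (hf x).hasDerivAt).deriv]
    ring
  refine ⟨h1, fun x => ?_⟩
  rw [← deriv_comp_add_const, funext h1, ((hE x).fun_mul
    ((differentiable_deriv hf x).hasDerivAt.fun_add ((hf x).hasDerivAt.const_mul a))).deriv]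
  ring

/-- The Bethe ansatz equations say that `W/f²` has no residues. -/
lemma IsBetheSolution.no_residue (hτ : 0 < τ.im) {s : BetheData m} (hs : IsBetheSolution τ s)
    {x : ℂ} (hx : thetaProd τ s.t x = 0) :
    deriv (thetaProd τ s.t) x ≠ 0 ∧
    deriv (deriv (thetaProd τ s.t)) x * betheWr τ s x =
      deriv (thetaProd τ s.t) x * deriv (betheWr τ s) x := by
  obtain ⟨j, k, l, hkl⟩ := (thetaProd_eq_zero_iff hτ).1 hx
  obtain rfl : x = s.t j + (k + l * τ) := by linear_combination hkl
  obtain ⟨hne, h2⟩ := deriv_thetaProd_self hτ hs.t_distinct j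
  have hW := (hasDerivAt_betheWr hτ (fun a => hs.t_ne_z j a)).deriv
  have h0 : thetaProd τ s.t (s.t j) = 0 :=
    (thetaProd_eq_zero_iff hτ).2 ⟨j, by simpa using inLattice_zero τ⟩
  obtain ⟨c, hc, hsh⟩ := thetaProd_add_lattice hτ s.t k l
  obtain ⟨d, hd, hsh'⟩ := thetaProd_add_lattice hτ s.z k l
  simp only [Fintype.card_fin] at hsh hsh'
  obtain ⟨f1, f2⟩ := exists_exp_shift_deriv (differentiable_thetaProd hτ s.t) hsh
  -- The exponent is twice the one for f. Therefore the shift adds the same term 2a f' W, with a the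
  -- exponent for f, to both sides of the condition, and the condition at t_j suffices.
  have hWsh : ∀ x, betheWr τ s (x + (k + l * τ)) = cexp (-2 * π * I * s.mu * (k + l * τ)) * d *
      cexp (2 * (-2 * π * I * l * m) * x) * betheWr τ s x := fun x => by
    rw [betheWr, betheWr, hsh', mul_add, Complex.exp_add]
    push_cast
    ring_nf
  obtain ⟨W1, -⟩ := exists_exp_shift_deriv (differentiable_betheWr hτ s) hWsh
  rw [f1, f2, W1, hWsh, h0]
  refine ⟨by simpa [hc, Complex.exp_ne_zero] using hne, ?_⟩
  have hb := hs.bethe j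
  rw [h2, hW]
  linear_combination (c * cexp (-2 * π * I * l * m * s.t j) *
    (cexp (-2 * π * I * s.mu * (k + l * τ)) * d * cexp (2 * (-2 * π * I * l * m) * s.t j)) *
    deriv (thetaProd τ s.t) (s.t j) * betheWr τ s (s.t j)) * hb

lemma thetaProd_ne_zero_fun (hτ : 0 < τ.im) {ι : Type*} [Fintype ι] (a : ι → ℂ) :
    ∃ x, thetaProd τ a x ≠ 0 := by
  have : (⋃ i, {x : ℂ | InLattice τ (x - a i)}).Countable :=
    Set.countable_iUnion fun i => countable_inLattice_sub τ (a i)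
  obtain ⟨x, hx⟩ := (this.dense_compl ℂ).nonempty
  refine ⟨x, fun h => hx ?_⟩
  obtain ⟨i, hi⟩ := (thetaProd_eq_zero_iff hτ).1 h
  exact Set.mem_iUnion.2 ⟨i, hi⟩

/-- The pair `(f,g)` of a solution: `f = ∏_j θ(x - t_j)` and
`Wr(f,g) = e^{-2πiμx} ∏_a θ(x - z_a)`. -/
lemma exists_thetaPair (hτ : 0 < τ.im) {s : BetheData m} (hs : IsBetheSolution τ s)
    (hμ : ∀ k : ℤ, s.mu ≠ k) :
    ∃ P : ThetaPair τ m, P.f = thetaProd τ s.t ∧ ∀ x, wr P.f P.g x = betheWr τ s x := by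
  obtain ⟨x₀, hx₀⟩ := thetaProd_ne_zero_fun hτ s.t
  obtain ⟨x₁, hx₁⟩ := thetaProd_ne_zero_fun hτ s.z
  obtain ⟨g₀, hg₀, hgW₀⟩ := exists_wronskian_partner (differentiable_thetaProd hτ s.t)
    (differentiable_betheWr hτ s) (fun x hx => (hs.no_residue hτ hx).1)
    (fun x hx => (hs.no_residue hτ hx).2)
  -- This is where μ ∉ ℤ enters: it is the condition that the first multiplier of W, and so of g, is
  -- not 1.
  have hA : cexp (-2 * π * I * s.mu) ≠ 1 := by
    rw [Ne, Complex.exp_eq_one_iff]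
    rintro ⟨n, hn⟩
    apply hμ (-n)
    have h2 : (2 * π * I : ℂ) ≠ 0 := Complex.two_pi_I_ne_zero
    apply mul_left_cancel₀ h2
    push_cast
    linear_combination -hn
  obtain ⟨g, hgW, hg⟩ := exists_thetaPoly_partner (isThetaPoly_thetaProd hτ s.t)
    (Complex.exp_ne_zero _) hx₀ hg₀ hgW₀ hA (betheWr_add_one s) (betheWr_add_tau hτ s)
  refine ⟨⟨thetaProd τ s.t, g, fun h => hx₀ (by rw [h]; rfl), ?_, ⟨_, Complex.exp_ne_zero _,
    isThetaPoly_thetaProd hτ s.t⟩, ⟨_, _, Complex.exp_ne_zero _, hA,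
    mul_ne_zero (Complex.exp_ne_zero _) (Complex.exp_ne_zero _), hg⟩⟩, rfl, hgW⟩
  rintro rfl
  have := hgW x₁
  simp only [wr, Pi.zero_apply, deriv_zero, mul_zero, sub_zero] at this
  exact mul_ne_zero (Complex.exp_ne_zero _) hx₁ this.symm

/-! ### Equivalent solutions -/

lemma thetaProd_update {n : ℕ} (a : Fin n → ℂ) (i : Fin n) (b : ℂ) {E x : ℂ}
    (h : theta τ (x - b) = E * theta τ (x - a i)) :
    thetaProd τ (Function.update a i b) x = E * thetaProd τ a x := by
  rw [thetaProd, thetaProd, ← Finset.mul_prod_erase _ _ (Finset.mem_univ i),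
    ← Finset.mul_prod_erase _ (fun j => theta τ (x - a j)) (Finset.mem_univ i)]
  have : ∏ j ∈ Finset.univ.erase i, theta τ (x - Function.update a i b j) =
      ∏ j ∈ Finset.univ.erase i, theta τ (x - a j) :=
    Finset.prod_congr rfl fun j hj => by rw [Function.update_of_ne (Finset.ne_of_mem_erase hj)]
  rw [this, Function.update_self, h]
  ring

lemma thetaProd_comp_perm {n : ℕ} (a : Fin n → ℂ) (e : Equiv.Perm (Fin n)) :
    thetaProd τ (a ∘ e) = thetaProd τ a := by
  ext x
  exact Equiv.prod_comp e fun j => theta τ (x - a j)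

lemma theta_sub_add_tau (hτ : 0 < τ.im) (y x : ℂ) : theta τ (x - (y + τ)) =
    -cexp (-π * I * τ - 2 * π * I * y) * cexp (2 * π * I * x) * theta τ (x - y) := by
  have := theta_add_tau hτ (x - (y + τ))
  rw [show x - (y + τ) + τ = x - y by ring] at this
  rw [this]
  have e : cexp (-π * I * τ - 2 * π * I * y) * cexp (2 * π * I * x) *
      cexp (-π * I * τ - 2 * π * I * (x - (y + τ))) = 1 := by
    rw [← Complex.exp_add, ← Complex.exp_add, ← Complex.exp_zero]
    ring_nf
  linear_combination (-theta τ (x - (y + τ))) * e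

lemma theta_sub_add_one (y x : ℂ) : theta τ (x - (y + 1)) = -1 * theta τ (x - y) := by
  have := theta_add_one τ (x - (y + 1))
  rw [show x - (y + 1) + 1 = x - y by ring] at this
  rw [this]
  ring

/-- Moving t_j by τ multiplies f by a constant times e^{2πix}, and the accompanying μ ↦ μ - 2
multiplies W by e^{4πix}. Moving z_a by τ produces e^{2πix} in the product, which μ ↦ μ + 1
compensates. -/
lemma BetheStep.exists_exp (hτ : 0 < τ.im) {s s' : BetheData m} (h : BetheStep τ s s') :
    ∃ (k : ℤ) (c d : ℂ), c ≠ 0 ∧ d ≠ 0 ∧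
      (∀ x, thetaProd τ s'.t x = c * cexp (2 * π * I * k * x) * thetaProd τ s.t x) ∧
      ∀ x, betheWr τ s' x = d * cexp (2 * π * I * k * x) ^ 2 * betheWr τ s x := by
  have h1 : ∀ x : ℂ, cexp (2 * π * I * (1 : ℤ) * x) = cexp (2 * π * I * x) := fun x => by simp
  have h0 : ∀ x : ℂ, cexp (2 * π * I * (0 : ℤ) * x) = 1 := fun x => by simp
  cases h with
  | permT e =>
    refine ⟨0, 1, 1, one_ne_zero, one_ne_zero, fun x => ?_, fun x => ?_⟩
    · rw [thetaProd_comp_perm, h0, one_mul, one_mul]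
    · rw [h0, one_pow, one_mul, one_mul]; rfl
  | permZ e =>
    refine ⟨0, 1, 1, one_ne_zero, one_ne_zero, fun x => ?_, fun x => ?_⟩
    · rw [h0, one_mul, one_mul]
    · rw [h0, one_pow, one_mul, one_mul, betheWr, thetaProd_comp_perm]; rfl
  | tTau j =>
    refine ⟨1, -cexp (-π * I * τ - 2 * π * I * s.t j), 1,
      neg_ne_zero.2 (Complex.exp_ne_zero _), one_ne_zero, fun x => ?_, fun x => ?_⟩
    · rw [h1, thetaProd_update _ _ _ (theta_sub_add_tau hτ (s.t j) x)]
    · rw [h1, betheWr, betheWr]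
      have e : cexp (-2 * π * I * (s.mu - 2) * x) =
          cexp (2 * π * I * x) ^ 2 * cexp (-2 * π * I * s.mu * x) := by
        rw [← Complex.exp_nat_mul, ← Complex.exp_add]
        congr 1
        push_cast
        ring
      rw [e]
      ring
  | tOne j =>
    refine ⟨0, -1, 1, neg_ne_zero.2 one_ne_zero, one_ne_zero, fun x => ?_, fun x => ?_⟩
    · rw [h0, thetaProd_update _ _ _ (theta_sub_add_one (s.t j) x), mul_one]
    · rw [h0, one_pow, one_mul, one_mul]; rfl
  | zTau a =>
    refine ⟨0, 1, -cexp (-π * I * τ - 2 * π * I * s.z a), one_ne_zero,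
      neg_ne_zero.2 (Complex.exp_ne_zero _), fun x => ?_, fun x => ?_⟩
    · rw [h0, one_mul, one_mul]
    · rw [h0, betheWr, betheWr, thetaProd_update _ _ _ (theta_sub_add_tau hτ (s.z a) x)]
      have e : cexp (-2 * π * I * s.mu * x) =
          cexp (-2 * π * I * (s.mu + 1) * x) * cexp (2 * π * I * x) := by
        rw [← Complex.exp_add]
        congr 1
        ring
      rw [e]
      ring
  | zOne a =>
    refine ⟨0, 1, -1, one_ne_zero, neg_ne_zero.2 one_ne_zero, fun x => ?_, fun x => ?_⟩
    · rw [h0, one_mul, one_mul]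
    · rw [h0, betheWr, betheWr, thetaProd_update _ _ _ (theta_sub_add_one (s.z a) x)]
      ring

/-- The invariant of the equivalence of solutions: `f` and `W` change by constants and by
`e^{2πikx}`, `e^{4πikx}`. -/
lemma BetheEquiv.exists_exp (hτ : 0 < τ.im) {s s' : BetheData m} (h : BetheEquiv τ s s') :
    ∃ (k : ℤ) (c d : ℂ), c ≠ 0 ∧ d ≠ 0 ∧
      (∀ x, thetaProd τ s'.t x = c * cexp (2 * π * I * k * x) * thetaProd τ s.t x) ∧
      ∀ x, betheWr τ s' x = d * cexp (2 * π * I * k * x) ^ 2 * betheWr τ s x := by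
  induction h with
  | rel s s' hstep => exact hstep.exists_exp hτ
  | refl s => exact ⟨0, 1, 1, one_ne_zero, one_ne_zero, by simp, by simp⟩
  | symm s s' _ ih =>
    obtain ⟨k, c, d, hc, hd, h1, h2⟩ := ih
    have e : ∀ x : ℂ, cexp (2 * π * I * (-k : ℤ) * x) * cexp (2 * π * I * k * x) = 1 := fun x => by
      rw [← Complex.exp_add, ← Complex.exp_zero]
      congr 1
      push_cast
      ring
    refine ⟨-k, c⁻¹, d⁻¹, inv_ne_zero hc, inv_ne_zero hd, fun x => ?_, fun x => ?_⟩
    · apply mul_left_cancel₀ hc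
      rw [h1, mul_assoc, mul_inv_cancel_left₀ hc]
      linear_combination (-(c * thetaProd τ s.t x)) * e x
    · apply mul_left_cancel₀ hd
      rw [h2, mul_assoc, mul_inv_cancel_left₀ hd]
      have := congrArg (· ^ 2) (e x)
      simp only [mul_pow, one_pow] at this
      linear_combination (-(d * betheWr τ s x)) * this
  | trans s s' s'' _ _ ih ih' =>
    obtain ⟨k, c, d, hc, hd, h1, h2⟩ := ih
    obtain ⟨k', c', d', hc', hd', h1', h2'⟩ := ih'
    have e : ∀ x : ℂ, cexp (2 * π * I * (k + k' : ℤ) * x) =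
        cexp (2 * π * I * k * x) * cexp (2 * π * I * k' * x) := fun x => by
      rw [← Complex.exp_add]
      congr 1
      push_cast
      ring
    refine ⟨k + k', c * c', d * d', mul_ne_zero hc hc', mul_ne_zero hd hd', fun x => ?_,
      fun x => ?_⟩
    · rw [h1', h1, e]
      ring
    · rw [h2', h2, e]
      ring

/-! ### The class β(μ,t,z): existence and uniqueness -/

lemma wr_exp_mul {f g : ℂ → ℂ} (hf : Differentiable ℂ f) (hg : Differentiable ℂ g) (a c d x : ℂ) :
    wr (fun x => c * (cexp (a * x) * f x)) (fun x => d * (cexp (a * x) * g x)) x =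
      c * d * cexp (a * x) ^ 2 * wr f g x := by
  have hE : HasDerivAt (fun x => cexp (a * x)) (cexp (a * x) * a) x := by
    simpa using ((hasDerivAt_id x).const_mul a).cexp
  rw [wr, wr, ((hE.fun_mul (hf x).hasDerivAt).const_mul c).deriv,
    ((hE.fun_mul (hg x).hasDerivAt).const_mul d).deriv]
  ring

lemma ThetaPair.differentiable_f (P : ThetaPair τ m) : Differentiable ℂ P.f := by
  obtain ⟨B, -, h⟩ := P.f_theta
  exact h.entire

lemma ThetaPair.differentiable_g (P : ThetaPair τ m) : Differentiable ℂ P.g := by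
  obtain ⟨A, B, -, -, -, h⟩ := P.g_theta
  exact h.entire

/-- A pair is determined by `f` and, up to a constant, `Wr(f,g)`. -/
lemma ThetaPair.exists_of_wr_eq {P Q : ThetaPair τ m} {k : ℤ} {c d : ℂ} {x₁ : ℂ}
    (hx₁ : wr P.f P.g x₁ ≠ 0) (hc : c ≠ 0) (hd : d ≠ 0)
    (hf : ∀ x, Q.f x = c * (cexp (2 * π * I * k * x) * P.f x))
    (hW : ∀ x, wr Q.f Q.g x = d * cexp (2 * π * I * k * x) ^ 2 * wr P.f P.g x) :
    Q.toPoint = P.toPoint := by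
  obtain ⟨B, hB, hPf⟩ := P.f_theta
  obtain ⟨A', B', -, hA1', -, hQg⟩ := Q.g_theta
  obtain ⟨A, B'', -, hA1, -, hPg⟩ := P.g_theta
  have hPfd := P.differentiable_f
  have hPgd := P.differentiable_g
  have hQgd := Q.differentiable_g
  obtain ⟨x₀, hx₀⟩ : ∃ x₀, P.f x₀ ≠ 0 := Function.ne_iff.1 P.f_ne
  set E : ℂ → ℂ := fun x => cexp (2 * π * I * k * x) with hE
  -- Removing the common exponential reduces to two partners g and `P.g` of the same f, with
  -- proportional Wronskians; hence g - (d/c) `P.g` = κ `P.f`.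
  set g : ℂ → ℂ := fun x => cexp (-(2 * π * I * k) * x) * Q.g x with hg
  have hgd : Differentiable ℂ g := by fun_prop
  have hEE : ∀ x, E x * cexp (-(2 * π * I * k) * x) = 1 := fun x => by
    rw [hE, ← Complex.exp_add, ← Complex.exp_zero]; ring_nf
  have hQg' : ∀ x, Q.g x = 1 * (E x * g x) := fun x => by
    simp only [hg]
    linear_combination -Q.g x * hEE x
  have hwg : ∀ x, wr P.f g x = d / c * wr P.f P.g x := fun x => by
    have h1 := hW x
    rw [funext hf, funext hQg', wr_exp_mul hPfd hgd] at h1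
    have h0 : E x ^ 2 ≠ 0 := pow_ne_zero _ (Complex.exp_ne_zero _)
    have : E x ^ 2 * (c * wr P.f g x) = E x ^ 2 * (d * wr P.f P.g x) := by
      linear_combination h1
    rw [div_mul_eq_mul_div, eq_div_iff hc, mul_comm]
    exact mul_left_cancel₀ h0 this
  have hκ := fun x => eqOn_const_mul_of_wr_eq_zero isOpen_univ isPreconnected_univ
    hPfd.differentiableOn (hgd.fun_sub (hPgd.const_mul (d / c))).differentiableOn
    (Set.mem_univ x₀) hx₀ (fun x _ => by
      rw [wr_sub_const_mul (hgd x) (hPgd x), hwg, sub_self]) x (Set.mem_univ x)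
  set κ := (g x₀ - d / c * P.g x₀) / P.f x₀
  have hm0 : ((-1 : ℂ) ^ m) ≠ 0 := by simp
  have hg1 : ∀ x, g (x + 1) = A' * (-1) ^ m * g x := fun x => by
    simp only [hg]
    rw [hQg.add_one, mul_add, Complex.exp_add, show -(2 * π * I * k) * 1 = (-k : ℤ) * (2 * π * I)
      by push_cast; ring, Complex.exp_int_mul_two_pi_mul_I]
    ring
  have hW1 : ∀ (h : ℂ → ℂ) (a : ℂ), Differentiable ℂ h → (∀ x, h (x + 1) = a * (-1) ^ m * h x) →
      ∀ x, wr P.f h (x + 1) = a * wr P.f h x := fun h a hh h1 x => by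
    have e1 : deriv h (x + 1) = a * (-1) ^ m * deriv h x := by
      rw [← deriv_comp_add_const, funext h1, deriv_const_mul _ (hh x)]
    have e2 : deriv P.f (x + 1) = 1 * (-1) ^ m * deriv P.f x := by
      rw [← deriv_comp_add_const, funext hPf.add_one, deriv_const_mul _ (hPfd x)]
    have hsq : ((-1 : ℂ) ^ m) * (-1) ^ m = 1 := by rw [← mul_pow]; simp
    rw [wr, wr, e1, e2, h1, hPf.add_one]
    linear_combination a * (P.f x * deriv h x - deriv P.f x * h x) * hsq
  -- Since f has first multiplier 1, the first multiplier of Wr(f,·) is that of the second function.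
  have hAA : A' = A := by
    have e1 := hW1 g A' hgd hg1 x₁
    have e2 := hW1 P.g A hPgd hPg.add_one x₁
    rw [hwg, hwg, e2] at e1
    have : d / c * wr P.f P.g x₁ ≠ 0 := mul_ne_zero (div_ne_zero hd hc) hx₁
    apply mul_right_cancel₀ this
    linear_combination -e1
  have hκ0 : κ = 0 := by
    have e1 := hκ (x₀ + 1)
    have e2 := hκ x₀
    rw [hg1, hPg.add_one, hPf.add_one, hAA] at e1
    have : κ * ((A - 1) * (-1) ^ m * P.f x₀) = 0 := by
      linear_combination e1 - A * (-1) ^ m * e2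
    refine (mul_eq_zero.1 this).resolve_right (mul_ne_zero (mul_ne_zero (sub_ne_zero.2 hA1) hm0) hx₀)
  refine (Quotient.sound ⟨k, c, d / c, hc, div_ne_zero hd hc, hf, fun x => ?_⟩ :
    P.toPoint = Q.toPoint).symm
  have e := hκ x
  rw [hκ0, zero_mul, sub_eq_zero] at e
  rw [hQg', e]
  ring

lemma ThetaPair.wr_of_toPoint_eq {P Q : ThetaPair τ m} (h : P.toPoint = Q.toPoint) :
    ∃ (k : ℤ) (c d : ℂ), c ≠ 0 ∧ d ≠ 0 ∧
      (∀ x, Q.f x = c * (cexp (2 * π * I * k * x) * P.f x)) ∧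
      (∀ x, Q.g x = d * (cexp (2 * π * I * k * x) * P.g x)) ∧
      ∀ x, wr Q.f Q.g x = c * d * cexp (2 * π * I * k * x) ^ 2 * wr P.f P.g x := by
  obtain ⟨k, c, d, hc, hd, hf, hg⟩ := Quotient.exact h
  refine ⟨k, c, d, hc, hd, hf, hg, fun x => ?_⟩
  rw [funext hf, funext hg, wr_exp_mul P.differentiable_f P.differentiable_g]

/-- Existence and uniqueness of `β(μ,t,z)`. -/
lemma exists_beta (hτ : 0 < τ.im) {s : BetheData m} (hs : IsBetheSolution τ s)
    (hμ : ∀ k : ℤ, s.mu ≠ k) :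
    ∃ (p : Pairs₁ τ m) (P : ThetaPair τ m), P.toPoint = p.1 ∧ P.f = thetaProd τ s.t ∧
      (∀ x, wr P.f P.g x = betheWr τ s x) ∧ ∀ p' : Pairs₁ τ m, IsBeta τ s p' ↔ p' = p := by
  obtain ⟨P, hPf, hPW⟩ := exists_thetaPair hτ hs hμ
  -- Genericity is required of all representatives. Passing between them multiplies f and the
  -- Wronskian by functions without zeros, so it suffices that no t_j is congruent to a z_a.
  have hp : ∀ Q : ThetaPair τ m, Q.toPoint = P.toPoint →
      ∀ x, Q.f x = 0 → wr Q.f Q.g x ≠ 0 := by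
    intro Q hQ x hx
    obtain ⟨k, c, d, hc, hd, hf, -, hW⟩ := ThetaPair.wr_of_toPoint_eq hQ.symm
    rw [hW, hPW]
    refine mul_ne_zero (mul_ne_zero (mul_ne_zero hc hd) (pow_ne_zero _ (Complex.exp_ne_zero _))) ?_
    rw [hf, hPf] at hx
    have hx := (mul_eq_zero.1 ((mul_eq_zero.1 hx).resolve_left hc)).resolve_left
      (Complex.exp_ne_zero _)
    obtain ⟨j, hj⟩ := (thetaProd_eq_zero_iff hτ).1 hx
    rw [Ne, betheWr_eq_zero_iff hτ]
    rintro ⟨a, ha⟩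
    refine hs.t_ne_z j a ?_
    have := ha.add hj.neg
    rwa [show x - s.z a + -(x - s.t j) = s.t j - s.z a by ring] at this
  refine ⟨⟨P.toPoint, hp⟩, P, rfl, hPf, hPW, fun p' => ⟨?_, ?_⟩⟩
  · rintro ⟨s', hss', Q, hQp, hQf, e, he, hQW⟩
    obtain ⟨k, c, d, hc, hd, hf, hW⟩ := hss'.exists_exp hτ
    obtain ⟨x₁, hx₁⟩ := thetaProd_ne_zero_fun hτ s.z
    refine Subtype.ext (hQp.symm.trans ?_)
    refine ThetaPair.exists_of_wr_eq (k := k) (c := c) (d := e * d) (x₁ := x₁) ?_ hc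
      (mul_ne_zero he hd) (fun x => ?_) fun x => ?_
    · rw [hPW]
      exact mul_ne_zero (Complex.exp_ne_zero _) hx₁
    · rw [hQf, hPf, ← mul_assoc]
      exact hf x
    · rw [hQW, hPW]
      have := hW x
      rw [betheWr, thetaProd] at this
      linear_combination e * this
  · rintro rfl
    refine ⟨s, Relation.EqvGen.refl s, P, rfl, fun x => by rw [hPf]; rfl, 1, one_ne_zero, fun x => ?_⟩
    rw [hPW, one_mul]
    rfl

end solution

end EllipticBethe

namespace EllipticBethe

open Real Complex Filter Topology

/-! ### The fundamental operator of a pair -/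

/-- The coefficient `c₂` of the operator `∂² + c₂` with kernel spanned by `f/√Wr(f,g)` and
`g/√Wr(f,g)`. -/
noncomputable def pairPotential (f g : ℂ → ℂ) (x : ℂ) : ℂ :=
  (deriv f x * deriv (deriv g) x - deriv (deriv f) x * deriv g x) / wr f g x
    + deriv (deriv (wr f g)) x / (2 * wr f g x) - 3 / 4 * (deriv (wr f g) x / wr f g x) ^ 2

section pair

variable {f g : ℂ → ℂ}

lemma hasDerivAt_wr (hf : Differentiable ℂ f) (hg : Differentiable ℂ g) (x : ℂ) :
    HasDerivAt (wr f g) (f x * deriv (deriv g) x - deriv (deriv f) x * g x) x := by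
  refine (((hf x).hasDerivAt.fun_mul (differentiable_deriv hg x).hasDerivAt).fun_sub
    ((differentiable_deriv hf x).hasDerivAt.fun_mul (hg x).hasDerivAt)).congr_deriv ?_
  ring

lemma differentiable_wr (hf : Differentiable ℂ f) (hg : Differentiable ℂ g) :
    Differentiable ℂ (wr f g) := fun x => (hasDerivAt_wr hf hg x).differentiableAt

lemma Meromorphic.of_differentiable {h : ℂ → ℂ} (hh : Differentiable ℂ h) (x : ℂ) :
    MeromorphicAt h x := (hh.analyticAt x).meromorphicAt

lemma meromorphic_pairPotential (hf : Differentiable ℂ f) (hg : Differentiable ℂ g) :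
    Meromorphic (pairPotential f g) := by
  intro x
  have h1 := Meromorphic.of_differentiable (differentiable_deriv hf) x
  have h2 := Meromorphic.of_differentiable (differentiable_deriv hg) x
  have h3 := Meromorphic.of_differentiable (differentiable_deriv (differentiable_deriv hf)) x
  have h4 := Meromorphic.of_differentiable (differentiable_deriv (differentiable_deriv hg)) x
  have hW := differentiable_wr hf hg
  have h5 := Meromorphic.of_differentiable hW x
  have h6 := Meromorphic.of_differentiable (differentiable_deriv hW) x
  have h7 := Meromorphic.of_differentiable (differentiable_deriv (differentiable_deriv hW)) x
  unfold pairPotential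
  fun_prop

/-- The operator `∂² + c₂` of a pair of entire functions. -/
noncomputable def pairOp (hf : Differentiable ℂ f) (hg : Differentiable ℂ g) : MonicOp where
  c₁ := fun _ => 0
  c₂ := pairPotential f g
  meromorphic_c₁ := fun x => MeromorphicAt.const 0 x
  meromorphic_c₂ := meromorphic_pairPotential hf hg

lemma continuousOn_pairPotential (hf : Differentiable ℂ f) (hg : Differentiable ℂ g) :
    ContinuousOn (pairPotential f g) {x | wr f g x ≠ 0} := by
  have h1 := (differentiable_deriv hf).continuous
  have h2 := (differentiable_deriv hg).continuous
  have h3 := (differentiable_deriv (differentiable_deriv hf)).continuous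
  have h4 := (differentiable_deriv (differentiable_deriv hg)).continuous
  have hW := differentiable_wr hf hg
  have h5 := hW.continuous
  have h6 := (differentiable_deriv hW).continuous
  have h7 := (differentiable_deriv (differentiable_deriv hW)).continuous
  unfold pairPotential
  have hne : ∀ x ∈ {x | wr f g x ≠ 0}, wr f g x ≠ 0 := fun x hx => hx
  have hne2 : ∀ x ∈ {x | wr f g x ≠ 0}, 2 * wr f g x ≠ 0 := fun x hx =>
    mul_ne_zero two_ne_zero hx
  exact ((((h1.mul h4).sub (h3.mul h2)).continuousOn.div h5.continuousOn hne).add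
    (h7.continuousOn.div (h5.const_mul 2).continuousOn hne2)).sub
    (((h6.continuousOn.div h5.continuousOn hne).pow 2).const_mul _)

variable {U : Set ℂ} {w : ℂ → ℂ}

lemma ne_zero_of_sq_eq {W : ℂ → ℂ} (hW : ∀ x ∈ U, W x ≠ 0) (hw : ∀ x ∈ U, w x ^ 2 = W x) {x : ℂ}
    (hx : x ∈ U) : w x ≠ 0 := fun h => hW x hx (by rw [← hw x hx, h]; simp)

/-- The derivative of `h/√W`. -/
lemma hasDerivAt_div_sqrt {h W : ℂ → ℂ} (hU : IsOpen U) (hh : Differentiable ℂ h)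
    (hW : ∀ x ∈ U, W x ≠ 0) (hwd : DifferentiableOn ℂ w U)
    (hw : ∀ x ∈ U, w x ^ 2 = W x) {x : ℂ} (hx : x ∈ U) :
    HasDerivAt w (deriv W x / (2 * w x)) x ∧
    HasDerivAt (fun x => h x / w x) (deriv h x / w x - h x * deriv W x / (2 * W x * w x)) x := by
  have hw0 := ne_zero_of_sq_eq hW hw hx
  have hwx := (hwd.differentiableAt (hU.mem_nhds hx)).hasDerivAt
  have h1 : HasDerivAt W (2 * w x * deriv w x) x := by
    have := (hwx.fun_pow 2).congr_of_eventuallyEq (f₁ := W) (by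
      filter_upwards [hU.mem_nhds hx] with y hy using (hw y hy).symm)
    simpa using this
  have h2 : HasDerivAt w (deriv W x / (2 * w x)) x := by
    refine hwx.congr_deriv ?_
    rw [h1.deriv]
    field_simp
  refine ⟨h2, ((hh x).hasDerivAt.fun_div h2 hw0).congr_deriv ?_⟩
  rw [← hw x hx]
  field_simp

lemma deriv_deriv_div_sqrt {h W : ℂ → ℂ} (hU : IsOpen U) (hh : Differentiable ℂ h)
    (hWd : Differentiable ℂ W) (hW : ∀ x ∈ U, W x ≠ 0) (hwd : DifferentiableOn ℂ w U)
    (hw : ∀ x ∈ U, w x ^ 2 = W x) {x : ℂ} (hx : x ∈ U) :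
    HasDerivAt (deriv fun x => h x / w x)
      ((deriv (deriv h) x - deriv h x * deriv W x / W x - h x * deriv (deriv W) x / (2 * W x)
        + 3 / 4 * h x * (deriv W x / W x) ^ 2) / w x) x := by
  have hw0 := ne_zero_of_sq_eq hW hw hx
  have hW0 := hW x hx
  have hev : (deriv fun x => h x / w x) =ᶠ[𝓝 x]
      fun x => deriv h x / w x - h x * deriv W x / (2 * W x * w x) := by
    filter_upwards [hU.mem_nhds hx] with y hy
    exact (hasDerivAt_div_sqrt hU hh hW hwd hw hy).2.deriv
  refine HasDerivAt.congr_of_eventuallyEq ?_ hev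
  have hwx := (hasDerivAt_div_sqrt hU hh hW hwd hw hx).1
  have hh' := (differentiable_deriv hh x).hasDerivAt
  have hW' := (differentiable_deriv hWd x).hasDerivAt
  refine ((hh'.fun_div hwx hw0).fun_sub (((hh x).hasDerivAt.fun_mul hW').fun_div
    (((hWd x).hasDerivAt.const_mul 2).fun_mul hwx) (by
      exact mul_ne_zero (mul_ne_zero two_ne_zero hW0) hw0))).congr_deriv ?_
  have e := hw x hx
  rw [← e]
  field_simp
  ring

/-- Both equations rest on h (f'g'' - f''g') = h'W' - h''W, valid for h = f and for h = g, where W =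
Wr(f,g). -/
lemma hasDerivAt_deriv_div_sqrt_wr (hf : Differentiable ℂ f) (hg : Differentiable ℂ g)
    (hU : IsOpen U) (hW : ∀ x ∈ U, wr f g x ≠ 0) (hwd : DifferentiableOn ℂ w U)
    (hw : ∀ x ∈ U, w x ^ 2 = wr f g x) {x : ℂ} (hx : x ∈ U) :
    HasDerivAt (deriv fun x => f x / w x) (-(pairPotential f g x * (f x / w x))) x ∧
    HasDerivAt (deriv fun x => g x / w x) (-(pairPotential f g x * (g x / w x))) x := by
  have hWd := differentiable_wr hf hg
  have hw0 := ne_zero_of_sq_eq hW hw hx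
  have hW0 := hW x hx
  have hW' := (hasDerivAt_wr hf hg x).deriv
  refine ⟨(deriv_deriv_div_sqrt hU hf hWd hW hwd hw hx).congr_deriv ?_,
    (deriv_deriv_div_sqrt hU hg hWd hW hwd hw hx).congr_deriv ?_⟩
  all_goals
    rw [pairPotential]
    have e : wr f g x = f x * deriv g x - deriv f x * g x := rfl
    generalize deriv (deriv (wr f g)) x = W2 at *
    generalize deriv (wr f g) x = W1 at *
    generalize wr f g x = W0 at *
    field_simp
    rw [hW', e]
    ring

lemma exists_const_of_deriv_eq_zero (hU : IsOpen U) (hUc : IsConnected U) {a : ℂ → ℂ}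
    (ha : ∀ x ∈ U, HasDerivAt a 0 x) : ∃ c, ∀ x ∈ U, a x = c :=
  hU.exists_is_const_of_deriv_eq_zero hUc.isPreconnected
    (fun x hx => (ha x hx).differentiableAt.differentiableWithinAt) (fun x hx => (ha x hx).deriv)

/-- The two basic solutions u₁, u₂ have Wronskian 1. As there is no first order term, the Wronskians
Wr(u,u₂) and Wr(u₁,u) of any solution u are constant on a connected set, and they are the
coefficients of u in terms of u₁ and u₂. -/
lemma isFundOpOfPair_pairOp (hf : Differentiable ℂ f) (hg : Differentiable ℂ g) :
    IsFundOpOfPair f g (pairOp hf hg) := by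
  intro U w hU hUc hW hwd hw u hu
  have hWd := differentiable_wr hf hg
  set u₁ : ℂ → ℂ := fun x => f x / w x with hu₁
  set u₂ : ℂ → ℂ := fun x => g x / w x with hu₂
  have d₁ := fun x hx => (hasDerivAt_div_sqrt (h := f) hU hf hW hwd hw (x := x) hx).2
  have d₂ := fun x hx => (hasDerivAt_div_sqrt (h := g) hU hg hW hwd hw (x := x) hx).2
  have dd := fun x hx => hasDerivAt_deriv_div_sqrt_wr hf hg hU hW hwd hw (x := x) hx
  have hwr : ∀ x ∈ U, u₁ x * deriv u₂ x - deriv u₁ x * u₂ x = 1 := fun x hx => by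
    rw [(d₁ x hx).deriv, (d₂ x hx).deriv]
    have hw0 := ne_zero_of_sq_eq hW hw hx
    have hW0 := hW x hx
    have e := hw x hx
    have e' : wr f g x = f x * deriv g x - deriv f x * g x := rfl
    simp only [hu₁, hu₂]
    field_simp
    rw [e, e']
    ring
  constructor
  · intro hode
    have hu' : ∀ x ∈ U, HasDerivAt u (deriv u x) x := fun x hx =>
      (hu.differentiableAt (hU.mem_nhds hx)).hasDerivAt
    have hu'' : ∀ x ∈ U, HasDerivAt (deriv u) (-(pairPotential f g x * u x)) x := fun x hx => by
      have h1 := ((hu.deriv hU).differentiableAt (hU.mem_nhds hx)).hasDerivAt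
      refine h1.congr_deriv ?_
      have := hode x hx
      simp only [pairOp] at this
      linear_combination this
    obtain ⟨a, ha⟩ := exists_const_of_deriv_eq_zero hU hUc
      (a := fun x => u x * deriv u₂ x - deriv u x * u₂ x) fun x hx => by
      refine (((hu' x hx).fun_mul (dd x hx).2).fun_sub
        ((hu'' x hx).fun_mul (d₂ x hx).differentiableAt.hasDerivAt)).congr_deriv ?_
      ring
    obtain ⟨b, hb⟩ := exists_const_of_deriv_eq_zero hU hUc
      (a := fun x => u₁ x * deriv u x - deriv u₁ x * u x) fun x hx => by
      refine (((d₁ x hx).differentiableAt.hasDerivAt.fun_mul (hu'' x hx)).fun_sub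
        ((dd x hx).1.fun_mul (hu' x hx))).congr_deriv ?_
      ring
    refine ⟨a, b, fun x hx => ?_⟩
    rw [← ha x hx, ← hb x hx]
    linear_combination (-u x) * hwr x hx
  · rintro ⟨a, b, hab⟩ x hx
    have hev : ∀ x ∈ U, u =ᶠ[𝓝 x] fun x => a * u₁ x + b * u₂ x := fun x hx => by
      filter_upwards [hU.mem_nhds hx] with y hy using hab y hy
    have h1 : ∀ x ∈ U, deriv u x = a * deriv u₁ x + b * deriv u₂ x := fun x hx => by
      rw [(hev x hx).deriv_eq]
      exact (((d₁ x hx).differentiableAt.hasDerivAt.const_mul a).fun_add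
        ((d₂ x hx).differentiableAt.hasDerivAt.const_mul b)).deriv
    have hev' : deriv u =ᶠ[𝓝 x] fun x => a * deriv u₁ x + b * deriv u₂ x := by
      filter_upwards [hU.mem_nhds hx] with y hy using h1 y hy
    rw [hev'.deriv_eq, (((dd x hx).1.const_mul a).fun_add ((dd x hx).2.const_mul b)).deriv, hab x hx]
    simp only [pairOp]
    ring

lemma IsFundOpOfPair.of_exp_mul {f' g' : ℂ → ℂ} {D : MonicOp} (h : IsFundOpOfPair f g D)
    {a c d : ℂ} (hc : c ≠ 0) (hd : d ≠ 0) (hf : ∀ x, f' x = c * (cexp (a * x) * f x))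
    (hg : ∀ x, g' x = d * (cexp (a * x) * g x))
    (hW : ∀ x, wr f' g' x = c * d * cexp (a * x) ^ 2 * wr f g x) : IsFundOpOfPair f' g' D := by
  intro U w hU hUc hU0 hwd hw u hu
  obtain ⟨r, hr⟩ := IsAlgClosed.exists_pow_nat_eq (c * d) two_pos
  have hr0 : r ≠ 0 := by
    rintro rfl
    exact mul_ne_zero hc hd (by rw [← hr]; simp)
  have hE0 : ∀ x, cexp (a * x) ≠ 0 := fun x => Complex.exp_ne_zero _
  have hWfg : ∀ x ∈ U, wr f g x ≠ 0 := fun x hx h0 => hU0 x hx (by rw [hW, h0, mul_zero])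
  have hw0 : ∀ x ∈ U, w x ≠ 0 := fun x hx => ne_zero_of_sq_eq hU0 hw hx
  -- As r² = cd, this quotient is a branch of √Wr(f,g), and the new basic functions are constant
  -- multiples of the old ones.
  rw [h U (fun x => w x / (r * cexp (a * x))) hU hUc hWfg
    (hwd.fun_div (by fun_prop) (fun x _ => mul_ne_zero hr0 (hE0 x)))
    (fun x hx => by
      have h1 := hw x hx
      have := hE0 x
      rw [hW, ← hr] at h1
      field_simp
      linear_combination h1) u hu]
  constructor
  · rintro ⟨A, B, hAB⟩
    refine ⟨A * r / c, B * r / d, fun x hx => ?_⟩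
    rw [hAB x hx, hf, hg]
    have := hE0 x
    have := hw0 x hx
    field_simp
  · rintro ⟨A, B, hAB⟩
    refine ⟨A * c / r, B * d / r, fun x hx => ?_⟩
    rw [hAB x hx, hf, hg]
    have := hE0 x
    have := hw0 x hx
    field_simp

lemma exists_sqrt_ball {W : ℂ → ℂ} (hWd : Differentiable ℂ W) {x : ℂ} (hx : W x ≠ 0) :
    ∃ r > 0, ∃ w : ℂ → ℂ, (∀ y ∈ Metric.ball x r, W y ≠ 0) ∧
      DifferentiableOn ℂ w (Metric.ball x r) ∧ ∀ y ∈ Metric.ball x r, w y ^ 2 = W y := by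
  obtain ⟨c, hc⟩ := IsAlgClosed.exists_pow_nat_eq (W x) two_pos
  have hcont : ContinuousAt (fun y => W y / W x) x := (hWd x).continuousAt.div_const _
  have hev : ∀ᶠ y in 𝓝 x, W y / W x ∈ Complex.slitPlane :=
    hcont.eventually_mem (Complex.isOpen_slitPlane.mem_nhds (by
      rw [div_self hx]; exact Complex.one_mem_slitPlane))
  obtain ⟨r, hr, hball⟩ := Metric.eventually_nhds_iff_ball.1 hev
  refine ⟨r, hr, fun y => c * cexp (Complex.log (W y / W x) / 2), fun y hy h0 => ?_, ?_,
    fun y hy => ?_⟩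
  · have := Complex.slitPlane_ne_zero (hball y hy)
    rw [h0, zero_div] at this
    exact this rfl
  · intro y hy
    have := hball y hy
    exact (((((hWd y).div_const _).clog this).div_const _).cexp.const_mul c).differentiableWithinAt
  · rw [mul_pow, hc, ← Complex.exp_nat_mul]
    have e : ((2 : ℕ) : ℂ) * (Complex.log (W y / W x) / 2) = Complex.log (W y / W x) := by
      push_cast; ring
    rw [e, Complex.exp_log (Complex.slitPlane_ne_zero (hball y hy)), mul_div_cancel₀ _ hx]

/-- Inserting f/√W and g/√W gives a linear system for the differences of the coefficients, whose
determinant is their Wronskian 1. -/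
lemma IsFundOpOfPair.unique (hf : Differentiable ℂ f) (hg : Differentiable ℂ g) {D : MonicOp}
    (hD : IsFundOpOfPair f g D) {x : ℂ} (hx : wr f g x ≠ 0) :
    D.c₁ x = 0 ∧ D.c₂ x = pairPotential f g x := by
  have hWd := differentiable_wr hf hg
  obtain ⟨r, hr, w, hW, hwd, hw⟩ := exists_sqrt_ball hWd hx
  have hU : IsOpen (Metric.ball x r) := Metric.isOpen_ball
  have hUc : IsConnected (Metric.ball x r) :=
    ⟨⟨x, Metric.mem_ball_self hr⟩, (convex_ball x r).isPreconnected⟩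
  have hxU : x ∈ Metric.ball x r := Metric.mem_ball_self hr
  have d₁ := fun y hy => (hasDerivAt_div_sqrt (h := f) hU hf hW hwd hw (x := y) hy).2
  have d₂ := fun y hy => (hasDerivAt_div_sqrt (h := g) hU hg hW hwd hw (x := y) hy).2
  obtain ⟨dd₁, dd₂⟩ := hasDerivAt_deriv_div_sqrt_wr hf hg hU hW hwd hw hxU
  have h1 := (hD _ w hU hUc hW hwd hw (fun y => f y / w y)
    (fun y hy => (d₁ y hy).differentiableAt.differentiableWithinAt)).2 ⟨1, 0, by simp⟩ x hxU
  have h2 := (hD _ w hU hUc hW hwd hw (fun y => g y / w y)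
    (fun y hy => (d₂ y hy).differentiableAt.differentiableWithinAt)).2 ⟨0, 1, by simp⟩ x hxU
  have hwr : f x / w x * deriv (fun y => g y / w y) x - deriv (fun y => f y / w y) x * (g x / w x)
      = 1 := by
    rw [(d₁ x hxU).deriv, (d₂ x hxU).deriv]
    have hw0 := ne_zero_of_sq_eq hW hw hxU
    have e := hw x hxU
    have e' : wr f g x = f x * deriv g x - deriv f x * g x := rfl
    field_simp
    rw [e, e']
    ring
  rw [dd₁.deriv] at h1
  rw [dd₂.deriv] at h2
  constructor
  · linear_combination (f x / w x) * h2 - (g x / w x) * h1 - D.c₁ x * hwr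
  · linear_combination deriv (fun y => g y / w y) x * h1 - deriv (fun y => f y / w y) x * h2
      - (D.c₂ x - pairPotential f g x) * hwr

/-- The Riccati form of the potential. -/
lemma pairPotential_eq_of_logDeriv (hf : Differentiable ℂ f) (hg : Differentiable ℂ g) {x : ℂ}
    (hfx : f x ≠ 0) (hWx : wr f g x ≠ 0) {R S R' S' : ℂ} (h1 : deriv f x = f x * R)
    (h2 : deriv (deriv f) x = f x * (R ^ 2 + R')) (h3 : deriv (wr f g) x = wr f g x * S)
    (h4 : deriv (deriv (wr f g)) x = wr f g x * (S ^ 2 + S')) :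
    pairPotential f g x = -(R' - S' / 2 + (R - S / 2) ^ 2) := by
  have hW' := (hasDerivAt_wr hf hg x).deriv
  have e : wr f g x = f x * deriv g x - deriv f x * g x := rfl
  -- The relation f (f'g'' - f''g') = f'W' - f''W eliminates g from the potential.
  have key : deriv f x * deriv (deriv g) x - deriv (deriv f) x * deriv g x =
      wr f g x * (R * S - R ^ 2 - R') := by
    apply mul_left_cancel₀ hfx
    rw [hW'] at h3
    rw [h1, h2] at *
    linear_combination R * h3 * f x + (f x * (R ^ 2 + R')) * e
  rw [pairPotential, key, h3, h4]
  field_simp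
  ring

end pair

end EllipticBethe

namespace EllipticBethe

open Real Complex Filter Topology

/-! ### The RST-operator in coordinates -/

section rst

variable {τ : ℂ} {n : ℕ}

/-- The function `½ ∑_k ± ρ(x - z_k)`, the sign being `+` if `J k = 0` and `-` if `J k = 1`. -/
noncomputable def weightRho (τ : ℂ) {n : ℕ} (z : Fin n → ℂ) (J : Fin n → Fin 2) (x : ℂ) : ℂ :=
  ∑ k, (if J k = 0 then 1 / 2 else -1 / 2) * rho τ (x - z k)

/-- `v` lies in the zero weight space. -/
def IsWeightZero {n : ℕ} (v : TensorPower n) : Prop :=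
  ∀ J, (∑ k, (if J k = 0 then 1 / 2 else -1 / 2 : ℂ)) * v J = 0

lemma fin_two_cases (i : Fin 2) : i = 0 ∨ i = 1 := by omega

lemma glMat_self_apply_of_ne (r : Fin 2) {i j : Fin 2} (h : i ≠ j) : glMat r r i j = 0 := by
  have : ¬(r = i ∧ r = j) := fun ⟨h1, h2⟩ => h (h1.symm.trans h2)
  simp [glMat, Matrix.one_apply_ne h, this]

lemma site_glMat_zero_zero (k : Fin n) (v : TensorPower n) (J : Fin n → Fin 2) :
    site k (glMat 0 0) v J = (if J k = 0 then 1 / 2 else -1 / 2) * v J := by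
  rw [site, Finset.sum_eq_single (J k)]
  · rw [Function.update_eq_self]
    rcases fin_two_cases (J k) with h | h <;> (rw [h]; simp [glMat]; norm_num)
  · intro i _ hi
    rw [glMat_self_apply_of_ne _ (Ne.symm hi), zero_mul]
  · simp

lemma site_glMat_one_one (k : Fin n) (v : TensorPower n) (J : Fin n → Fin 2) :
    site k (glMat 1 1) v J = -((if J k = 0 then 1 / 2 else -1 / 2) * v J) := by
  rw [site, Finset.sum_eq_single (J k)]
  · rw [Function.update_eq_self]
    rcases fin_two_cases (J k) with h | h <;> rw [h] <;> simp [glMat] <;> norm_num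
  · intro i _ hi
    rw [glMat_self_apply_of_ne _ (Ne.symm hi), zero_mul]
  · simp

lemma site_glMat_zero_one (k : Fin n) (v : TensorPower n) (J : Fin n → Fin 2) :
    site k (glMat 0 1) v J = if J k = 0 then v (Function.update J k 1) else 0 := by
  rw [site, Fin.sum_univ_two]
  rcases fin_two_cases (J k) with h | h <;> rw [h] <;> simp [glMat]

lemma site_glMat_one_zero (k : Fin n) (v : TensorPower n) (J : Fin n → Fin 2) :
    site k (glMat 1 0) v J = if J k = 1 then v (Function.update J k 0) else 0 := by
  rw [site, Fin.sum_univ_two]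
  rcases fin_two_cases (J k) with h | h <;> rw [h] <;> simp [glMat]

/-- On weight zero vectors the total Cartan action vanishes, and with it the term ρ(λ_{12}) e_{22}.
-/
lemma lMat_zero_zero (z : Fin n → ℂ) (x : ℂ) (lam : Fin 2 → ℂ) {v : TensorPower n}
    (hv : IsWeightZero v) (J : Fin n → Fin 2) :
    lMat τ z 0 0 x lam v J = weightRho τ z J x * v J := by
  have h1 : (Finset.univ.erase (0 : Fin 2)) = {1} := by decide
  rw [lMat, if_pos rfl, h1, Finset.sum_singleton, Pi.add_apply, Pi.smul_apply, Finset.sum_apply,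
    ePlus, Finset.sum_apply]
  simp only [if_true, Pi.smul_apply, site_glMat_zero_zero, site_glMat_one_one, smul_eq_mul]
  rw [Finset.sum_neg_distrib, ← Finset.sum_mul, hv J, weightRho, Finset.sum_mul, neg_zero, mul_zero,
    add_zero]
  exact Finset.sum_congr rfl fun k _ => by ring

lemma lMat_one_one (z : Fin n → ℂ) (x : ℂ) (lam : Fin 2 → ℂ) {v : TensorPower n}
    (hv : IsWeightZero v) (J : Fin n → Fin 2) :
    lMat τ z 1 1 x lam v J = -(weightRho τ z J x * v J) := by
  have h1 : (Finset.univ.erase (1 : Fin 2)) = {0} := by decide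
  rw [lMat, if_pos rfl, h1, Finset.sum_singleton, Pi.add_apply, Pi.smul_apply, Finset.sum_apply,
    ePlus, Finset.sum_apply]
  simp only [if_true, Pi.smul_apply, site_glMat_zero_zero, site_glMat_one_one, smul_eq_mul]
  rw [← Finset.sum_mul, hv J, weightRho, Finset.sum_mul, mul_zero, add_zero,
    ← Finset.sum_neg_distrib]
  exact Finset.sum_congr rfl fun k _ => by ring

lemma update_update_eq_comp_swap {J : Fin n → Fin 2} {k l : Fin n} (hl : J l = 0) (hk : J k = 1) :
    Function.update (Function.update J l 1) k 0 = J ∘ Equiv.swap k l := by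
  ext i
  have hkl : k ≠ l := by rintro rfl; rw [hl] at hk; exact absurd hk (by decide)
  by_cases hik : i = k
  · subst hik; simp [hl]
  · by_cases hil : i = l
    · subst hil; simp [hik, hk]
    · simp [hik, hil, Equiv.swap_apply_of_ne_of_ne hik hil]

/-- The operator `e⁺₁₂(x) e⁺₂₁(x)` in coordinates. -/
noncomputable def hopping (τ : ℂ) {n : ℕ} (z : Fin n → ℂ) (x lam : ℂ) (v : TensorPower n)
    (J : Fin n → Fin 2) : ℂ :=
  ∑ l, if J l = 0 then sigma τ (x - z l) lam * (sigma τ (x - z l) (-lam) * v J +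
    ∑ k, if J k = 1 then sigma τ (x - z k) (-lam) * v (J ∘ Equiv.swap k l) else 0) else 0

lemma hopping_smul (z : Fin n → ℂ) (x lam c : ℂ) (v : TensorPower n) (J : Fin n → Fin 2) :
    hopping τ z x lam (c • v) J = c * hopping τ z x lam v J := by
  rw [hopping, hopping, Finset.mul_sum]
  refine Finset.sum_congr rfl fun l _ => ?_
  have : ∑ k, (if J k = 1 then sigma τ (x - z k) (-lam) * (c • v) (J ∘ Equiv.swap k l) else 0) =
      c * ∑ k, if J k = 1 then sigma τ (x - z k) (-lam) * v (J ∘ Equiv.swap k l) else 0 := by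
    rw [Finset.mul_sum]
    refine Finset.sum_congr rfl fun k _ => ?_
    split_ifs
    · simp only [Pi.smul_apply, smul_eq_mul]; ring
    · ring
  rw [this]
  split_ifs
  · simp only [Pi.smul_apply, smul_eq_mul]; ring
  · ring

lemma lMat_one_zero_lMat_zero_one (z : Fin n → ℂ) (x : ℂ) (lam : Fin 2 → ℂ) (v : TensorPower n)
    (J : Fin n → Fin 2) :
    lMat τ z 1 0 x lam (lMat τ z 0 1 x lam v) J = hopping τ z x (lam 0 - lam 1) v J := by
  have h01 : (0 : Fin 2) ≠ 1 := by decide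
  rw [lMat, lMat, if_neg h01.symm, if_neg h01, ePlus, ePlus, Finset.sum_apply, hopping]
  refine Finset.sum_congr rfl fun l _ => ?_
  rw [if_neg h01, Pi.smul_apply, site_glMat_zero_one, smul_eq_mul]
  by_cases hl : J l = 0
  · rw [if_pos hl, if_pos hl, Finset.sum_apply]
    congr 1
    simp only [if_neg h01.symm, Pi.smul_apply, site_glMat_one_zero, smul_eq_mul, neg_sub]
    -- The term k = l flips the same place twice and restores J; for k ≠ l with J k = 1 the two
    -- flips amount to the transposition of k and l.
    rw [← Finset.add_sum_erase _ _ (Finset.mem_univ l), Function.update_self, if_pos rfl,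
      Function.update_idem, ← hl, Function.update_eq_self,
      ← Finset.add_sum_erase (a := l) _ (fun k => if J k = 1 then _ else _) (Finset.mem_univ l),
      if_neg (by rw [hl]; exact h01), zero_add]
    congr 1
    refine Finset.sum_congr rfl fun k hk => ?_
    rw [Function.update_of_ne (Finset.ne_of_mem_erase hk)]
    by_cases hk1 : J k = 1
    · rw [if_pos hk1, if_pos hk1, hl, update_update_eq_comp_swap hl hk1]
    · rw [if_neg hk1, if_neg hk1, mul_zero]
  · rw [if_neg hl, if_neg hl, mul_zero]

lemma rst_eq (z : Fin n → ℂ) (F : ℂ → (Fin 2 → ℂ) → TensorPower n) :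
    rst τ z F = rstEntry τ z 0 0 (rstEntry τ z 1 1 F) - rstEntry τ z 1 0 (rstEntry τ z 0 1 F) := by
  have : (Finset.univ : Finset (Equiv.Perm (Fin 2))) = {1, Equiv.swap 0 1} := by decide
  rw [rst, this, Finset.sum_pair (by decide)]
  simp [sub_eq_add_neg]

variable {Φ : ℂ → TensorPower n} {c : ℂ → ℂ}

lemma rstEntry_one_one (hτ : 0 < τ.im) (z : Fin n → ℂ)
    (hΦ : ∀ J, DifferentiableOn ℂ (fun l => Φ l J) {l | ¬ InLattice τ l})
    (hwt : ∀ l, IsWeightZero (Φ l)) (hc : Differentiable ℂ c) (x : ℂ) {lam : Fin 2 → ℂ}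
    (hlam : ¬ InLattice τ (lam 0 - lam 1)) (J : Fin n → Fin 2) :
    rstEntry τ z 1 1 (fun y lam => c y • Φ (lam 0 - lam 1)) x lam J =
      deriv c x * Φ (lam 0 - lam 1) J + c x * (deriv (fun l => Φ l J) (lam 0 - lam 1)
        - weightRho τ z J x * Φ (lam 0 - lam 1) J) := by
  have hV := isOpen_theta_ne_zero hτ
  have h01 : (0 : Fin 2) ≠ 1 := by decide
  have hwt' : IsWeightZero (c x • Φ (lam 0 - lam 1)) := fun J => by
    rw [Pi.smul_apply, smul_eq_mul, mul_left_comm, hwt, mul_zero]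
  have h1 : HasDerivAt (fun y => c y • Φ (lam 0 - lam 1)) (deriv c x • Φ (lam 0 - lam 1)) x :=
    (hc x).hasDerivAt.smul_const _
  have h2 : HasDerivAt (fun s => c x • Φ (Function.update lam 1 s 0 - Function.update lam 1 s 1))
      (c x • fun J => -deriv (fun l => Φ l J) (lam 0 - lam 1)) (lam 1) := by
    have key : HasDerivAt (fun s => Φ (Function.update lam 1 s 0 - Function.update lam 1 s 1))
        (fun J => -deriv (fun l => Φ l J) (lam 0 - lam 1)) (lam 1) := by
      refine hasDerivAt_pi.2 fun J => ?_
      simp only [Function.update_of_ne h01, Function.update_self]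
      exact (((hΦ J).differentiableAt (hV.mem_nhds hlam)).hasDerivAt).comp_const_sub (lam 0) (lam 1)
    exact key.const_smul (c x)
  rw [rstEntry, if_pos rfl, h1.deriv, h2.deriv, Pi.add_apply, lMat_one_one z x lam hwt' J]
  simp only [Pi.sub_apply, Pi.smul_apply, smul_eq_mul]
  ring

/-- On functions of λ_{12} the derivatives in λ_1 and λ_2 are ±∂_λ, so the diagonal product is (∂_x
- ∂_λ + w)(∂_x + ∂_λ - w) with w = `weightRho`. Its terms in c' cancel, which is why S₁ = 0. The
scalar function c is kept general because y - x and 1 give the two coefficients. -/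
lemma rst_apply (hτ : 0 < τ.im) (z : Fin n → ℂ)
    (hΦ : ∀ J, DifferentiableOn ℂ (fun l => Φ l J) {l | ¬ InLattice τ l})
    (hwt : ∀ l, IsWeightZero (Φ l)) (hc : Differentiable ℂ c) {x : ℂ}
    (hx : ∀ k, ¬ InLattice τ (x - z k)) {lam : Fin 2 → ℂ}
    (hlam : ¬ InLattice τ (lam 0 - lam 1)) (J : Fin n → Fin 2) :
    rst τ z (fun y lam => c y • Φ (lam 0 - lam 1)) x lam J =
      deriv (deriv c) x * Φ (lam 0 - lam 1) J
      - c x * (deriv (deriv fun l => Φ l J) (lam 0 - lam 1)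
        - 2 * weightRho τ z J x * deriv (fun l => Φ l J) (lam 0 - lam 1)
        + (weightRho τ z J x ^ 2 + deriv (weightRho τ z J) x) * Φ (lam 0 - lam 1) J
        + hopping τ z x (lam 0 - lam 1) (Φ (lam 0 - lam 1)) J) := by
  have hV := isOpen_theta_ne_zero hτ
  have h01 : (0 : Fin 2) ≠ 1 := by decide
  set lam0 := lam 0 - lam 1 with hlam0
  set F : ℂ → (Fin 2 → ℂ) → TensorPower n := fun y lam => c y • Φ (lam 0 - lam 1) with hF
  set G := rstEntry τ z 1 1 F with hG
  have hGJ := fun y {lam} (hl : ¬ InLattice τ (lam 0 - lam 1)) J =>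
    rstEntry_one_one hτ z hΦ hwt hc y (lam := lam) hl J
  have hwr : ∀ J, DifferentiableAt ℂ (weightRho τ z J) x := fun J => by
    have hth := differentiable_theta hτ
    have hth' := differentiable_deriv hth
    unfold weightRho rho
    refine DifferentiableAt.fun_sum fun k _ => DifferentiableAt.const_mul ?_ _
    refine DifferentiableAt.fun_div (by fun_prop) (by fun_prop) ?_
    rw [Ne, theta_eq_zero_iff hτ]
    exact hx k
  -- The inner entry preserves weight zero, so the outer diagonal entry also acts through w alone.
  have hwtG : IsWeightZero (G x lam) := fun J => by
    have hz : ∀ l, (∑ k, (if J k = 0 then 1 / 2 else -1 / 2 : ℂ)) * Φ l J = 0 := fun l => hwt l J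
    have hz' : (∑ k, (if J k = 0 then 1 / 2 else -1 / 2 : ℂ)) * deriv (fun l => Φ l J) lam0 = 0 := by
      rw [← deriv_const_mul _ ((hΦ J).differentiableAt (hV.mem_nhds hlam)), funext hz, deriv_const]
    rw [hG, hGJ x hlam]
    linear_combination (deriv c x - c x * weightRho τ z J x) * hz lam0 + c x * hz'
  have hd1 : ∀ J, HasDerivAt (fun y => G y lam J) (deriv (deriv c) x * Φ lam0 J +
      (deriv c x * (deriv (fun l => Φ l J) lam0 - weightRho τ z J x * Φ lam0 J)
        + c x * (-(deriv (weightRho τ z J) x * Φ lam0 J)))) x := fun J => by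
    rw [funext fun y => hGJ y hlam J]
    exact ((differentiable_deriv hc x).hasDerivAt.mul_const _).fun_add
      ((hc x).hasDerivAt.fun_mul (((hwr J).hasDerivAt.mul_const _).const_sub _))
  have hd2 : ∀ J, HasDerivAt (fun s => G x (Function.update lam 0 s) J)
      (deriv c x * deriv (fun l => Φ l J) lam0 + c x * (deriv (deriv fun l => Φ l J) lam0
        - weightRho τ z J x * deriv (fun l => Φ l J) lam0)) (lam 0) := fun J => by
    have hev : (fun s => G x (Function.update lam 0 s) J) =ᶠ[𝓝 (lam 0)] fun s =>
        deriv c x * Φ (s - lam 1) J + c x * (deriv (fun l => Φ l J) (s - lam 1)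
        - weightRho τ z J x * Φ (s - lam 1) J) := by
      have hcont : ContinuousAt (fun s => s - lam 1) (lam 0) := by fun_prop
      filter_upwards [hcont.eventually_mem (hV.mem_nhds hlam)] with s hs
      have := hGJ x (lam := Function.update lam 0 s)
        (by simpa [Function.update_of_ne h01.symm] using hs) J
      simpa [Function.update_of_ne h01.symm] using this
    refine HasDerivAt.congr_of_eventuallyEq ?_ hev
    have e1 := (((hΦ J).differentiableAt (hV.mem_nhds hlam)).hasDerivAt).comp_sub_const
      (lam 0) (lam 1)
    have e2 := ((((hΦ J).deriv hV).differentiableAt (hV.mem_nhds hlam)).hasDerivAt).comp_sub_const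
      (lam 0) (lam 1)
    exact (e1.const_mul _).fun_add ((e2.fun_sub (e1.const_mul _)).const_mul _)
  have e00 : rstEntry τ z 0 0 G x lam J = (deriv (deriv c) x * Φ lam0 J +
      (deriv c x * (deriv (fun l => Φ l J) lam0 - weightRho τ z J x * Φ lam0 J)
        + c x * (-(deriv (weightRho τ z J) x * Φ lam0 J)))) -
      (deriv c x * deriv (fun l => Φ l J) lam0 + c x * (deriv (deriv fun l => Φ l J) lam0
        - weightRho τ z J x * deriv (fun l => Φ l J) lam0)) +
      weightRho τ z J x * (deriv c x * Φ lam0 J + c x * (deriv (fun l => Φ l J) lam0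
        - weightRho τ z J x * Φ lam0 J)) := by
    rw [rstEntry, if_pos rfl, (hasDerivAt_pi.2 hd1).deriv, (hasDerivAt_pi.2 hd2).deriv,
      Pi.add_apply, lMat_zero_zero z x lam hwtG J, hG, hGJ x hlam J]
    rfl
  have e10 : rstEntry τ z 1 0 (rstEntry τ z 0 1 F) x lam J = c x * hopping τ z x lam0 (Φ lam0) J := by
    rw [rstEntry, if_neg h01.symm, zero_add]
    have : rstEntry τ z 0 1 F x lam = lMat τ z 0 1 x lam (F x lam) := by
      rw [rstEntry, if_neg h01, zero_add]
    rw [this, lMat_one_zero_lMat_zero_one, hF, hopping_smul]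
  rw [rst_eq, Pi.sub_apply, Pi.sub_apply, Pi.sub_apply, e00, e10]
  ring

lemma rstS1_apply (hτ : 0 < τ.im) (z : Fin n → ℂ)
    (hΦ : ∀ J, DifferentiableOn ℂ (fun l => Φ l J) {l | ¬ InLattice τ l})
    (hwt : ∀ l, IsWeightZero (Φ l)) {x : ℂ}
    (hx : ∀ k, ¬ InLattice τ (x - z k)) {lam : Fin 2 → ℂ}
    (hlam : ¬ InLattice τ (lam 0 - lam 1)) :
    rstS1 τ z x (fun lam => Φ (lam 0 - lam 1)) lam = 0 := by
  ext J
  have := rst_apply hτ z hΦ hwt (c := fun y => y - x) (by fun_prop) hx hlam J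
  rw [rstS1, this]
  simp

lemma rstS2_apply (hτ : 0 < τ.im) (z : Fin n → ℂ)
    (hΦ : ∀ J, DifferentiableOn ℂ (fun l => Φ l J) {l | ¬ InLattice τ l})
    (hwt : ∀ l, IsWeightZero (Φ l)) {x : ℂ}
    (hx : ∀ k, ¬ InLattice τ (x - z k)) {lam : Fin 2 → ℂ}
    (hlam : ¬ InLattice τ (lam 0 - lam 1)) (J : Fin n → Fin 2) :
    rstS2 τ z x (fun lam => Φ (lam 0 - lam 1)) lam J =
      -(deriv (deriv fun l => Φ l J) (lam 0 - lam 1)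
        - 2 * weightRho τ z J x * deriv (fun l => Φ l J) (lam 0 - lam 1)
        + (weightRho τ z J x ^ 2 + deriv (weightRho τ z J) x) * Φ (lam 0 - lam 1) J
        + hopping τ z x (lam 0 - lam 1) (Φ (lam 0 - lam 1)) J) := by
  have := rst_apply hτ z hΦ hwt (c := fun _ => 1) (by fun_prop) hx hlam J
  simp only [one_smul] at this
  rw [rstS2, this]
  simp

end rst

end EllipticBethe

namespace EllipticBethe

open Real Complex Filter Topology

/-! ### Further identities for `ρ` and `σ` -/

section identities

variable {τ : ℂ}

lemma hasDerivAt_rho (hτ : 0 < τ.im) {x : ℂ} (hx : ¬ InLattice τ x) :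
    HasDerivAt (rho τ) (deriv (rho τ) x) x := by
  have hth := differentiable_theta hτ
  exact (((differentiable_deriv hth) x).fun_div (hth x)
    (by rwa [Ne, theta_eq_zero_iff hτ])).hasDerivAt

lemma deriv_rho (hτ : 0 < τ.im) {x : ℂ} (hx : ¬ InLattice τ x) : deriv (rho τ) x =
    (deriv (deriv (theta τ)) x * theta τ x - deriv (theta τ) x ^ 2) / theta τ x ^ 2 := by
  have hth := differentiable_theta hτ
  have := ((differentiable_deriv hth x).hasDerivAt.fun_div (hth x).hasDerivAt
    (by rwa [Ne, theta_eq_zero_iff hτ])).deriv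
  rw [show rho τ = fun x => deriv (theta τ) x / theta τ x from rfl, this]
  ring

lemma deriv_rho_neg (x : ℂ) : deriv (rho τ) (-x) = deriv (rho τ) x := by
  have := deriv_comp_neg (rho τ) x
  rw [funext (rho_neg τ), deriv.fun_neg] at this
  linear_combination this

lemma deriv_deriv_theta_neg (x : ℂ) :
    deriv (deriv (theta τ)) (-x) = -deriv (deriv (theta τ)) x := by
  have := deriv_comp_neg (deriv (theta τ)) x
  rw [funext (deriv_theta_neg (τ := τ))] at this
  linear_combination this

/-- The degenerate case u + w = 0 of the addition theorem: there the identity itself is trivial, but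
its derivative in w at w = -u is this formula. -/
lemma sigma_mul_sigma_neg (hτ : 0 < τ.im) {u l : ℂ} (hu : ¬ InLattice τ u)
    (hl : ¬ InLattice τ l) :
    sigma τ u l * sigma τ u (-l) = deriv (rho τ) l - deriv (rho τ) u := by
  have hth := differentiable_theta hτ
  have hth' := differentiable_deriv hth
  have a1 : HasDerivAt (fun w => theta τ (u + w - l)) (deriv (theta τ) l) (-u) := by
    have := (hth (u + -u - l)).hasDerivAt.comp (-u)
      (((hasDerivAt_id (-u)).const_add u).sub_const l)
    simpa [Function.comp_def, deriv_theta_neg] using this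
  have a2 : HasDerivAt (fun w => deriv (theta τ) (u + w - l)) (-deriv (deriv (theta τ)) l) (-u) := by
    have := (hth' (u + -u - l)).hasDerivAt.comp (-u)
      (((hasDerivAt_id (-u)).const_add u).sub_const l)
    simpa [Function.comp_def, deriv_deriv_theta_neg] using this
  have a3 : HasDerivAt (theta τ) (deriv (theta τ) u) (-u) := by
    simpa [deriv_theta_neg] using (hth (-u)).hasDerivAt
  have a4 : HasDerivAt (deriv (theta τ)) (-deriv (deriv (theta τ)) u) (-u) := by
    simpa [deriv_deriv_theta_neg] using (hth' (-u)).hasDerivAt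
  have a5 : HasDerivAt (fun w => theta τ (u + w)) 1 (-u) := by
    have := (hth (u + -u)).hasDerivAt.comp (-u) ((hasDerivAt_id (-u)).const_add u)
    simpa [Function.comp_def, deriv_theta_zero hτ] using this
  have a6 : HasDerivAt (fun w => theta τ (w - l)) (deriv (theta τ) (-u - l)) (-u) :=
    (hth (-u - l)).hasDerivAt.comp_sub_const (-u) l
  have key := (((((a1.const_mul (deriv (theta τ) u)).fun_mul a3).mul_const (theta τ l)).fun_add
    ((a1.const_mul (theta τ u)).fun_mul ((a4.mul_const (theta τ l)).fun_sub
      (a3.mul_const (deriv (theta τ) l))))).fun_sub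
    (((a2.const_mul (theta τ u)).fun_mul a3).mul_const (theta τ l))).fun_add
    ((a5.fun_mul a6).mul_const (theta τ (u - l)))
  rw [funext fun w => theta_addition hτ u w l] at key
  have e := key.unique (hasDerivAt_const (-u) 0)
  rw [show u + -u - l = -l by ring, show u + -u = 0 by ring, show -u - l = -(u + l) by ring] at e
  simp only [theta_neg, deriv_theta_neg, theta_zero] at e
  rw [sigma, sigma, deriv_rho hτ hl, deriv_rho hτ hu, theta_neg, ← sub_eq_add_neg]
  rw [← theta_eq_zero_iff hτ] at hu hl
  field_simp
  linear_combination e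

lemma sigma_ne_zero (hτ : 0 < τ.im) {u l : ℂ} (hu : ¬ InLattice τ u) (hl : ¬ InLattice τ l)
    (hul : ¬ InLattice τ (u - l)) : sigma τ u (-l) ≠ 0 := by
  rw [← theta_eq_zero_iff hτ] at hu hl hul
  rw [sigma, theta_neg, ← sub_eq_add_neg]
  exact div_ne_zero hul (mul_ne_zero hu (neg_ne_zero.2 hl))

/-- The derivative of `σ(u,-λ)` in `λ`. -/
lemma hasDerivAt_sigma_right (hτ : 0 < τ.im) {u l : ℂ} (hl : ¬ InLattice τ l)
    (hul : ¬ InLattice τ (u - l)) :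
    HasDerivAt (fun l => sigma τ u (-l)) (sigma τ u (-l) * -(rho τ (u - l) + rho τ l)) l := by
  have hth := differentiable_theta hτ
  by_cases hu : theta τ u = 0
  · simpa [sigma, hu] using hasDerivAt_const l (0 : ℂ)
  rw [← theta_eq_zero_iff hτ] at hl hul
  have h1 := ((hth (u - l)).hasDerivAt.comp_const_sub u l).fun_div
    ((hth l).hasDerivAt.fun_neg.const_mul (theta τ u)) (mul_ne_zero hu (neg_ne_zero.2 hl))
  have : (fun l => sigma τ u (-l)) = fun l => theta τ (u - l) / (theta τ u * -theta τ l) := by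
    ext l
    rw [sigma, theta_neg, ← sub_eq_add_neg]
  rw [this]
  refine h1.congr_deriv ?_
  rw [sigma, theta_neg, ← sub_eq_add_neg, rho, rho]
  field_simp
  ring

/-- The derivative of `σ(u,-λ)` in `u`. -/
lemma hasDerivAt_sigma_left (hτ : 0 < τ.im) {u l : ℂ} (hu : ¬ InLattice τ u)
    (hl : ¬ InLattice τ l) (hul : ¬ InLattice τ (u - l)) :
    HasDerivAt (fun u => sigma τ u (-l)) (sigma τ u (-l) * (rho τ (u - l) - rho τ u)) u := by
  have hth := differentiable_theta hτ
  rw [← theta_eq_zero_iff hτ] at hu hl hul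
  have h1 := ((hth (u - l)).hasDerivAt.comp_sub_const u l).fun_div
    ((hth u).hasDerivAt.mul_const (-theta τ l)) (mul_ne_zero hu (neg_ne_zero.2 hl))
  have : (fun u => sigma τ u (-l)) = fun u => theta τ (u - l) / (theta τ u * -theta τ l) := by
    ext l
    rw [sigma, theta_neg, ← sub_eq_add_neg]
  rw [this]
  refine h1.congr_deriv ?_
  rw [sigma, theta_neg, ← sub_eq_add_neg, rho, rho]
  field_simp
  ring

/-- Differentiate `sigma_mul_sigma` in w, eliminate σ(u,-λ) σ(w,-λ) by the same identity, and cancel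
σ(u+w,-λ). -/
lemma deriv_rho_sub_deriv_rho (hτ : 0 < τ.im) {u w l : ℂ} (hu : ¬ InLattice τ u)
    (hw : ¬ InLattice τ w) (hl : ¬ InLattice τ l) (huw : ¬ InLattice τ (u + w))
    (huwl : ¬ InLattice τ (u + w - l)) (hwl : ¬ InLattice τ (w - l)) :
    deriv (rho τ) w - deriv (rho τ) (u + w - l) =
      (rho τ u + rho τ w - rho τ l - rho τ (u + w - l)) *
        (rho τ (w - l) - rho τ w - rho τ (u + w - l) + rho τ (u + w)) := by
  have hs0 := sigma_ne_zero hτ huw hl huwl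
  have hV := isOpen_theta_ne_zero hτ
  have hev : (fun w => sigma τ u (-l) * sigma τ w (-l)) =ᶠ[𝓝 w] fun w =>
      sigma τ (u + w) (-l) * (rho τ u + rho τ w - rho τ l - rho τ (u + w - l)) := by
    have c1 : ContinuousAt (fun w => u + w) w := by fun_prop
    have c2 : ContinuousAt (fun w => u + w - l) w := by fun_prop
    filter_upwards [hV.mem_nhds hw, c1.eventually_mem (hV.mem_nhds huw),
      c2.eventually_mem (hV.mem_nhds huwl)] with y h1 h2 h3
    exact sigma_mul_sigma hτ hu h1 hl h2 h3
  have d1 := (hasDerivAt_sigma_left hτ hw hl hwl).const_mul (sigma τ u (-l))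
  have d2 := (hasDerivAt_sigma_left hτ huw hl huwl).comp_const_add u w
  have d3 : HasDerivAt (fun w => rho τ (u + w - l)) (deriv (rho τ) (u + w - l)) w := by
    have := (hasDerivAt_rho hτ huwl).comp w (((hasDerivAt_id w).const_add u).sub_const l)
    simpa [Function.comp_def] using this
  have d4 := d2.fun_mul ((((hasDerivAt_rho hτ hw).const_add (rho τ u)).sub_const (rho τ l)).fun_sub
    d3)
  have e := d1.unique (d4.congr_of_eventuallyEq hev)
  have f := sigma_mul_sigma hτ hu hw hl huw huwl
  apply mul_left_cancel₀ hs0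
  linear_combination -e + (rho τ (w - l) - rho τ w) * f

/-- `σ(y,λ) σ(w+y,-λ) = σ(w,-λ) (ρ(y) - ρ(w+y) + ρ(λ) + ρ(w-λ))`. -/
lemma sigma_mul_sigma_add (hτ : 0 < τ.im) {y w l : ℂ} (hy : ¬ InLattice τ y)
    (hw : ¬ InLattice τ w) (hl : ¬ InLattice τ l) (hyw : ¬ InLattice τ (w + y))
    (hwl : ¬ InLattice τ (w - l)) :
    sigma τ y l * sigma τ (w + y) (-l) =
      sigma τ w (-l) * (rho τ y - rho τ (w + y) + rho τ l + rho τ (w - l)) := by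
  have e : -y + (w + y) = w := by ring
  have := sigma_mul_sigma hτ (u := -y) (w := w + y) (l := l) (by rwa [inLattice_neg_iff]) hyw hl
    (by rwa [e]) (by rwa [e])
  rw [e, sigma_neg_neg, rho_neg] at this
  linear_combination -this

/-- The left side and the three products on the right are all σ(w₁,-λ) σ(w₂+y,-λ) times a sum of
values of ρ, by the two-factor identities; those sums match. -/
lemma sigma_triple (hτ : 0 < τ.im) {y w₁ w₂ l : ℂ} (hl : ¬ InLattice τ l)
    (hy : ¬ InLattice τ y) (hw₁ : ¬ InLattice τ w₁) (hw₂ : ¬ InLattice τ w₂)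
    (hyw₁ : ¬ InLattice τ (w₁ + y)) (hyw₂ : ¬ InLattice τ (w₂ + y))
    (hww : ¬ InLattice τ (w₁ - w₂)) (hwl₁ : ¬ InLattice τ (w₁ - l))
    (hywl₂ : ¬ InLattice τ (w₂ + y - l)) :
    sigma τ w₁ (-l) * sigma τ w₂ (-l) * sigma τ y (-l) =
      sigma τ y l * sigma τ (w₁ + y) (-l) * sigma τ (w₂ + y) (-l)
      + sigma τ (w₂ + y) (-l) * sigma τ w₂ (-l) * sigma τ (w₁ - w₂) (-l)
      + sigma τ (w₁ + y) (-l) * sigma τ w₁ (-l) * sigma τ (w₂ - w₁) (-l) := by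
  have e1 := sigma_mul_sigma_add hτ hy hw₁ hl hyw₁ hwl₁
  have e2 := sigma_mul_sigma hτ (u := w₂) (w := w₁ - w₂) hw₂ hww hl (by rwa [add_sub_cancel])
    (by rwa [add_sub_cancel])
  have e : w₂ - w₁ + (w₁ + y) = w₂ + y := by ring
  have e3 := sigma_mul_sigma hτ (u := w₂ - w₁) (w := w₁ + y) (by rwa [inLattice_sub_comm]) hyw₁ hl
    (by rwa [e]) (by rwa [e])
  have e4 := sigma_mul_sigma hτ (u := w₂) (w := y) hw₂ hy hl hyw₂ hywl₂
  rw [add_sub_cancel] at e2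
  rw [e, ← neg_sub w₁ w₂, rho_neg] at e3
  rw [← neg_sub w₁ w₂]
  linear_combination sigma τ w₁ (-l) * e4 - sigma τ (w₂ + y) (-l) * e1
    - sigma τ (w₂ + y) (-l) * e2 - sigma τ w₁ (-l) * e3

end identities

end EllipticBethe

namespace EllipticBethe

open Real Complex Filter Topology

/-! ### The Bethe vector -/

section bethe

variable {τ : ℂ} {m : ℕ}

/-- The summand of the Bethe function that corresponds to the assignment `j ↦ e j`. -/
noncomputable def betheTerm (τ : ℂ) {m : ℕ} (s : BetheData m) (e : Fin m → Fin (2 * m)) (l : ℂ) :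
    ℂ :=
  cexp (π * I * s.mu * l) * ∏ j, sigma τ (s.t j - s.z (e j)) (-l)

/-- The Bethe function as a function of `λ = λ₁ - λ₂`. -/
noncomputable def betheVec (τ : ℂ) {m : ℕ} (s : BetheData m) (l : ℂ) : TensorPower (2 * m) :=
  fun J => ∑ e : Fin m ≃ {i : Fin (2 * m) // J i = 1}, betheTerm τ s (fun j => e j) l

lemma betheFun_eq (s : BetheData m) :
    betheFun τ s = fun lam => betheVec τ s (lam 0 - lam 1) := by
  ext lam J
  simp only [betheFun, betheVec, betheTerm, Finset.mul_sum]

lemma sum_eq_sum_add_sum_equiv {J : Fin (2 * m) → Fin 2} (e : Fin m ≃ {i // J i = 1})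
    (g : Fin (2 * m) → ℂ) :
    ∑ k, g k = ∑ k, (if J k = 0 then g k else 0) + ∑ j, g (e j) := by
  have h1 : ∑ j, g (e j) = ∑ k, if J k = 1 then g k else 0 := by
    rw [Equiv.sum_comp e fun k : {i // J i = 1} => g k, ← Finset.sum_filter]
    exact (Finset.sum_subtype _ (by simp) g).symm
  rw [h1, ← Finset.sum_add_distrib]
  refine Finset.sum_congr rfl fun k _ => ?_
  rcases fin_two_cases (J k) with h | h <;> simp [h]

lemma sum_if_one_eq {J : Fin (2 * m) → Fin 2} (e : Fin m ≃ {i // J i = 1})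
    (g : Fin (2 * m) → ℂ) : (∑ k, if J k = 1 then g k else 0) = ∑ j, g (e j) := by
  rw [Equiv.sum_comp e fun k : {i // J i = 1} => g k, ← Finset.sum_filter]
  exact Finset.sum_subtype _ (by simp) g

lemma sum_if_zero_one {J : Fin (2 * m) → Fin 2} (e : Fin m ≃ {i // J i = 1}) :
    (∑ k, if J k = 0 then (1 : ℂ) else 0) = m := by
  have := sum_eq_sum_add_sum_equiv e fun _ => 1
  simp only [Finset.sum_const, Finset.card_univ, Fintype.card_fin, nsmul_eq_mul, mul_one] at this
  push_cast at this
  linear_combination -this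

lemma isWeightZero_betheVec (s : BetheData m) (l : ℂ) : IsWeightZero (betheVec τ s l) := by
  intro J
  rw [betheVec, Finset.mul_sum]
  refine Finset.sum_eq_zero fun e _ => ?_
  have h0 := sum_if_zero_one e
  have h1 := sum_if_one_eq e fun _ => 1
  simp only [Finset.sum_const, Finset.card_univ, Fintype.card_fin, nsmul_eq_mul, mul_one] at h1
  have : ∑ k, (if J k = 0 then 1 / 2 else -1 / 2 : ℂ) =
      1 / 2 * (∑ k, if J k = 0 then (1 : ℂ) else 0) - 1 / 2 * ∑ k, if J k = 1 then (1 : ℂ) else 0 := by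
    rw [Finset.mul_sum, Finset.mul_sum, ← Finset.sum_sub_distrib]
    refine Finset.sum_congr rfl fun k _ => ?_
    rcases fin_two_cases (J k) with h | h <;> (simp [h]; try norm_num)
  rw [this, h0, h1, sub_self, zero_mul]

/-- The transposition carries the bijections onto the places of v_2 in J to those of the permuted
index, so that all components can be summed over the same set. -/
lemma betheVec_comp_swap (s : BetheData m) (l : ℂ) (J : Fin (2 * m) → Fin 2) (k i : Fin (2 * m)) :
    betheVec τ s l (J ∘ Equiv.swap k i) =
      ∑ e : Fin m ≃ {i // J i = 1}, betheTerm τ s (fun j => Equiv.swap k i (e j)) l := by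
  have h : ∀ a, J a = 1 ↔ (J ∘ Equiv.swap k i) (Equiv.swap k i a) = 1 := fun a => by simp
  refine (Fintype.sum_equiv (Equiv.equivCongr (Equiv.refl _)
    ((Equiv.swap k i).subtypeEquiv h)) _ _ fun e => ?_).symm
  rfl

lemma differentiableOn_betheTerm (hτ : 0 < τ.im) (s : BetheData m) (e : Fin m → Fin (2 * m)) :
    DifferentiableOn ℂ (betheTerm τ s e) {l | ¬ InLattice τ l} := by
  intro l hl
  have hth := differentiable_theta hτ
  refine DifferentiableAt.differentiableWithinAt ?_
  unfold betheTerm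
  refine DifferentiableAt.fun_mul (by fun_prop) (DifferentiableAt.fun_finsetProd fun j _ => ?_)
  -- No equation is assumed for s here; a vanishing θ(t_j - z) makes σ the zero function, division
  -- by zero being 0.
  by_cases h0 : theta τ (s.t j - s.z (e j)) = 0
  · simp [sigma, h0]
  · refine DifferentiableAt.fun_div (by fun_prop) (by fun_prop) (mul_ne_zero h0 ?_)
    rw [Ne, theta_eq_zero_iff hτ, inLattice_neg_iff]
    exact hl

lemma differentiableOn_betheVec (hτ : 0 < τ.im) (s : BetheData m) (J : Fin (2 * m) → Fin 2) :
    DifferentiableOn ℂ (fun l => betheVec τ s l J) {l | ¬ InLattice τ l} :=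
  DifferentiableOn.fun_sum fun _ _ => differentiableOn_betheTerm hτ s _

/-- The logarithmic derivative of a summand of the Bethe function. -/
noncomputable def betheLogDeriv (τ : ℂ) {m : ℕ} (s : BetheData m) (e : Fin m → Fin (2 * m))
    (l : ℂ) : ℂ :=
  π * I * s.mu - ∑ j, (rho τ (s.t j - s.z (e j) - l) + rho τ l)

lemma hasDerivAt_betheTerm (hτ : 0 < τ.im) (s : BetheData m) (e : Fin m → Fin (2 * m)) {l : ℂ}
    (hl : ¬ InLattice τ l) (hle : ∀ j, ¬ InLattice τ (s.t j - s.z (e j) - l)) :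
    HasDerivAt (betheTerm τ s e) (betheTerm τ s e l * betheLogDeriv τ s e l) l := by
  have h1 : HasDerivAt (fun l => cexp (π * I * s.mu * l))
      (cexp (π * I * s.mu * l) * (π * I * s.mu)) l := by
    simpa using ((hasDerivAt_id l).const_mul (π * I * s.mu)).cexp
  have h2 := HasDerivAt.fun_finsetProd (u := Finset.univ) (x := l)
    (f := fun j l => sigma τ (s.t j - s.z (e j)) (-l)) fun j _ =>
      hasDerivAt_sigma_right hτ hl (hle j)
  refine (h1.fun_mul h2).congr_deriv ?_
  rw [betheTerm, betheLogDeriv]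
  have : ∑ j, (∏ k ∈ Finset.univ.erase j, sigma τ (s.t k - s.z (e k)) (-l)) •
      (sigma τ (s.t j - s.z (e j)) (-l) * -(rho τ (s.t j - s.z (e j) - l) + rho τ l)) =
      -((∏ j, sigma τ (s.t j - s.z (e j)) (-l)) *
        ∑ j, (rho τ (s.t j - s.z (e j) - l) + rho τ l)) := by
    rw [Finset.mul_sum, ← Finset.sum_neg_distrib]
    refine Finset.sum_congr rfl fun j _ => ?_
    rw [← Finset.mul_prod_erase _ _ (Finset.mem_univ j), smul_eq_mul]
    ring
  rw [this]
  ring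

lemma hasDerivAt_deriv_betheTerm (hτ : 0 < τ.im) (s : BetheData m) (e : Fin m → Fin (2 * m)) {l : ℂ}
    (hl : ¬ InLattice τ l) (hle : ∀ j, ¬ InLattice τ (s.t j - s.z (e j) - l)) :
    HasDerivAt (deriv (betheTerm τ s e)) (betheTerm τ s e l * (betheLogDeriv τ s e l ^ 2 +
      ∑ j, (deriv (rho τ) (s.t j - s.z (e j) - l) - deriv (rho τ) l))) l := by
  have hV := isOpen_theta_ne_zero hτ
  have hev : deriv (betheTerm τ s e) =ᶠ[𝓝 l] fun l => betheTerm τ s e l * betheLogDeriv τ s e l := by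
    have : ∀ᶠ l' in 𝓝 l, ∀ j, ¬ InLattice τ (s.t j - s.z (e j) - l') :=
      eventually_all.2 fun j => by
        have c : ContinuousAt (fun l' => s.t j - s.z (e j) - l') l := by fun_prop
        exact c.eventually_mem (hV.mem_nhds (hle j))
    filter_upwards [hV.mem_nhds hl, this] with l' h1 h2
    exact (hasDerivAt_betheTerm hτ s e h1 h2).deriv
  refine HasDerivAt.congr_of_eventuallyEq ?_ hev
  have h2 : HasDerivAt (betheLogDeriv τ s e)
      (-∑ j, (-deriv (rho τ) (s.t j - s.z (e j) - l) + deriv (rho τ) l)) l := by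
    refine (HasDerivAt.fun_sum fun j _ => ?_).const_sub _
    exact ((hasDerivAt_rho hτ (hle j)).comp_const_sub _ l).fun_add (hasDerivAt_rho hτ hl)
  refine ((hasDerivAt_betheTerm hτ s e hl hle).fun_mul h2).congr_deriv ?_
  rw [← Finset.sum_neg_distrib,
    Finset.sum_congr rfl fun j _ => show -(-deriv (rho τ) (s.t j - s.z (e j) - l) + deriv (rho τ) l) =
      deriv (rho τ) (s.t j - s.z (e j) - l) - deriv (rho τ) l by ring]
  ring

/-! ### The eigenvalue equation -/

/-- `x` and `λ` avoid all zeros and poles that occur in the computation. -/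
structure IsGenericPoint (τ : ℂ) {m : ℕ} (s : BetheData m) (x l : ℂ) : Prop where
  l_ne : ¬ InLattice τ l
  xz : ∀ a, ¬ InLattice τ (x - s.z a)
  tx : ∀ j, ¬ InLattice τ (s.t j - x)
  tzl : ∀ j a, ¬ InLattice τ (s.t j - s.z a - l)
  txl : ∀ j, ¬ InLattice τ (s.t j - x - l)

/-- The quantity `ρ(x - z_a) + ρ(t_j - x) - ρ(λ) - ρ(t_j - z_a - λ)`. -/
noncomputable def betheDelta (τ : ℂ) {m : ℕ} (s : BetheData m) (x l : ℂ) (j : Fin m)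
    (a : Fin (2 * m)) : ℂ :=
  rho τ (x - s.z a) + rho τ (s.t j - x) - rho τ l - rho τ (s.t j - s.z a - l)

variable {s : BetheData m} {x l : ℂ}

lemma IsGenericPoint.delta (hτ : 0 < τ.im) (hs : IsBetheSolution τ s)
    (h : IsGenericPoint τ s x l) (j : Fin m) (a : Fin (2 * m)) :
    sigma τ (x - s.z a) (-l) * sigma τ (s.t j - x) (-l) =
      sigma τ (s.t j - s.z a) (-l) * betheDelta τ s x l j a := by
  have e : x - s.z a + (s.t j - x) = s.t j - s.z a := by ring
  have := sigma_mul_sigma hτ (h.xz a) (h.tx j) h.l_ne (by rw [e]; exact hs.t_ne_z j a)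
    (by rw [e]; exact h.tzl j a)
  rwa [e] at this

lemma IsGenericPoint.sigma_tz_ne (hτ : 0 < τ.im) (hs : IsBetheSolution τ s)
    (h : IsGenericPoint τ s x l) (j : Fin m) (a : Fin (2 * m)) :
    sigma τ (s.t j - s.z a) (-l) ≠ 0 :=
  sigma_ne_zero hτ (hs.t_ne_z j a) h.l_ne (h.tzl j a)

lemma IsGenericPoint.sigma_tx_ne (hτ : 0 < τ.im) (h : IsGenericPoint τ s x l) (j : Fin m) :
    sigma τ (s.t j - x) (-l) ≠ 0 :=
  sigma_ne_zero hτ (h.tx j) h.l_ne (h.txl j)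

/-- Since J i = 0, the place i is not a value of e, and the transposition alters only the factor of
the root j. -/
lemma betheTerm_swap {J : Fin (2 * m) → Fin 2} (e : Fin m ≃ {i // J i = 1}) {i : Fin (2 * m)}
    (hi : J i = 0) (j : Fin m) (h0 : sigma τ (s.t j - s.z (e j)) (-l) ≠ 0) :
    betheTerm τ s (fun k => Equiv.swap (e j : Fin (2 * m)) i (e k)) l =
      betheTerm τ s (fun k => e k) l * sigma τ (s.t j - s.z i) (-l) /
        sigma τ (s.t j - s.z (e j)) (-l) := by
  rw [betheTerm, betheTerm, ← Finset.mul_prod_erase _ _ (Finset.mem_univ j),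
    ← Finset.mul_prod_erase _ (fun k => sigma τ (s.t k - s.z (e k)) (-l)) (Finset.mem_univ j),
    Equiv.swap_apply_left]
  have : ∏ k ∈ Finset.univ.erase j, sigma τ (s.t k - s.z (Equiv.swap (e j : Fin (2 * m)) i (e k))) (-l)
      = ∏ k ∈ Finset.univ.erase j, sigma τ (s.t k - s.z (e k)) (-l) := by
    refine Finset.prod_congr rfl fun k hk => ?_
    rw [Equiv.swap_apply_of_ne_of_ne]
    · exact fun h => Finset.ne_of_mem_erase hk (e.injective (Subtype.ext h))
    · intro h
      have := (e k).2
      rw [h, hi] at this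
      exact absurd this (by decide)
  rw [this]
  field_simp

/-- The hopping term applied to the Bethe function. -/
lemma hopping_betheVec (hτ : 0 < τ.im) (hs : IsBetheSolution τ s) (h : IsGenericPoint τ s x l)
    (J : Fin (2 * m) → Fin 2) :
    hopping τ s.z x l (betheVec τ s l) J =
      ∑ e : Fin m ≃ {i // J i = 1}, betheTerm τ s (fun j => e j) l *
        ∑ i, if J i = 0 then (deriv (rho τ) l - deriv (rho τ) (x - s.z i) +
          ∑ j, betheDelta τ s x l j (e j) * (rho τ (x - s.z i) - rho τ (s.t j - s.z i) + rho τ l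
            + rho τ (s.t j - x - l))) else 0 := by
  simp_rw [Finset.mul_sum]
  rw [Finset.sum_comm, hopping]
  refine Finset.sum_congr rfl fun i _ => ?_
  by_cases hi : J i = 0
  swap
  · simp [hi]
  simp only [hi, if_true]
  have h1 : ∑ k, (if J k = 1 then sigma τ (x - s.z k) (-l) *
      betheVec τ s l (J ∘ Equiv.swap k i) else 0) =
      ∑ e : Fin m ≃ {i // J i = 1}, ∑ j, sigma τ (x - s.z (e j)) (-l) *
        betheTerm τ s (fun k => Equiv.swap (e j : Fin (2 * m)) i (e k)) l := by
    simp_rw [betheVec_comp_swap, Finset.mul_sum]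
    rw [Finset.sum_congr rfl fun e _ => (sum_if_one_eq e fun k => sigma τ (x - s.z k) (-l) *
      betheTerm τ s (fun j => Equiv.swap k i (e j)) l).symm, Finset.sum_comm]
    refine Finset.sum_congr rfl fun k _ => ?_
    by_cases hk : J k = 1 <;> simp [hk]
  rw [h1, betheVec, Finset.mul_sum, ← Finset.sum_add_distrib, Finset.mul_sum]
  refine Finset.sum_congr rfl fun e _ => ?_
  have hsq := sigma_mul_sigma_neg hτ (h.xz i) h.l_ne
  -- By `IsGenericPoint.delta`, σ(x - z_{e j}) / σ(t_j - z_{e j}) is δ / σ(t_j - x); the identity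
  -- for σ(x - z_i, λ) σ(t_j - z_i, -λ) supplies a factor σ(t_j - x) that cancels the denominator.
  have h2 : ∀ j, sigma τ (x - s.z i) l * (sigma τ (x - s.z (e j)) (-l) *
      betheTerm τ s (fun k => Equiv.swap (e j : Fin (2 * m)) i (e k)) l) =
      betheTerm τ s (fun j => e j) l * (betheDelta τ s x l j (e j) *
        (rho τ (x - s.z i) - rho τ (s.t j - s.z i) + rho τ l + rho τ (s.t j - x - l))) := by
    intro j
    have hS := h.sigma_tz_ne hτ hs j (e j)
    have hw := h.sigma_tx_ne hτ j
    rw [betheTerm_swap e hi j hS]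
    have f1 := h.delta hτ hs j (e j)
    have ee : s.t j - x + (x - s.z i) = s.t j - s.z i := by ring
    have f2 := sigma_mul_sigma_add hτ (h.xz i) (h.tx j) h.l_ne
      (by rw [ee]; exact hs.t_ne_z j i) (h.txl j)
    rw [ee] at f2
    field_simp
    apply mul_left_cancel₀ hw
    linear_combination (sigma τ (x - s.z i) l * sigma τ (s.t j - s.z i) (-l) *
      betheTerm τ s (fun j => e j) l) * f1 + (sigma τ (s.t j - s.z (e j)) (-l) *
        betheDelta τ s x l j (e j) * betheTerm τ s (fun j => e j) l) * f2
  rw [mul_add, Finset.mul_sum, Finset.sum_congr rfl fun j _ => h2 j, ← Finset.mul_sum]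
  linear_combination betheTerm τ s (fun j => e j) l * hsq

/-- The diagonal part of the unwanted terms vanishes. -/
lemma IsGenericPoint.diagonal (hτ : 0 < τ.im) (hs : IsBetheSolution τ s)
    (h : IsGenericPoint τ s x l) (j : Fin m) (a : Fin (2 * m)) :
    betheDelta τ s x l j a * (betheDelta τ s x l j a - 2 * rho τ (s.t j - x)
      + rho τ (s.t j - s.z a) - rho τ (x - s.z a) + rho τ l + rho τ (s.t j - x - l))
      + deriv (rho τ) (s.t j - s.z a - l) - deriv (rho τ) (s.t j - x) = 0 := by
  have e : x - s.z a + (s.t j - x) = s.t j - s.z a := by ring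
  have := deriv_rho_sub_deriv_rho hτ (h.xz a) (h.tx j) h.l_ne (by rw [e]; exact hs.t_ne_z j a)
    (by rw [e]; exact h.tzl j a) (h.txl j)
  rw [e] at this
  rw [betheDelta]
  linear_combination -this

/-- The off-diagonal unwanted term, for the assignment `e` and the pair `(j,k)`. -/
noncomputable def unwanted (τ : ℂ) {m : ℕ} (s : BetheData m) (x l : ℂ) (e : Fin m → Fin (2 * m))
    (j k : Fin m) : ℂ :=
  betheTerm τ s e l * (betheDelta τ s x l j (e j) * (betheDelta τ s x l k (e k)
    - 2 * rho τ (s.t k - x) - 2 * rho τ (s.t j - s.t k) + rho τ (s.t j - s.z (e k))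
    - rho τ (x - s.z (e k)) + rho τ l + rho τ (s.t j - x - l)))

lemma betheTerm_eq_mul (e : Fin m → Fin (2 * m)) {j k : Fin m} (hjk : j ≠ k) :
    betheTerm τ s e l = (cexp (π * I * s.mu * l) *
      ∏ i ∈ (Finset.univ.erase j).erase k, sigma τ (s.t i - s.z (e i)) (-l)) *
      sigma τ (s.t j - s.z (e j)) (-l) * sigma τ (s.t k - s.z (e k)) (-l) := by
  rw [betheTerm, ← Finset.mul_prod_erase _ _ (Finset.mem_univ j),
    ← Finset.mul_prod_erase (Finset.univ.erase j) _
      (Finset.mem_erase.2 ⟨hjk.symm, Finset.mem_univ k⟩)]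
  ring

/-- An expression for the off-diagonal unwanted terms without denominators. -/
lemma IsGenericPoint.unwanted_eq (hτ : 0 < τ.im) (hs : IsBetheSolution τ s)
    (h : IsGenericPoint τ s x l) (e : Fin m → Fin (2 * m)) {j k : Fin m} (hjk : j ≠ k) :
    unwanted τ s x l e j k = (cexp (π * I * s.mu * l) *
      ∏ i ∈ (Finset.univ.erase j).erase k, sigma τ (s.t i - s.z (e i)) (-l)) *
      (sigma τ (x - s.z (e j)) (-l) * sigma τ (s.t j - x) (-l) * sigma τ (x - s.z (e k)) (-l) *
          sigma τ (s.t k - x) (-l)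
        - 2 * sigma τ (x - s.z (e j)) (-l) * sigma τ (s.t k - s.z (e k)) (-l) *
          sigma τ (s.t k - x) (-l) * sigma τ (s.t j - s.t k) (-l)
        - sigma τ (x - s.z (e j)) (-l) * sigma τ (x - s.z (e k)) l *
          sigma τ (s.t k - s.z (e k)) (-l) * sigma τ (s.t j - s.z (e k)) (-l)) := by
  have d1 := h.delta hτ hs j (e j)
  have d2 := h.delta hτ hs k (e k)
  have e1 : s.t k - x + (s.t j - s.t k) = s.t j - x := by ring
  have f1 := sigma_mul_sigma hτ (h.tx k) (hs.t_distinct j k hjk) h.l_ne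
    (by rw [e1]; exact h.tx j) (by rw [e1]; exact h.txl j)
  rw [e1] at f1
  have e2 : s.t j - x + (x - s.z (e k)) = s.t j - s.z (e k) := by ring
  have f2 := sigma_mul_sigma_add hτ (h.xz (e k)) (h.tx j) h.l_ne
    (by rw [e2]; exact hs.t_ne_z j (e k)) (h.txl j)
  rw [e2] at f2
  rw [unwanted, betheTerm_eq_mul e hjk]
  generalize cexp (π * I * s.mu * l) * ∏ i ∈ (Finset.univ.erase j).erase k,
    sigma τ (s.t i - s.z (e i)) (-l) = P
  generalize betheDelta τ s x l j (e j) = δj at *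
  generalize betheDelta τ s x l k (e k) = δk at *
  have g : sigma τ (s.t j - s.z (e j)) (-l) * δj * (- 2 * rho τ (s.t k - x)
      - 2 * rho τ (s.t j - s.t k) + rho τ (s.t j - s.z (e k))
      - rho τ (x - s.z (e k)) + rho τ l + rho τ (s.t j - x - l)) =
      - 2 * sigma τ (x - s.z (e j)) (-l) * sigma τ (s.t k - x) (-l) * sigma τ (s.t j - s.t k) (-l)
      - sigma τ (x - s.z (e j)) (-l) * sigma τ (x - s.z (e k)) l *
        sigma τ (s.t j - s.z (e k)) (-l) := by
    rw [← d1]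
    linear_combination 2 * sigma τ (x - s.z (e j)) (-l) * f1 + sigma τ (x - s.z (e j)) (-l) * f2
  linear_combination P * sigma τ (s.t k - s.z (e k)) (-l) * g
    - P * sigma τ (x - s.z (e k)) (-l) * sigma τ (s.t k - x) (-l) * d1
    - P * sigma τ (s.t j - s.z (e j)) (-l) * δj * d2

/-- The off-diagonal unwanted terms cancel after symmetrization. -/
lemma IsGenericPoint.unwanted_symm (hτ : 0 < τ.im) (hs : IsBetheSolution τ s)
    (h : IsGenericPoint τ s x l) (e : Fin m → Fin (2 * m)) {j k : Fin m} (hjk : j ≠ k) :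
    unwanted τ s x l e j k + unwanted τ s x l e k j
      + unwanted τ s x l (e ∘ Equiv.swap j k) j k + unwanted τ s x l (e ∘ Equiv.swap j k) k j = 0 := by
  have hP : ∏ i ∈ (Finset.univ.erase j).erase k,
      sigma τ (s.t i - s.z ((e ∘ Equiv.swap j k) i)) (-l) =
      ∏ i ∈ (Finset.univ.erase j).erase k, sigma τ (s.t i - s.z (e i)) (-l) := by
    refine Finset.prod_congr rfl fun i hi => ?_
    rw [Finset.mem_erase, Finset.mem_erase] at hi
    rw [Function.comp, Equiv.swap_apply_of_ne_of_ne hi.2.1 hi.1]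
  have triple : ∀ a, sigma τ (s.t j - x) (-l) * sigma τ (s.t k - x) (-l) *
      sigma τ (x - s.z a) (-l) =
      sigma τ (x - s.z a) l * sigma τ (s.t j - s.z a) (-l) * sigma τ (s.t k - s.z a) (-l)
      + sigma τ (s.t k - s.z a) (-l) * sigma τ (s.t k - x) (-l) * sigma τ (s.t j - s.t k) (-l)
      + sigma τ (s.t j - s.z a) (-l) * sigma τ (s.t j - x) (-l) * sigma τ (s.t k - s.t j) (-l) := by
    intro a
    have e1 : s.t j - x + (x - s.z a) = s.t j - s.z a := by ring
    have e2 : s.t k - x + (x - s.z a) = s.t k - s.z a := by ring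
    have e3 : s.t j - x - (s.t k - x) = s.t j - s.t k := by ring
    have e4 : s.t k - x - (s.t j - x) = s.t k - s.t j := by ring
    have := sigma_triple hτ (y := x - s.z a) (w₁ := s.t j - x) (w₂ := s.t k - x) h.l_ne (h.xz a)
      (h.tx j) (h.tx k) (by rw [e1]; exact hs.t_ne_z j a) (by rw [e2]; exact hs.t_ne_z k a)
      (by rw [e3]; exact hs.t_distinct j k hjk) (h.txl j) (by rw [e2]; exact h.tzl k a)
    rwa [e1, e2, e3, e4] at this
  rw [h.unwanted_eq hτ hs e hjk, h.unwanted_eq hτ hs e hjk.symm,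
    h.unwanted_eq hτ hs (e ∘ Equiv.swap j k) hjk, h.unwanted_eq hτ hs (e ∘ Equiv.swap j k) hjk.symm,
    Finset.erase_right_comm (a := k) (b := j), hP]
  simp only [Function.comp, Equiv.swap_apply_left, Equiv.swap_apply_right]
  -- In the sum of the four terms the parts in which t_j, t_k face z_{e k} combine to the three-term
  -- relation there, multiplied by σ(x - z_{e j}), and symmetrically with j and k exchanged.
  linear_combination (cexp (π * I * s.mu * l) *
      ∏ i ∈ (Finset.univ.erase j).erase k, sigma τ (s.t i - s.z (e i)) (-l)) *
    (2 * sigma τ (x - s.z (e j)) (-l) * triple (e k)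
      + 2 * sigma τ (x - s.z (e k)) (-l) * triple (e j))

/-- The sum over all e and all j ≠ k is unchanged by exchanging j and k and by composing e with the
transposition (j k). Four copies of it therefore group into the vanishing combinations of
`IsGenericPoint.unwanted_symm`. -/
lemma IsGenericPoint.sum_unwanted (hτ : 0 < τ.im) (hs : IsBetheSolution τ s)
    (h : IsGenericPoint τ s x l) (J : Fin (2 * m) → Fin 2) :
    ∑ e : Fin m ≃ {i // J i = 1}, ∑ j, ∑ k ∈ Finset.univ.erase j,
      unwanted τ s x l (fun i => e i) j k = 0 := by
  set Y : (Fin m ≃ {i // J i = 1}) → Fin m → Fin m → ℂ := fun e j k =>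
    if j = k then 0 else unwanted τ s x l (fun i => e i) j k with hY
  have h1 : ∀ e : Fin m ≃ {i // J i = 1}, ∑ j, ∑ k ∈ Finset.univ.erase j,
      unwanted τ s x l (fun i => e i) j k = ∑ j, ∑ k, Y e j k := fun e =>
    Finset.sum_congr rfl fun j _ => by
      rw [← Finset.add_sum_erase _ (fun k => Y e j k) (Finset.mem_univ j)]
      simp only [hY, if_true, zero_add]
      exact Finset.sum_congr rfl fun k hk => by rw [if_neg (Finset.ne_of_mem_erase hk).symm]
  simp_rw [h1]
  set Z := ∑ e, ∑ j, ∑ k, Y e j k with hZ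
  have z1 : Z = ∑ j, ∑ k, ∑ e, Y e j k := by
    rw [hZ, Finset.sum_comm]
    exact Finset.sum_congr rfl fun j _ => Finset.sum_comm
  have z2 : Z = ∑ j, ∑ k, ∑ e, Y e k j := by
    rw [z1, Finset.sum_comm]
  have hswap : ∀ (F : (Fin m ≃ {i // J i = 1}) → ℂ) (j k : Fin m),
      ∑ e, F e = ∑ e : Fin m ≃ {i // J i = 1}, F ((Equiv.swap j k).trans e) := fun F j k =>
    (Fintype.sum_equiv (Equiv.equivCongr (Equiv.swap j k) (Equiv.refl _)) _ _ fun e => rfl).symm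
  have z3 : Z = ∑ j, ∑ k, ∑ e : Fin m ≃ {i // J i = 1}, Y ((Equiv.swap j k).trans e) j k := by
    rw [z1]
    exact Finset.sum_congr rfl fun j _ => Finset.sum_congr rfl fun k _ => hswap _ j k
  have z4 : Z = ∑ j, ∑ k, ∑ e : Fin m ≃ {i // J i = 1}, Y ((Equiv.swap j k).trans e) k j := by
    rw [z2]
    exact Finset.sum_congr rfl fun j _ => Finset.sum_congr rfl fun k _ => hswap _ j k
  have : Z + Z + Z + Z = 0 := by
    conv_lhs => rw [show Z + Z + Z + Z = (∑ j, ∑ k, ∑ e, Y e j k) + (∑ j, ∑ k, ∑ e, Y e k j) +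
      (∑ j, ∑ k, ∑ e : Fin m ≃ {i // J i = 1}, Y ((Equiv.swap j k).trans e) j k) +
      (∑ j, ∑ k, ∑ e : Fin m ≃ {i // J i = 1}, Y ((Equiv.swap j k).trans e) k j) by
        rw [← z1, ← z2, ← z3, ← z4]]
    simp_rw [← Finset.sum_add_distrib]
    refine Finset.sum_eq_zero fun j _ => Finset.sum_eq_zero fun k _ =>
      Finset.sum_eq_zero fun e _ => ?_
    by_cases hjk : j = k
    · simp [hY, hjk]
    · simp only [hY, if_neg hjk, if_neg (Ne.symm hjk)]
      exact h.unwanted_symm hτ hs (fun i => e i) hjk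
  have h4 : (4 : ℂ) * Z = 0 := by linear_combination this
  simpa using h4

end bethe

end EllipticBethe

namespace EllipticBethe

open Real Complex Filter Topology

/-! ### The action on the Bethe vector at generic points -/

section eigen

variable {τ : ℂ} {m : ℕ} {s : BetheData m} {x l : ℂ}

/-- The eigenvalue `v' + v²`, where `v = πiμ + ∑_j ρ(x - t_j) - ½ ∑_a ρ(x - z_a)`. -/
noncomputable def betheEigen (τ : ℂ) {m : ℕ} (s : BetheData m) (x : ℂ) : ℂ :=
  ∑ j, deriv (rho τ) (x - s.t j) - (∑ a, deriv (rho τ) (x - s.z a)) / 2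
    + (∑ j, rho τ (x - s.t j) - (-2 * π * I * s.mu + ∑ a, rho τ (x - s.z a)) / 2) ^ 2

lemma sum_sign_mul {J : Fin (2 * m) → Fin 2} (e : Fin m ≃ {i // J i = 1})
    (g : Fin (2 * m) → ℂ) : ∑ k, (if J k = 0 then 1 / 2 else -1 / 2) * g k =
      (∑ k, if J k = 0 then g k else 0) / 2 - (∑ j, g (e j)) / 2 := by
  have h1 := sum_eq_sum_add_sum_equiv e fun k => (if J k = 0 then 1 / 2 else -1 / 2) * g k
  rw [h1, Finset.sum_div, Finset.sum_div, sub_eq_add_neg, ← Finset.sum_neg_distrib]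
  congr 1
  · refine Finset.sum_congr rfl fun k _ => ?_
    by_cases h : J k = 0
    · simp only [h, if_true]; ring
    · simp only [h, if_false]; ring
  · refine Finset.sum_congr rfl fun j _ => ?_
    have : ¬ J (e j) = 0 := by rw [(e j).2]; decide
    rw [if_neg this]
    ring

lemma hasDerivAt_weightRho (hτ : 0 < τ.im) {n : ℕ} (z : Fin n → ℂ) (J : Fin n → Fin 2) {x : ℂ}
    (hx : ∀ k, ¬ InLattice τ (x - z k)) : HasDerivAt (weightRho τ z J)
      (∑ k, (if J k = 0 then 1 / 2 else -1 / 2) * deriv (rho τ) (x - z k)) x := by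
  unfold weightRho
  exact HasDerivAt.fun_sum fun k _ =>
    ((hasDerivAt_rho hτ (hx k)).comp_sub_const x (z k)).const_mul _

/-- For a single bijection e this is the coefficient of its summand in -S₂Ψ minus the eigenvalue.
The equality holds before symmetrization; only the right side, pairs of distinct roots, needs the
sum over e to vanish. -/
lemma IsGenericPoint.term_eq (hτ : 0 < τ.im) (hs : IsBetheSolution τ s)
    (h : IsGenericPoint τ s x l) {J : Fin (2 * m) → Fin 2} (e : Fin m ≃ {i // J i = 1}) :
    betheLogDeriv τ s (fun j => e j) l ^ 2
      + ∑ j, (deriv (rho τ) (s.t j - s.z (e j) - l) - deriv (rho τ) l)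
      - 2 * weightRho τ s.z J x * betheLogDeriv τ s (fun j => e j) l
      + (weightRho τ s.z J x ^ 2 + deriv (weightRho τ s.z J) x)
      + (∑ i, if J i = 0 then (deriv (rho τ) l - deriv (rho τ) (x - s.z i) +
          ∑ j, betheDelta τ s x l j (e j) * (rho τ (x - s.z i) - rho τ (s.t j - s.z i) + rho τ l
            + rho τ (s.t j - x - l))) else 0)
      - betheEigen τ s x =
    ∑ j, ∑ k ∈ Finset.univ.erase j, betheDelta τ s x l j (e j) * (betheDelta τ s x l k (e k)
      - 2 * rho τ (s.t k - x) - 2 * rho τ (s.t j - s.t k) + rho τ (s.t j - s.z (e k))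
      - rho τ (x - s.z (e k)) + rho τ l + rho τ (s.t j - x - l)) := by
  set A := ∑ i, if J i = 0 then rho τ (x - s.z i) else 0 with hA
  set A' := ∑ i, if J i = 0 then deriv (rho τ) (x - s.z i) else 0 with hA'
  set U := ∑ j, rho τ (x - s.z (e j)) with hU
  set U' := ∑ j, deriv (rho τ) (x - s.z (e j)) with hU'
  set Aj : Fin m → ℂ := fun j => ∑ i, if J i = 0 then rho τ (s.t j - s.z i) else 0 with hAj
  set Uj : Fin m → ℂ := fun j => ∑ k, rho τ (s.t j - s.z (e k)) with hUj
  set Bj : Fin m → ℂ := fun j => ∑ k ∈ Finset.univ.erase j, rho τ (s.t j - s.t k) with hBj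
  set δ : Fin m → ℂ := fun j => betheDelta τ s x l j (e j) with hδ
  set R := ∑ j, rho τ (s.t j - x) with hR
  set R' := ∑ j, deriv (rho τ) (s.t j - x) with hR'
  set Q := ∑ j, rho τ (s.t j - s.z (e j) - l) with hQ
  set Q' := ∑ j, deriv (rho τ) (s.t j - s.z (e j) - l) with hQ'
  have w1 : weightRho τ s.z J x = A / 2 - U / 2 := sum_sign_mul e _
  have w2 : deriv (weightRho τ s.z J) x = A' / 2 - U' / 2 := by
    rw [(hasDerivAt_weightRho hτ s.z J h.xz).deriv]
    exact sum_sign_mul e _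
  have w3 : ∑ j, rho τ (x - s.t j) = -R := by
    rw [hR, ← Finset.sum_neg_distrib]
    exact Finset.sum_congr rfl fun j _ => by rw [← rho_neg, neg_sub]
  have w4 : ∑ j, deriv (rho τ) (x - s.t j) = R' :=
    Finset.sum_congr rfl fun j _ => by rw [← deriv_rho_neg, neg_sub]
  have w5 : ∑ a, rho τ (x - s.z a) = A + U := sum_eq_sum_add_sum_equiv e _
  have w6 : ∑ a, deriv (rho τ) (x - s.z a) = A' + U' := sum_eq_sum_add_sum_equiv e _
  have w7 : betheLogDeriv τ s (fun j => e j) l = π * I * s.mu - Q - m * rho τ l := by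
    rw [betheLogDeriv, Finset.sum_add_distrib, Finset.sum_const, Finset.card_univ, Fintype.card_fin,
      nsmul_eq_mul]
    ring
  have w8 : ∑ j, (deriv (rho τ) (s.t j - s.z (e j) - l) - deriv (rho τ) l) =
      Q' - m * deriv (rho τ) l := by
    rw [Finset.sum_sub_distrib, Finset.sum_const, Finset.card_univ, Fintype.card_fin, nsmul_eq_mul]
  have w9 : ∑ j, δ j = U + R - m * rho τ l - Q := by
    simp only [hδ, betheDelta]
    rw [Finset.sum_sub_distrib, Finset.sum_sub_distrib, Finset.sum_add_distrib, Finset.sum_const,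
      Finset.card_univ, Fintype.card_fin, nsmul_eq_mul]
  -- The Bethe equations, with the places split into those of v_1 (`Aj`) and those of v_2 (`Uj`).
  -- They replace -2`Bj` + `Uj`, which comes from the pairs of roots, by 2πiμ - `Aj`, and the
  -- hopping term contains the same -`Aj`.
  have bae : ∀ j, 2 * π * I * s.mu = Aj j + Uj j - 2 * Bj j := fun j => by
    have h1 := hs.bethe j
    rw [sum_eq_sum_add_sum_equiv e] at h1
    linear_combination h1
  have w10 : (∑ i, if J i = 0 then (deriv (rho τ) l - deriv (rho τ) (x - s.z i) +
      ∑ j, δ j * (rho τ (x - s.z i) - rho τ (s.t j - s.z i) + rho τ l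
        + rho τ (s.t j - x - l))) else 0) = m * deriv (rho τ) l - A' +
      ∑ j, δ j * (A - Aj j + m * (rho τ l + rho τ (s.t j - x - l))) := by
    have hm := sum_if_zero_one e
    have e1 : ∀ j, δ j * (A - Aj j + m * (rho τ l + rho τ (s.t j - x - l))) =
        ∑ i, if J i = 0 then δ j * (rho τ (x - s.z i) - rho τ (s.t j - s.z i) + rho τ l
          + rho τ (s.t j - x - l)) else 0 := fun j => by
      rw [← hm, hA, hAj, ← Finset.sum_sub_distrib, Finset.sum_mul, ← Finset.sum_add_distrib,
        Finset.mul_sum]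
      refine Finset.sum_congr rfl fun i _ => ?_
      split_ifs <;> ring
    simp_rw [e1]
    rw [Finset.sum_comm, ← hm, Finset.sum_mul, hA', ← Finset.sum_sub_distrib,
      ← Finset.sum_add_distrib]
    refine Finset.sum_congr rfl fun i _ => ?_
    split_ifs with hi
    · ring
    · simp
  have inner : ∀ j, ∑ k ∈ Finset.univ.erase j, δ j * (δ k
      - 2 * rho τ (s.t k - x) - 2 * rho τ (s.t j - s.t k) + rho τ (s.t j - s.z (e k))
      - rho τ (x - s.z (e k)) + rho τ l + rho τ (s.t j - x - l)) =
      δ j * (∑ k, δ k - 2 * R - 2 * Bj j + Uj j - U + m * (rho τ l + rho τ (s.t j - x - l)))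
      + deriv (rho τ) (s.t j - s.z (e j) - l) - deriv (rho τ) (s.t j - x) := fun j => by
    have s1 := Finset.add_sum_erase _ δ (Finset.mem_univ j)
    have s2 := Finset.add_sum_erase _ (fun k => rho τ (s.t k - x)) (Finset.mem_univ j)
    have s3 := Finset.add_sum_erase _ (fun k => rho τ (s.t j - s.z (e k))) (Finset.mem_univ j)
    have s4 := Finset.add_sum_erase _ (fun k => rho τ (x - s.z (e k))) (Finset.mem_univ j)
    have s5 := Finset.add_sum_erase _ (fun _ => (1 : ℂ)) (Finset.mem_univ j)
    have hm1 : ∑ _k : Fin m, (1 : ℂ) = m := by simp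
    rw [hm1] at s5
    rw [← Finset.mul_sum]
    have s6 : ∑ k ∈ Finset.univ.erase j, (δ k
      - 2 * rho τ (s.t k - x) - 2 * rho τ (s.t j - s.t k) + rho τ (s.t j - s.z (e k))
      - rho τ (x - s.z (e k)) + rho τ l + rho τ (s.t j - x - l)) =
      ∑ k ∈ Finset.univ.erase j, δ k - 2 * ∑ k ∈ Finset.univ.erase j, rho τ (s.t k - x)
      - 2 * Bj j + ∑ k ∈ Finset.univ.erase j, rho τ (s.t j - s.z (e k))
      - ∑ k ∈ Finset.univ.erase j, rho τ (x - s.z (e k))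
      + (∑ k ∈ Finset.univ.erase j, (1 : ℂ)) * (rho τ l + rho τ (s.t j - x - l)) := by
      simp only [hBj, Finset.mul_sum, Finset.sum_mul, ← Finset.sum_sub_distrib,
        ← Finset.sum_add_distrib]
      exact Finset.sum_congr rfl fun k _ => by ring
    rw [s6]
    -- The term k = j, added to complete the sum over k, is a difference of values of ρ' by the
    -- diagonal identity.
    have dg := h.diagonal hτ hs j (e j)
    change δ j * (δ j - 2 * rho τ (s.t j - x) + rho τ (s.t j - s.z (e j)) - rho τ (x - s.z (e j))
      + rho τ l + rho τ (s.t j - x - l)) + deriv (rho τ) (s.t j - s.z (e j) - l)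
      - deriv (rho τ) (s.t j - x) = 0 at dg
    linear_combination δ j * (s1 - 2 * s2 + s3 - s4 + (rho τ l + rho τ (s.t j - x - l)) * s5) - dg
  have total : ∑ j, (δ j * (∑ k, δ k - 2 * R - 2 * Bj j + Uj j - U
      + m * (rho τ l + rho τ (s.t j - x - l)))
      + deriv (rho τ) (s.t j - s.z (e j) - l) - deriv (rho τ) (s.t j - x)) =
      (∑ j, δ j) * (∑ k, δ k - 2 * R + 2 * π * I * s.mu - A - U)
      + ∑ j, δ j * (A - Aj j + m * (rho τ l + rho τ (s.t j - x - l))) + Q' - R' := by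
    rw [Finset.sum_mul, hQ', hR', ← Finset.sum_add_distrib, ← Finset.sum_add_distrib,
      ← Finset.sum_sub_distrib]
    refine Finset.sum_congr rfl fun j _ => ?_
    linear_combination (-δ j) * bae j
  rw [Finset.sum_congr rfl fun j _ => inner j, total, w10, w8, w7, w1, w2, betheEigen, w3, w4, w5,
    w6, w9]
  ring

/-- Multiply `IsGenericPoint.term_eq` by the summand of e and sum over e; the right side vanishes by
`IsGenericPoint.sum_unwanted`. -/
lemma IsGenericPoint.eigen (hτ : 0 < τ.im) (hs : IsBetheSolution τ s)
    (h : IsGenericPoint τ s x l) (J : Fin (2 * m) → Fin 2) :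
    deriv (deriv fun l => betheVec τ s l J) l
      - 2 * weightRho τ s.z J x * deriv (fun l => betheVec τ s l J) l
      + (weightRho τ s.z J x ^ 2 + deriv (weightRho τ s.z J) x) * betheVec τ s l J
      + hopping τ s.z x l (betheVec τ s l) J = betheEigen τ s x * betheVec τ s l J := by
  have hV := isOpen_theta_ne_zero hτ
  have d1 : ∀ l', ¬ InLattice τ l' → HasDerivAt (fun l => betheVec τ s l J)
      (∑ e : Fin m ≃ {i // J i = 1}, deriv (betheTerm τ s fun j => e j) l') l' := fun l' hl' =>
    HasDerivAt.fun_sum fun e _ =>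
      ((differentiableOn_betheTerm hτ s _).differentiableAt (hV.mem_nhds hl')).hasDerivAt
  have d2 : HasDerivAt (deriv fun l => betheVec τ s l J)
      (∑ e : Fin m ≃ {i // J i = 1}, betheTerm τ s (fun j => e j) l *
        (betheLogDeriv τ s (fun j => e j) l ^ 2 +
          ∑ j, (deriv (rho τ) (s.t j - s.z (e j) - l) - deriv (rho τ) l))) l := by
    have hev : (deriv fun l => betheVec τ s l J) =ᶠ[𝓝 l] fun l' =>
        ∑ e : Fin m ≃ {i // J i = 1}, deriv (betheTerm τ s fun j => e j) l' := by
      filter_upwards [hV.mem_nhds h.l_ne] with l' hl' using (d1 l' hl').deriv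
    exact HasDerivAt.congr_of_eventuallyEq (HasDerivAt.fun_sum fun e _ =>
      hasDerivAt_deriv_betheTerm hτ s _ h.l_ne fun j => h.tzl j _) hev
  have d1' : ∑ e : Fin m ≃ {i // J i = 1}, deriv (betheTerm τ s fun j => e j) l =
      ∑ e : Fin m ≃ {i // J i = 1}, betheTerm τ s (fun j => e j) l *
        betheLogDeriv τ s (fun j => e j) l :=
    Finset.sum_congr rfl fun e _ =>
      (hasDerivAt_betheTerm hτ s _ h.l_ne fun j => h.tzl j _).deriv
  have hz := h.sum_unwanted hτ hs J
  have hterm : ∀ e : Fin m ≃ {i // J i = 1}, ∑ j, ∑ k ∈ Finset.univ.erase j,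
      unwanted τ s x l (fun i => e i) j k = betheTerm τ s (fun i => e i) l *
      ∑ j, ∑ k ∈ Finset.univ.erase j, betheDelta τ s x l j (e j) * (betheDelta τ s x l k (e k)
        - 2 * rho τ (s.t k - x) - 2 * rho τ (s.t j - s.t k) + rho τ (s.t j - s.z (e k))
        - rho τ (x - s.z (e k)) + rho τ l + rho τ (s.t j - x - l)) := fun e => by
    simp only [unwanted, Finset.mul_sum]
  rw [Finset.sum_congr rfl fun e _ =>
    (hterm e).trans (congrArg _ (h.term_eq hτ hs e).symm)] at hz
  rw [d2.deriv, (d1 l h.l_ne).deriv, d1', hopping_betheVec hτ hs h J, betheVec]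
  refine sub_eq_zero.1 (Eq.trans ?_ hz)
  rw [Finset.mul_sum _ _ (2 * _), Finset.mul_sum _ _ (_ + _), Finset.mul_sum _ _ (betheEigen _ _ _),
    ← Finset.sum_sub_distrib, ← Finset.sum_add_distrib, ← Finset.sum_add_distrib,
    ← Finset.sum_sub_distrib]
  exact Finset.sum_congr rfl fun e _ => by ring

end eigen

end EllipticBethe

namespace EllipticBethe

open Real Complex Filter Topology

/-! ### Comparison of the two operators -/

section comparison

variable {τ : ℂ} {m : ℕ} {s : BetheData m}

lemma deriv_deriv_eq_of_hasDerivAt_mul {h R : ℂ → ℂ} {x R' : ℂ}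
    (h1 : ∀ᶠ y in 𝓝 x, HasDerivAt h (h y * R y) y) (h2 : HasDerivAt R R' x) :
    deriv (deriv h) x = h x * (R x ^ 2 + R') := by
  have hev : deriv h =ᶠ[𝓝 x] fun y => h y * R y := h1.mono fun y hy => hy.deriv
  rw [hev.deriv_eq, (h1.self_of_nhds.fun_mul h2).deriv]
  ring

lemma eventually_not_inLattice (hτ : 0 < τ.im) {ι : Type*} [Finite ι] {a : ι → ℂ} {x : ℂ}
    (hx : ∀ i, ¬ InLattice τ (x - a i)) : ∀ᶠ y in 𝓝 x, ∀ i, ¬ InLattice τ (y - a i) :=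
  eventually_all.2 fun i => by
    have c : ContinuousAt (fun y => y - a i) x := by fun_prop
    exact c.eventually_mem ((isOpen_theta_ne_zero hτ).mem_nhds (hx i))

lemma hasDerivAt_sum_rho (hτ : 0 < τ.im) {ι : Type*} [Fintype ι] {a : ι → ℂ} {x : ℂ}
    (hx : ∀ i, ¬ InLattice τ (x - a i)) :
    HasDerivAt (fun y => ∑ i, rho τ (y - a i)) (∑ i, deriv (rho τ) (x - a i)) x :=
  HasDerivAt.fun_sum fun i _ => (hasDerivAt_rho hτ (hx i)).comp_sub_const x (a i)

lemma pairPotential_eq_neg_betheEigen (hτ : 0 < τ.im) {f g : ℂ → ℂ} (hf : Differentiable ℂ f)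
    (hg : Differentiable ℂ g) (hft : f = thetaProd τ s.t) (hW : wr f g = betheWr τ s) {x : ℂ}
    (ht : ∀ j, ¬ InLattice τ (x - s.t j)) (hz : ∀ a, ¬ InLattice τ (x - s.z a)) :
    pairPotential f g x = -betheEigen τ s x := by
  have hf1 : ∀ᶠ y in 𝓝 x, HasDerivAt f (f y * ∑ j, rho τ (y - s.t j)) y :=
    (eventually_not_inLattice hτ ht).mono fun y hy => by rw [hft]; exact hasDerivAt_thetaProd hτ hy
  have hW1 : ∀ᶠ y in 𝓝 x, HasDerivAt (wr f g)
      (wr f g y * (-2 * π * I * s.mu + ∑ a, rho τ (y - s.z a))) y :=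
    (eventually_not_inLattice hτ hz).mono fun y hy => by rw [hW]; exact hasDerivAt_betheWr hτ hy
  have hfx : f x ≠ 0 := by
    rw [hft, Ne, thetaProd_eq_zero_iff hτ]
    rintro ⟨j, hj⟩
    exact ht j hj
  have hWx : wr f g x ≠ 0 := by
    rw [hW, Ne, betheWr_eq_zero_iff hτ]
    rintro ⟨a, ha⟩
    exact hz a ha
  have hf2 := deriv_deriv_eq_of_hasDerivAt_mul hf1 (hasDerivAt_sum_rho hτ ht)
  have hW2 := deriv_deriv_eq_of_hasDerivAt_mul hW1 ((hasDerivAt_sum_rho hτ hz).const_add _)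
  rw [pairPotential_eq_of_logDeriv hf hg hfx hWx hf1.self_of_nhds.deriv hf2
    hW1.self_of_nhds.deriv hW2, betheEigen]

/-! ### Continuity in x and λ, and removal of the genericity assumptions -/

lemma continuousAt_sigma (hτ : 0 < τ.im) {u w : ℂ → ℂ} {y : ℂ} (hu : ContinuousAt u y)
    (hw : ContinuousAt w y) (h1 : ¬ InLattice τ (u y)) (h2 : ¬ InLattice τ (w y)) :
    ContinuousAt (fun y => sigma τ (u y) (w y)) y := by
  have hth := (differentiable_theta hτ).continuous
  rw [← theta_eq_zero_iff hτ] at h1 h2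
  exact (hth.continuousAt.comp (hu.add hw)).div₀
    ((hth.continuousAt.comp hu).mul (hth.continuousAt.comp hw)) (mul_ne_zero h1 h2)

lemma continuousAt_ite_const {p : Prop} [Decidable p] {F : ℂ → ℂ} {y : ℂ}
    (hF : ContinuousAt F y) : ContinuousAt (fun y => if p then F y else 0) y := by
  by_cases hp : p
  · simpa [hp] using hF
  · simpa [hp] using continuousAt_const

lemma continuousAt_hopping (hτ : 0 < τ.im) {n : ℕ} (z : Fin n → ℂ) {u w : ℂ → ℂ}
    {v : ℂ → TensorPower n} {y : ℂ} (hu : ContinuousAt u y) (hw : ContinuousAt w y)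
    (hv : ∀ J, ContinuousAt (fun y => v y J) y) (h1 : ∀ k, ¬ InLattice τ (u y - z k))
    (h2 : ¬ InLattice τ (w y)) (J : Fin n → Fin 2) :
    ContinuousAt (fun y => hopping τ z (u y) (w y) (v y) J) y := by
  have h2' : ¬ InLattice τ (-w y) := by rwa [inLattice_neg_iff]
  have hs : ∀ k, ContinuousAt (fun y => sigma τ (u y - z k) (-w y)) y := fun k =>
    continuousAt_sigma hτ (hu.sub continuousAt_const) hw.neg (h1 k) h2'
  unfold hopping
  refine tendsto_finsetSum _ fun l _ => continuousAt_ite_const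
    ((continuousAt_sigma hτ (hu.sub continuousAt_const) hw (h1 l) h2).mul
      (((hs l).mul (hv J)).add (tendsto_finsetSum _ fun k _ =>
        continuousAt_ite_const ((hs k).mul (hv _)))))

lemma differentiableOn_rho (hτ : 0 < τ.im) : DifferentiableOn ℂ (rho τ) {x | ¬ InLattice τ x} :=
  fun _ hx => (hasDerivAt_rho hτ hx).differentiableAt.differentiableWithinAt

lemma continuousAt_deriv_rho (hτ : 0 < τ.im) {x : ℂ} (hx : ¬ InLattice τ x) :
    ContinuousAt (deriv (rho τ)) x :=
  ((differentiableOn_rho hτ).deriv (isOpen_theta_ne_zero hτ)).continuousOn.continuousAt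
    ((isOpen_theta_ne_zero hτ).mem_nhds hx)

lemma continuousAt_deriv_weightRho (hτ : 0 < τ.im) {n : ℕ} (z : Fin n → ℂ) (J : Fin n → Fin 2)
    {x : ℂ} (hx : ∀ k, ¬ InLattice τ (x - z k)) : ContinuousAt (deriv (weightRho τ z J)) x := by
  have hev : deriv (weightRho τ z J) =ᶠ[𝓝 x] fun x =>
      ∑ k, (if J k = 0 then 1 / 2 else -1 / 2) * deriv (rho τ) (x - z k) :=
    (eventually_not_inLattice hτ hx).mono fun y hy => (hasDerivAt_weightRho hτ z J hy).deriv
  refine ContinuousAt.congr (tendsto_finsetSum _ fun k _ => continuousAt_const.mul ?_) hev.symm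
  exact ContinuousAt.comp (f := fun x => x - z k) (continuousAt_deriv_rho hτ (hx k)) (by fun_prop)

/-- The negative of the coefficient `S₂(x)` applied to the Bethe function. -/
noncomputable def betheAction (τ : ℂ) {m : ℕ} (s : BetheData m) (J : Fin (2 * m) → Fin 2)
    (x l : ℂ) : ℂ :=
  deriv (deriv fun l => betheVec τ s l J) l
    - 2 * weightRho τ s.z J x * deriv (fun l => betheVec τ s l J) l
    + (weightRho τ s.z J x ^ 2 + deriv (weightRho τ s.z J) x) * betheVec τ s l J
    + hopping τ s.z x l (betheVec τ s l) J

lemma continuousAt_betheAction_left (hτ : 0 < τ.im) (J : Fin (2 * m) → Fin 2) {x l : ℂ}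
    (hx : ∀ a, ¬ InLattice τ (x - s.z a)) (hl : ¬ InLattice τ l) :
    ContinuousAt (fun x => betheAction τ s J x l) x := by
  have h1 : ContinuousAt (weightRho τ s.z J) x := (hasDerivAt_weightRho hτ s.z J hx).continuousAt
  have h2 := continuousAt_deriv_weightRho hτ s.z J hx
  have h3 : ContinuousAt (fun x => hopping τ s.z x l (betheVec τ s l) J) x :=
    continuousAt_hopping hτ s.z (u := fun x => x) (w := fun _ => l)
      (v := fun _ => betheVec τ s l) continuousAt_id continuousAt_const
      (fun _ => continuousAt_const) hx hl J
  exact ((continuousAt_const.sub ((continuousAt_const.mul h1).mul continuousAt_const)).add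
    (((h1.pow 2).add h2).mul continuousAt_const)).add h3

lemma continuousAt_betheAction_right (hτ : 0 < τ.im) (J : Fin (2 * m) → Fin 2) {x l : ℂ}
    (hx : ∀ a, ¬ InLattice τ (x - s.z a)) (hl : ¬ InLattice τ l) :
    ContinuousAt (betheAction τ s J x) l := by
  have hV := isOpen_theta_ne_zero hτ
  have h0 := fun J => differentiableOn_betheVec hτ s J
  have hn := hV.mem_nhds hl
  have c0 := fun J => (h0 J).continuousOn.continuousAt hn
  have c1 := ((h0 J).deriv hV).continuousOn.continuousAt hn
  have c2 := (((h0 J).deriv hV).deriv hV).continuousOn.continuousAt hn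
  exact ((c2.sub (continuousAt_const.mul c1)).add (continuousAt_const.mul (c0 J))).add
    (continuousAt_hopping hτ s.z continuousAt_const continuousAt_id c0 hx hl J)

/-- For fixed x the remaining genericity conditions exclude countably many λ, and both sides are
continuous in λ off the lattice. -/
lemma betheAction_eq_betheEigen (hτ : 0 < τ.im) (hs : IsBetheSolution τ s)
    (J : Fin (2 * m) → Fin 2) {x l : ℂ} (hx : ∀ a, ¬ InLattice τ (x - s.z a))
    (ht : ∀ j, ¬ InLattice τ (x - s.t j)) (hl : ¬ InLattice τ l) :
    betheAction τ s J x l = betheEigen τ s x * betheVec τ s l J := by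
  have hV := isOpen_theta_ne_zero hτ
  refine sub_eq_zero.1 (eqOn_zero_of_countable (F := fun l => betheAction τ s J x l -
    betheEigen τ s x * betheVec τ s l J) (S := (⋃ j, ⋃ a, {l | InLattice τ (l - (s.t j - s.z a))}) ∪
      ⋃ j, {l | InLattice τ (l - (s.t j - x))}) hV (fun l hl => ?_) ?_ ?_ l hl)
  · exact ((continuousAt_betheAction_right hτ J hx hl).sub (continuousAt_const.mul
      ((differentiableOn_betheVec hτ s J).continuousOn.continuousAt
        (hV.mem_nhds hl)))).continuousWithinAt
  · exact (Set.countable_iUnion fun j => Set.countable_iUnion fun a =>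
      countable_inLattice_sub τ _).union (Set.countable_iUnion fun j => countable_inLattice_sub τ _)
  · intro l hl hS
    simp only [Set.mem_union, Set.mem_iUnion, Set.mem_ofPred_eq, not_or, not_exists] at hS
    exact sub_eq_zero.2 (IsGenericPoint.eigen hτ hs
      ⟨hl, hx, fun j => by rw [inLattice_sub_comm]; exact ht j,
        fun j a => by rw [inLattice_sub_comm]; exact hS.1 j a,
        fun j => by rw [inLattice_sub_comm]; exact hS.2 j⟩ J)

lemma wr_ne_zero (hτ : 0 < τ.im) {f g : ℂ → ℂ} (hW : wr f g = betheWr τ s) {x : ℂ}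
    (hx : ∀ a, ¬ InLattice τ (x - s.z a)) : wr f g x ≠ 0 := by
  rw [hW, Ne, betheWr_eq_zero_iff hτ, not_exists]
  exact hx

/-- To reach x = t_j the eigenvalue must be written as the potential of the pair: individual terms
of `betheEigen` have poles there, whereas `pairPotential` is continuous wherever the Wronskian is
nonzero. -/
lemma betheAction_eq_pairPotential (hτ : 0 < τ.im) (hs : IsBetheSolution τ s) {f g : ℂ → ℂ}
    (hf : Differentiable ℂ f) (hg : Differentiable ℂ g) (hft : f = thetaProd τ s.t)
    (hW : wr f g = betheWr τ s) (J : Fin (2 * m) → Fin 2) {x l : ℂ}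
    (hx : ∀ a, ¬ InLattice τ (x - s.z a)) (hl : ¬ InLattice τ l) :
    betheAction τ s J x l = -pairPotential f g x * betheVec τ s l J := by
  have hopen : IsOpen {x | ∀ a, ¬ InLattice τ (x - s.z a)} :=
    isOpen_iff_mem_nhds.2 fun x hx => eventually_not_inLattice hτ hx
  have hopenW : IsOpen {x | wr f g x ≠ 0} :=
    isOpen_compl_singleton.preimage (differentiable_wr hf hg).continuous
  refine sub_eq_zero.1 (eqOn_zero_of_countable (F := fun x => betheAction τ s J x l -
    -pairPotential f g x * betheVec τ s l J) (S := ⋃ j, {x | InLattice τ (x - s.t j)}) hopen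
    (fun x hx => ?_) ?_ ?_ x hx)
  · exact ((continuousAt_betheAction_left hτ J hx hl).sub
      (((continuousOn_pairPotential hf hg).continuousAt
        (hopenW.mem_nhds (wr_ne_zero hτ hW hx))).neg.mul continuousAt_const)).continuousWithinAt
  · exact Set.countable_iUnion fun j => countable_inLattice_sub τ _
  · intro x hx hS
    simp only [Set.mem_iUnion, Set.mem_ofPred_eq, not_exists] at hS
    rw [betheAction_eq_betheEigen hτ hs J hx hS hl,
      pairPotential_eq_neg_betheEigen hτ hf hg hft hW hS hx, neg_neg, sub_self]

/-- The Bethe function does not vanish identically. -/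
lemma exists_betheFun_ne_zero (hτ : 0 < τ.im) (hs : IsBetheSolution τ s) :
    ∃ lam : Fin 2 → ℂ, ¬ InLattice τ (lam 0 - lam 1) ∧ betheFun τ s lam ≠ 0 := by
  by_contra! hcon
  set J : Fin (2 * m) → Fin 2 := fun i => if (i : ℕ) < m then 1 else 0 with hJ
  have e₀ : Fin m ≃ {i // J i = 1} :=
    { toFun := fun j => ⟨⟨j, by omega⟩, by simp [hJ]⟩
      invFun := fun i => ⟨i.1, by
        have := i.2
        by_contra h
        simp [hJ, h] at this⟩
      left_inv := fun j => rfl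
      right_inv := fun i => rfl }
  have hth : ∀ j a, theta τ (s.t j - s.z a) ≠ 0 := fun j a => by
    rw [Ne, theta_eq_zero_iff hτ]
    exact hs.t_ne_z j a
  have hcont := (differentiable_theta hτ).continuous
  -- Up to the exponential, G is θ(-λ)^m times the component of Ψ with v_2 in the first m places. It
  -- extends continuously to λ = 0, where every product is 1 and the value is the number of
  -- bijections.
  set G : ℂ → ℂ := fun l => ∑ e : Fin m ≃ {i // J i = 1},
    ∏ j, theta τ (s.t j - s.z (e j) - l) / theta τ (s.t j - s.z (e j)) with hG
  have hG0 : G 0 ≠ 0 := by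
    have : G 0 = Fintype.card (Fin m ≃ {i // J i = 1}) := by
      simp only [hG, sub_zero, div_self (hth _ _), Finset.prod_const_one, Finset.sum_const,
        Finset.card_univ, nsmul_eq_mul, mul_one]
    rw [this, Nat.cast_ne_zero]
    exact (Fintype.card_pos_iff.2 ⟨e₀⟩).ne'
  refine hG0 (eqOn_zero_of_countable isOpen_univ (F := G) ?_ (countable_inLattice τ)
    (fun l _ hl => ?_) 0 trivial)
  · refine Continuous.continuousOn ?_
    refine continuous_finsetSum _ fun e _ => continuous_finsetProd _ fun j _ => ?_
    exact (hcont.comp (by fun_prop)).div_const _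
  · have h0 := congrFun (hcon ![l, 0] (by simpa using hl)) J
    simp only [betheFun, Matrix.cons_val_zero, Matrix.cons_val_one, sub_zero, Pi.zero_apply,
      mul_eq_zero, Complex.exp_ne_zero, false_or] at h0
    have : G l = theta τ (-l) ^ m * ∑ e : Fin m ≃ {i // J i = 1},
        ∏ j, sigma τ (s.t j - s.z (e j)) (-l) := by
      rw [Finset.mul_sum]
      refine Finset.sum_congr rfl fun e _ => ?_
      have hm : theta τ (-l) ^ m = ∏ _j : Fin m, theta τ (-l) := by simp
      rw [hm, ← Finset.prod_mul_distrib]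
      refine Finset.prod_congr rfl fun j _ => ?_
      have h1 := hth j (e j)
      have h2 : theta τ (-l) ≠ 0 := by
        rw [Ne, theta_eq_zero_iff hτ, inLattice_neg_iff]
        exact hl
      rw [sigma, ← sub_eq_add_neg]
      field_simp
    rw [this, h0, mul_zero]

lemma isFundOpOfSolution_pairOp (hτ : 0 < τ.im) (hs : IsBetheSolution τ s) {f g : ℂ → ℂ}
    (hf : Differentiable ℂ f) (hg : Differentiable ℂ g) (hft : f = thetaProd τ s.t)
    (hW : wr f g = betheWr τ s) : IsFundOpOfSolution τ s (pairOp hf hg) where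
  ne_zero := exists_betheFun_ne_zero hτ hs
  eigen₁ x hx lam hlam := by
    rw [betheFun_eq, rstS1_apply hτ s.z (fun J => differentiableOn_betheVec hτ s J)
      (isWeightZero_betheVec s) hx hlam]
    exact (zero_smul _ _).symm
  eigen₂ x hx lam hlam := by
    ext J
    rw [betheFun_eq, rstS2_apply hτ s.z (fun J => differentiableOn_betheVec hτ s J)
      (isWeightZero_betheVec s) hx hlam]
    refine (congrArg Neg.neg
      (betheAction_eq_pairPotential hτ hs hf hg hft hW J hx hlam)).trans ?_
    rw [neg_mul, neg_neg]
    rfl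

lemma IsFundOpOfSolution.unique {D D' : MonicOp} (hD : IsFundOpOfSolution τ s D)
    (hD' : IsFundOpOfSolution τ s D') {x : ℂ} (hx : ∀ a, ¬ InLattice τ (x - s.z a)) :
    D'.c₁ x = D.c₁ x ∧ D'.c₂ x = D.c₂ x := by
  obtain ⟨lam, hlam, h0⟩ := hD.ne_zero
  exact ⟨smul_left_injective ℂ h0 ((hD'.eigen₁ x hx lam hlam).symm.trans (hD.eigen₁ x hx lam hlam)),
    smul_left_injective ℂ h0 ((hD'.eigen₂ x hx lam hlam).symm.trans (hD.eigen₂ x hx lam hlam))⟩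

end comparison

end EllipticBethe

/-! ### Proof of the theorem -/

theorem mainTheorem9 (τ : ℂ) (hτ : 0 < τ.im) (m : ℕ) (hm : 0 < m)
    (s : BetheData m) (hs : IsBetheSolution τ s) (hμ : ∀ k : ℤ, s.mu ≠ k) :
    ∃ p : Pairs₁ τ m, (∀ p' : Pairs₁ τ m, IsBeta τ s p' ↔ p' = p) ∧
      ∃ D : MonicOp,
        IsFundOpOfSolution τ s D ∧
        (∀ P : ThetaPair τ m, P.toPoint = p.1 → IsFundOpOfPair P.f P.g D) ∧
        (∀ D' : MonicOp, IsFundOpOfSolution τ s D' →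
          ∀ x, (∀ a, ¬ InLattice τ (x - s.z a)) → D'.c₁ x = D.c₁ x ∧ D'.c₂ x = D.c₂ x) ∧
        (∀ (D' : MonicOp) (P : ThetaPair τ m), P.toPoint = p.1 → IsFundOpOfPair P.f P.g D' →
          ∀ x, (∀ a, ¬ InLattice τ (x - s.z a)) → D'.c₁ x = D.c₁ x ∧ D'.c₂ x = D.c₂ x) := by
  obtain ⟨p, P, hPp, hPf, hPW, hp⟩ := exists_beta hτ hs hμ
  have hW : wr P.f P.g = betheWr τ s := funext hPW
  have hsol := isFundOpOfSolution_pairOp hτ hs P.differentiable_f P.differentiable_g hPf hW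
  -- One representative provides the operator for the entire class. All representatives have
  -- Wronskians without zeros off the z_a + Λ, which is what uniqueness of the coefficients there
  -- requires.
  have hpair : ∀ Q : ThetaPair τ m, Q.toPoint = p.1 →
      IsFundOpOfPair Q.f Q.g (pairOp P.differentiable_f P.differentiable_g) ∧
      ∀ x, (∀ a, ¬ InLattice τ (x - s.z a)) → wr Q.f Q.g x ≠ 0 := fun Q hQ => by
    obtain ⟨k, c, d, hc, hd, hf, hg, hWQ⟩ := ThetaPair.wr_of_toPoint_eq (hPp.trans hQ.symm)
    refine ⟨(isFundOpOfPair_pairOp P.differentiable_f P.differentiable_g).of_exp_mul hc hd hf hg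
      hWQ, fun x hx => ?_⟩
    rw [hWQ]
    exact mul_ne_zero (mul_ne_zero (mul_ne_zero hc hd) (pow_ne_zero 2 (Complex.exp_ne_zero _)))
      (wr_ne_zero hτ hW hx)
  refine ⟨p, hp, pairOp P.differentiable_f P.differentiable_g, hsol, fun Q hQ => (hpair Q hQ).1,
    fun D' hD' x hx => hsol.unique hD' hx, fun D' Q hQ hD' x hx => ?_⟩
  obtain ⟨h1, h2⟩ := hD'.unique Q.differentiable_f Q.differentiable_g ((hpair Q hQ).2 x hx)
  obtain ⟨h3, h4⟩ :=
    (hpair Q hQ).1.unique Q.differentiable_f Q.differentiable_g ((hpair Q hQ).2 x hx)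
  exact ⟨h1.trans h3.symm, h2.trans h4.symm⟩
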